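/- Let $S^\infty$ be the graph on $\mathbb Z^2$ in which two distinct points are adjacent when both of their coordinates differ by at most $1$. For $m,n\ge 1$ let $R(m,n)$ be its subgraph induced by $\{(x,y): 1\le x\le m,\ 1\le y\le n\}$, and for $m,n>1$, $k,l\ge 1$, $m-k\ge 1$, $n-l\ge 1$ let $L(m,n;k,l)$ be the subgraph of $R(m,n)$ obtained by deleting the vertices with $x>m-k$ and $y\le l$. The length of a path is its number of vertices; a longest $(s,t)$-path is a simple path from $s$ to $t$ of maximum length, and $\hat L(G,s,t)$ is its length. A set of vertices is a vertex cut if its removal disconnects the graph. Let $s=(s_x,s_y)$ and $t=(t_x,t_y)$ be distinct vertices of $L(m,n;k,l)$. Consider the conditions (F1) $\{s\}$, $\{t\}$ or $\{s,t\}$ is a vertex cut of $L(m,n;k,l)$; (F4) some vertex of $L(m,n;k,l)$ other than $s$ and $t$ has degree $1$; (F5) up to the isomorphism $(x,y)\mapsto(n+1-y,m+1-x)$ from $L(m,n;k,l)$ onto $L(n,m;l,k)$: $m-k=1$, $n-l=2$, $l=1$, $k\ge 2$, and $\{s,t\}=\{(1,2),(2,3)\}$ or $\{s,t\}=\{(1,3),(2,2)\}$.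 Theorem. (1) There are a fixed algorithm (a program for a random access machine with unit-cost addition, subtraction, comparison and memory access) and a constant $C$ such that, for all $m,n,k,l$ and all distinct vertices $s,t$ of $L(m,n;k,l)$, on input $(m,n,k,l,s,t)$ it outputs the vertex sequence of a longest $(s,t)$-path of $L(m,n;k,l)$ in at most $C\,mn$ steps, storing only integers of absolute value at most $C\,mn$. (2) If none of (F1), (F4), (F5) holds, then $\hat L(L(m,n;k,l),s,t)=mn-kl$. (3) Whenever one of the cases below applies, possibly after exchanging $s$ and $t$ and/or applying the above isomorphism, $\hat L(L(m,n;k,l),s,t)$ equals the value stated there (subgraphs are translated to normal position, and $s$, $t$ with them, where necessary). If one of (F1), (F4), (F5) holds, then at least one of the cases does apply, possibly after such a change. The cases are: (UB1) $m-k=1$, $l>1$, $s_y,t_y\le l$: value $|t_y-s_y|+1$. (UB2) $m-k=n-l=1$, $l>1$, $s_y\le l$, $t_x>1$: value $n-s_y+t_x$. (UB3) $m-k=n-l=1$, $l>1$, $s_x=t_x=1$, $\max\{s_y,t_y\}=n$, and ($k>1$, or $k=1$ and $\min\{s_y,t_y\}>1$): value $|t_y-s_y|+2$. (UB4) $m-k=1$,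 $l>1$, and ($s_y,t_y>l$ and $\{s,t\}$ is not a vertex cut, or $s_y\le l<t_y$, or $t_y\le l<s_y$): value $\hat L(G',s,t)$, where $G'=L(m,n-n';k,l-n')$ arises by deleting the first $n'$ rows, with $n'=l-1$ if $s_y,t_y\ge l$ and $n'=\min\{s_y,t_y\}-1$ otherwise. (UB5) $n-l>1$, $m-k=1$, $k>1$, $s=(1,l+1)$, $t=(2,l+1)$: value $\hat L(R(m,n-l),s,t)$, the rectangle consisting of the last $n-l$ rows. (UB6) Value $\max\{\hat L(G_1,s,t),\hat L(G_2,s,t)\}$, where (a) if $n-l>1$, $m-k=2$, $l>1$, $2\le s_y=t_y\le l$: $G_1=R(m-k,s_y)$ and $G_2=L(m,n-s_y+1;k,l-s_y+1)$ (rows $\ge s_y$); (b) if $m=2$, $n-l>1$, $l+1\le s_y=t_y\le n-1$: $G_1=L(m,s_y;k,l)$ and $G_2=R(m,n-s_y+1)$ (rows $\ge s_y$); (c) if $n-l=2$, $k>1$, $m-k+1\le s_x=t_x\le m-1$: $G_1=L(s_x,n;s_x-(m-k),l)$ and $G_2=R(m-s_x+1,n-l)$ (columns $\ge s_x$, last $n-l$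 rows). (F5) in the orientation displayed above: value $mn-kl-1$. -/

import Mathlib

namespace Supergrid

/-! ### Supergrid graphs -/

/-- The infinite supergrid `S^∞`: two distinct integer points are adjacent when both coordinates
differ by at most one (eight neighbours). -/
def supergrid : SimpleGraph (ℤ × ℤ) where
  Adj u v := u ≠ v ∧ |u.1 - v.1| ≤ 1 ∧ |u.2 - v.2| ≤ 1
  symm := ⟨fun u v h => ⟨h.1.symm, by rw [abs_sub_comm]; exact h.2.1,
    by rw [abs_sub_comm]; exact h.2.2⟩⟩
  loopless := ⟨fun _ h => h.1 rfl⟩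

/-- Vertex set of `R(m, n)`: `m` columns and `n` rows, `(1, 1)` being the upper-left corner. -/
def rect (m n : ℤ) : Set (ℤ × ℤ) := {v | 1 ≤ v.1 ∧ v.1 ≤ m ∧ 1 ≤ v.2 ∧ v.2 ≤ n}

/-- Vertex set of `L(m, n; k, l)`: remove the upper-right `k` by `l` block from `R(m, n)`. -/
def lShape (m n k l : ℤ) : Set (ℤ × ℤ) := {v | v ∈ rect m n ∧ ¬ (m - k < v.1 ∧ v.2 ≤ l)}

/-- An instance `(L(m, n; k, l), s, t)`: admissible parameters and two distinct vertices. -/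
structure Instance (m n k l : ℤ) (s t : ℤ × ℤ) : Prop where
  one_lt_m : 1 < m
  one_lt_n : 1 < n
  one_le_k : 1 ≤ k
  one_le_l : 1 ≤ l
  one_le_m_sub_k : 1 ≤ m - k
  one_le_n_sub_l : 1 ≤ n - l
  s_mem : s ∈ lShape m n k l
  t_mem : t ∈ lShape m n k l
  s_ne_t : s ≠ t

/-! ### Paths.  The length of a path is its number of vertices. -/

/-- `p` is the vertex sequence of a simple path from `s` to `t` in the supergrid graph induced
by `V`. -/
def IsSTPath (V : Set (ℤ × ℤ)) (s t : ℤ × ℤ) (p : List (ℤ × ℤ)) : Prop :=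
  p.head? = some s ∧ p.getLast? = some t ∧ p.Nodup ∧ (∀ v ∈ p, v ∈ V) ∧ p.IsChain supergrid.Adj

/-- `p` is a longest `(s, t)`-path. -/
def IsLongestSTPath (V : Set (ℤ × ℤ)) (s t : ℤ × ℤ) (p : List (ℤ × ℤ)) : Prop :=
  IsSTPath V s t p ∧ ∀ q, IsSTPath V s t q → q.length ≤ p.length

/-- The number of vertices of a longest `(s, t)`-path (for a finite vertex set in which `s` and `t`
are connected). -/
noncomputable def longestLength (V : Set (ℤ × ℤ)) (s t : ℤ × ℤ) : ℕ :=
  sSup {N | ∃ p, IsSTPath V s t p ∧ p.length = N}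

/-! ### The forbidden conditions -/

/-- Removing `S` disconnects the supergrid graph induced by `V`. -/
def IsVertexCut (V S : Set (ℤ × ℤ)) : Prop := ¬ (supergrid.induce (V \ S)).Preconnected

/-- (F1): `s` or `t` is a cut vertex, or `{s, t}` is a vertex cut. -/
def F1 (m n k l : ℤ) (s t : ℤ × ℤ) : Prop :=
  IsVertexCut (lShape m n k l) {s} ∨ IsVertexCut (lShape m n k l) {t} ∨
    IsVertexCut (lShape m n k l) {s, t}

/-- (F4): some vertex other than `s` and `t` has degree one. -/
def F4 (m n k l : ℤ) (s t : ℤ × ℤ) : Prop :=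
  ∃ w : lShape m n k l, ((supergrid.induce (lShape m n k l)).neighborSet w).ncard = 1 ∧
    (w : ℤ × ℤ) ≠ s ∧ (w : ℤ × ℤ) ≠ t

/-- (F5) in its normalized orientation. -/
def F5Std (m n k l : ℤ) (s t : ℤ × ℤ) : Prop :=
  m - k = 1 ∧ n - l = 2 ∧ l = 1 ∧ 2 ≤ k ∧
    (({s, t} : Set (ℤ × ℤ)) = {(1, 2), (2, 3)} ∨ ({s, t} : Set (ℤ × ℤ)) = {(1, 3), (2, 2)})

/-- The reflection in the anti-diagonal, an isomorphism from `L(m, n; k, l)` onto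
`L(n, m; l, k)`. -/
def mirror (m n : ℤ) (v : ℤ × ℤ) : ℤ × ℤ := (n + 1 - v.2, m + 1 - v.1)

/-- (F5), in either of the two isomorphic orientations. -/
def F5 (m n k l : ℤ) (s t : ℤ × ℤ) : Prop :=
  F5Std m n k l s t ∨ F5Std n m l k (mirror m n s) (mirror m n t)

/-! ### The upper bounds -/

/-- (UB1) -/
def UB1 (m _n k l : ℤ) (s t : ℤ × ℤ) : Prop :=
  m - k = 1 ∧ 1 < l ∧ s.2 ≤ l ∧ t.2 ≤ l

/-- (UB2) -/
def UB2 (m n k l : ℤ) (s t : ℤ × ℤ) : Prop :=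
  m - k = 1 ∧ n - l = 1 ∧ 1 < l ∧ s.2 ≤ l ∧ 1 < t.1

/-- (UB3) -/
def UB3 (m n k l : ℤ) (s t : ℤ × ℤ) : Prop :=
  m - k = 1 ∧ n - l = 1 ∧ 1 < l ∧ s.1 = 1 ∧ t.1 = 1 ∧ max s.2 t.2 = n ∧
    (1 < k ∨ (k = 1 ∧ 1 < min s.2 t.2))

/-- (UB4) -/
def UB4 (m n k l : ℤ) (s t : ℤ × ℤ) : Prop :=
  m - k = 1 ∧ 1 < l ∧
    ((l < s.2 ∧ l < t.2 ∧ ¬ IsVertexCut (lShape m n k l) {s, t}) ∨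
      (s.2 ≤ l ∧ l < t.2) ∨ (t.2 ≤ l ∧ l < s.2))

/-- The number `n'` of top rows that are cut off under (UB4). -/
def cutRows (l : ℤ) (s t : ℤ × ℤ) : ℤ :=
  if l ≤ s.2 ∧ l ≤ t.2 then l - 1 else min s.2 t.2 - 1

/-- (UB5) -/
def UB5 (m n k l : ℤ) (s t : ℤ × ℤ) : Prop :=
  1 < n - l ∧ m - k = 1 ∧ 1 < k ∧ s = (1, l + 1) ∧ t = (2, l + 1)

/-- (UB6), first case: `s`, `t` form a full row of the vertical arm of width two. -/
def UB6a (m n k l : ℤ) (s t : ℤ × ℤ) : Prop :=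
  1 < n - l ∧ m - k = 2 ∧ 1 < l ∧ 2 ≤ s.2 ∧ s.2 = t.2 ∧ s.2 ≤ l

/-- (UB6), second case: `m = 2` and `s`, `t` form a full row below the vertical arm. -/
def UB6b (m n _k l : ℤ) (s t : ℤ × ℤ) : Prop :=
  m = 2 ∧ 1 < n - l ∧ l + 1 ≤ s.2 ∧ s.2 = t.2 ∧ s.2 ≤ n - 1

/-- (UB6), third case: `s`, `t` form a full column of the horizontal arm of height two. -/
def UB6c (m n k l : ℤ) (s t : ℤ × ℤ) : Prop :=
  n - l = 2 ∧ 1 < k ∧ m - k + 1 ≤ s.1 ∧ s.1 = t.1 ∧ s.1 ≤ m - 1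

/-- `UpperBound m n k l s t N`: one of the conditions (UB1)-(UB6), (F5) holds in its normalized
orientation and `N` is the bound attached to it.  A subgraph that does not contain the upper-left
corner is translated to normal position, and `s`, `t` with it. -/
inductive UpperBound (m n k l : ℤ) (s t : ℤ × ℤ) : ℤ → Prop
  | ub1 : UB1 m n k l s t → UpperBound m n k l s t (|t.2 - s.2| + 1)
  | ub2 : UB2 m n k l s t → UpperBound m n k l s t (n - s.2 + t.1)
  | ub3 : UB3 m n k l s t → UpperBound m n k l s t (|t.2 - s.2| + 2)
  | ub4 : UB4 m n k l s t → UpperBound m n k l s t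
      (longestLength (lShape m (n - cutRows l s t) k (l - cutRows l s t))
        (s - (0, cutRows l s t)) (t - (0, cutRows l s t)))
  | ub5 : UB5 m n k l s t → UpperBound m n k l s t
      (longestLength (rect m (n - l)) (s - (0, l)) (t - (0, l)))
  | ub6a : UB6a m n k l s t → UpperBound m n k l s t
      (max (longestLength (rect (m - k) s.2) s t)
        (longestLength (lShape m (n - s.2 + 1) k (l - s.2 + 1))
          (s - (0, s.2 - 1)) (t - (0, s.2 - 1))) : ℕ)
  | ub6b : UB6b m n k l s t → UpperBound m n k l s t
      (max (longestLength (lShape m s.2 k l) s t)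
        (longestLength (rect m (n - s.2 + 1)) (s - (0, s.2 - 1)) (t - (0, s.2 - 1))) : ℕ)
  | ub6c : UB6c m n k l s t → UpperBound m n k l s t
      (max (longestLength (lShape s.1 n (s.1 - (m - k)) l) s t)
        (longestLength (rect (m - s.1 + 1) (n - l))
          (s - (s.1 - 1, l)) (t - (s.1 - 1, l))) : ℕ)
  | f5 : F5Std m n k l s t → UpperBound m n k l s t (m * n - k * l - 1)

/-- The same up to exchanging `s` and `t` and up to the reflection of the `L`-shape. -/
def UpperBoundIso (m n k l : ℤ) (s t : ℤ × ℤ) (N : ℤ) : Prop :=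
  UpperBound m n k l s t N ∨ UpperBound m n k l t s N ∨
    UpperBound n m l k (mirror m n s) (mirror m n t) N ∨
    UpperBound n m l k (mirror m n t) (mirror m n s) N

end Supergrid

/-! ### The machine model: a random access machine with unit cost, no multiplication, and bounded
words, programmed by structured programs. -/

namespace RAM

/-- Registers, random access memory and the write-only output tape (the words written so far). -/
structure State where
  reg : ℕ → ℤ
  mem : ℤ → ℤ
  out : List ℤ

/-- Start: the input words lie in registers `0, 1, 2, …`, all else is zero, no output. -/
def State.init (inp : List ℤ) : State where
  reg i := inp.getD i 0
  mem _ := 0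
  out := []

/-- Arithmetic expressions; `load a` reads the memory cell with address `a`. -/
inductive Expr
  | const (c : ℤ)
  | reg (i : ℕ)
  | load (a : Expr)
  | add (a b : Expr)
  | sub (a b : Expr)

/-- Value of an expression. -/
def Expr.eval (σ : State) : Expr → ℤ
  | .const c => c
  | .reg i => σ.reg i
  | .load a => σ.mem (a.eval σ)
  | .add a b => a.eval σ + b.eval σ
  | .sub a b => a.eval σ - b.eval σ

/-- Every operation and every access costs one unit. -/
def Expr.cost : Expr → ℕ
  | .const _ => 1
  | .reg _ => 1
  | .load a => a.cost + 1
  | .add a b => a.cost + b.cost + 1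
  | .sub a b => a.cost + b.cost + 1

/-- Tests. -/
inductive Test
  | lt (a b : Expr)
  | eq (a b : Expr)
  | not (c : Test)
  | and (c d : Test)

/-- Truth of a test. -/
def Test.holds (σ : State) : Test → Prop
  | .lt a b => a.eval σ < b.eval σ
  | .eq a b => a.eval σ = b.eval σ
  | .not c => ¬ c.holds σ
  | .and c d => c.holds σ ∧ d.holds σ

/-- Cost of a test. -/
def Test.cost : Test → ℕ
  | .lt a b => a.cost + b.cost + 1
  | .eq a b => a.cost + b.cost + 1
  | .not c => c.cost + 1
  | .and c d => c.cost + d.cost + 1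

/-- Programs: `assign i e` sets register `i`, `store a e` sets the memory cell with address `a`,
`write e` appends a word to the output, `cond` is if-then-else and `loop` is a while loop. -/
inductive Prog
  | skip
  | assign (i : ℕ) (e : Expr)
  | store (a e : Expr)
  | write (e : Expr)
  | seq (p q : Prog)
  | cond (c : Test) (p q : Prog)
  | loop (c : Test) (p : Prog)

/-- `Exec W p σ T τ`: started in state `σ`, the program `p` halts in state `τ` after exactly `T`
units of time, and every word (or address) it stores or writes has absolute value at most `W`.
An execution that would exceed `W` is stuck. -/
inductive Exec (W : ℤ) : Prog → State → ℕ → State → Prop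
  | skip (σ : State) : Exec W .skip σ 1 σ
  | assign (i : ℕ) (e : Expr) (σ : State) (h : |e.eval σ| ≤ W) :
      Exec W (.assign i e) σ (e.cost + 1)
        { σ with reg := Function.update σ.reg i (e.eval σ) }
  | store (a e : Expr) (σ : State) (ha : |a.eval σ| ≤ W) (h : |e.eval σ| ≤ W) :
      Exec W (.store a e) σ (a.cost + e.cost + 1)
        { σ with mem := Function.update σ.mem (a.eval σ) (e.eval σ) }
  | write (e : Expr) (σ : State) (h : |e.eval σ| ≤ W) :
      Exec W (.write e) σ (e.cost + 1) { σ with out := σ.out ++ [e.eval σ] }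
  | seq {p q : Prog} {σ τ ρ : State} {T U : ℕ} :
      Exec W p σ T τ → Exec W q τ U ρ → Exec W (.seq p q) σ (T + U) ρ
  | cond_true {c : Test} {p q : Prog} {σ τ : State} {T : ℕ} :
      c.holds σ → Exec W p σ T τ → Exec W (.cond c p q) σ (c.cost + T + 1) τ
  | cond_false {c : Test} {p q : Prog} {σ τ : State} {T : ℕ} :
      ¬ c.holds σ → Exec W q σ T τ → Exec W (.cond c p q) σ (c.cost + T + 1) τ
  | loop_false {c : Test} {p : Prog} {σ : State} :
      ¬ c.holds σ → Exec W (.loop c p) σ (c.cost + 1) σ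
  | loop_true {c : Test} {p : Prog} {σ τ ρ : State} {T U : ℕ} :
      c.holds σ → Exec W p σ T τ → Exec W (.loop c p) τ U ρ →
        Exec W (.loop c p) σ (c.cost + T + U + 1) ρ

end RAM

/-!
All three parts of the theorem rest on one explicit construction: for every instance a list of cells
is written down (`Supergrid.longestPath`), it is shown to be a longest path, and a machine is shown
to compute it.

*The construction.*  A rectangle has a Hamiltonian path between two cells unless these separate it
(`ham_rectPath`); the paths are sweeps through rows or columns, glued along a cut.  The central
device for L-shapes is `bump`: a Hamiltonian path of a rectangle is rerouted near the corner
`(1, 1)` so that it also runs through a region attached to the cells `(1, 1)` and `(2, 1)`.  This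
works for all pairs of ends except a few, `BumpOK`, because the corner has only three neighbours, so
that a path passing through it visits two of them just before and after.  If both arms have width
at least two, `bump` and some explicit paths yield a Hamiltonian path of the L-shape, unless the
ends form a full row of a vertical arm of width two, or a full column of a horizontal arm of height
two (`ham_lPath`).

*Longest paths.*  A path cannot visit a set of cells that is attached to the rest by a single cell
and contains no end (`IsSTPath.avoids`), and a path whose ends separate a set of cells from the rest
stays on one side (`IsSTPath.one_side`).  These two facts confine every path to one or two regions,
and in almost all cases these regions have Hamiltonian paths: rectangles, L-shapes with wide arms,
and rectangles enlarged by one cell, which `bump` covers.  The only exception are two diagonal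
neighbours at the left end of a horizontal arm of height two, where exactly one cell has to be
missed (`isLongest_diagonal`).  The reflection `mirror` reduces the case of a horizontal arm of
height one to that of a vertical arm of width one.

*Linear time.*  `RAM.Comp D f` says that some program appends the list `f e` of cells to a stack
in memory, in time and with words linear in the area, for every input `e` in `D`.  This property is
closed under concatenation, case distinctions by linear tests, reflections and translations,
reversal, deletion and insertion of cells, and comparison of lengths, and the rows of a rectangle
have it.  Thus the definition of `longestPath` is followed clause by clause.

*The value.*  A value given by `UpperBound` is compared with the length of a longest path by the same
confinement arguments (`UpperBoundIso.length_eq`).  For the remaining claims one case distinction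
shows that there is a Hamiltonian path, or that a forbidden condition holds and some upper bound
applies (`dichotomy`).  A Hamiltonian path has `m * n - k * l` cells, and it rules out (F1) and (F4),
since removing its ends leaves a path, and each of its inner cells has two neighbours.
-/

namespace Supergrid

/-! ### Hamiltonian paths of finite sets of cells -/

/-- Two cells are equal or adjacent. -/
def Near (u v : ℤ × ℤ) : Prop :=
  u.1 - v.1 ≤ 1 ∧ v.1 - u.1 ≤ 1 ∧ u.2 - v.2 ≤ 1 ∧ v.2 - u.2 ≤ 1

theorem Near.symm {u v : ℤ × ℤ} (h : Near u v) : Near v u := ⟨h.2.1, h.1, h.2.2.2, h.2.2.1⟩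

/-- The cells of the box `[x₁, x₂] × [y₁, y₂]`. -/
def box (x₁ x₂ y₁ y₂ x y : ℤ) : Prop := x₁ ≤ x ∧ x ≤ x₂ ∧ y₁ ≤ y ∧ y ≤ y₂

/-- `p` is a Hamiltonian path from `(a, b)` to `(c, d)` of the cells `(x, y)` with `V x y`.
Consecutive cells are only required to be equal or adjacent, since `p` has no duplicates. -/
structure Ham (V : ℤ → ℤ → Prop) (a b c d : ℤ) (p : List (ℤ × ℤ)) : Prop where
  head : p.head? = some (a, b)
  last : p.getLast? = some (c, d)
  nodup : p.Nodup
  mem : ∀ x y, (x, y) ∈ p ↔ V x y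
  chain : p.IsChain Near

namespace Ham
variable {V V₁ V₂ : ℤ → ℤ → Prop} {a b c d e f g h : ℤ} {p q : List (ℤ × ℤ)}

theorem congr (H : Ham V a b c d p)
    (E : e = a ∧ f = b ∧ g = c ∧ h = d := by omega)
    (hV : ∀ x y, V₁ x y ↔ V x y := by
      first | exact fun _ _ => Iff.rfl | ((try simp only [box] at *); omega)) :
    Ham V₁ e f g h p := by
  obtain ⟨rfl, rfl, rfl, rfl⟩ := E
  exact ⟨H.head, H.last, H.nodup, fun x y => (H.mem x y).trans (hV x y).symm, H.chain⟩

theorem append (H₁ : Ham V₁ a b c d p) (H₂ : Ham V₂ e f g h q)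
    (E : c - e ≤ 1 ∧ e - c ≤ 1 ∧ d - f ≤ 1 ∧ f - d ≤ 1 := by omega)
    (hV : ∀ x y, (V x y ↔ V₁ x y ∨ V₂ x y) ∧ ¬ (V₁ x y ∧ V₂ x y) := by
      (try simp only [box] at *); omega) :
    Ham V a b g h (p ++ q) where
  head := by rw [List.head?_append, H₁.head]; rfl
  last := by rw [List.getLast?_append, H₂.last]; rfl
  nodup := by
    refine List.nodup_append.2 ⟨H₁.nodup, H₂.nodup, ?_⟩
    rintro ⟨x, y⟩ hp ⟨x', y'⟩ hq hh
    obtain ⟨rfl, rfl⟩ := Prod.mk.inj hh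
    exact (hV x y).2 ⟨(H₁.mem _ _).1 hp, (H₂.mem _ _).1 hq⟩
  mem x y := by rw [List.mem_append, H₁.mem, H₂.mem, (hV x y).1]
  chain := by
    refine List.isChain_append.2 ⟨H₁.chain, H₂.chain, ?_⟩
    rw [H₁.last, H₂.head]
    rintro _ ⟨⟩ _ ⟨⟩
    exact E

theorem join {a' b' g' h' : ℤ} (H₁ : Ham V₁ a b c d p) (H₂ : Ham V₂ e f g h q)
    (E : (a' = a ∧ b' = b ∧ g' = g ∧ h' = h) ∧
      c - e ≤ 1 ∧ e - c ≤ 1 ∧ d - f ≤ 1 ∧ f - d ≤ 1 := by omega)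
    (hV : ∀ x y, (V x y ↔ V₁ x y ∨ V₂ x y) ∧ ¬ (V₁ x y ∧ V₂ x y) := by
      (try simp only [box] at *); omega) :
    Ham V a' b' g' h' (p ++ q) :=
  (H₁.append H₂ E.2 hV).congr E.1 fun _ _ => Iff.rfl

theorem reverse (H : Ham V a b c d p) : Ham V c d a b p.reverse where
  head := by rw [List.head?_reverse, H.last]
  last := by rw [List.getLast?_reverse, H.head]
  nodup := List.nodup_reverse.2 H.nodup
  mem x y := by rw [List.mem_reverse, H.mem]
  chain := by
    rw [List.isChain_reverse]
    exact H.chain.imp fun _ _ h => Near.symm h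

theorem map (H : Ham V a b c d p) (φ ψ : ℤ × ℤ → ℤ × ℤ) (h₁ : ∀ v, ψ (φ v) = v)
    (h₂ : ∀ v, φ (ψ v) = v) (hn : ∀ u v, Near u v → Near (φ u) (φ v)) :
    Ham (fun x y => V (ψ (x, y)).1 (ψ (x, y)).2) (φ (a, b)).1 (φ (a, b)).2
      (φ (c, d)).1 (φ (c, d)).2 (p.map φ) where
  head := by rw [List.head?_map, H.head]; rfl
  last := by rw [List.getLast?_map, H.last]; rfl
  nodup := H.nodup.map fun u v h => by rw [← h₁ u, h, h₁]
  mem x y := by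
    rw [← H.mem, List.mem_map]
    constructor
    · rintro ⟨v, hv, h⟩
      rw [← h, h₁]; exact hv
    · intro h
      exact ⟨_, h, h₂ _⟩
  chain := by
    rw [List.isChain_map]
    exact H.chain.imp hn

theorem singleton (a b : ℤ) : Ham (fun x y => x = a ∧ y = b) a b a b [(a, b)] where
  head := rfl
  last := rfl
  nodup := List.nodup_singleton _
  mem x y := by simp
  chain := by simp

/-- Deleting an inner cell whose two neighbours on the path are adjacent. -/
theorem filter_ne (H : Ham V a b c d p) (hs : ¬ (a = e ∧ b = f)) (ht : ¬ (c = e ∧ d = f))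
    (hn : ∀ u v, [u, (e, f), v] <:+: p → Near u v)
    (E : ∀ x y, V₁ x y ↔ V x y ∧ ¬ (x = e ∧ y = f)) :
    Ham V₁ a b c d (p.filter (· ≠ (e, f))) := by
  by_cases hm : (e, f) ∈ p
  · obtain ⟨p₁, p₂, rfl⟩ := List.append_of_mem hm
    have nd := H.nodup
    have hq : (p₁ ++ (e, f) :: p₂).filter (· ≠ (e, f)) = p₁ ++ p₂ := by
      rw [List.nodup_append] at nd
      rw [List.filter_append, List.filter_cons_of_neg (by simp),
        List.filter_eq_self.2, List.filter_eq_self.2]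
      · intro v hv
        have := (List.nodup_cons.1 nd.2.1).1
        simp only [ne_eq, decide_not, Bool.not_eq_true', decide_eq_false_iff_not]
        rintro rfl; exact this hv
      · intro v hv
        have := nd.2.2 v hv (e, f) (by simp)
        simpa using this
    rw [hq]
    rcases List.eq_nil_or_concat p₁ with rfl | ⟨p₁', u, rfl⟩
    · have := H.head; simp at this; omega
    rcases p₂ with _ | ⟨v, p₂'⟩
    · have := H.last; simp at this; omega
    have huv : Near u v := hn u v ⟨p₁', p₂', by simp⟩
    refine ⟨?_, ?_, ?_, ?_, ?_⟩
    · have := H.head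
      rcases p₁' with _ | ⟨z, p₁'⟩ <;> simpa using this
    · have := H.last
      simp only [List.getLast?_append, List.getLast?_cons] at this ⊢
      simpa using this
    · exact nd.sublist (List.Sublist.append_left (List.sublist_cons_self _ _) _)
    · intro x y
      rw [E, ← H.mem]
      have h1 := nd
      rw [List.nodup_append] at h1
      have h2 := (List.nodup_cons.1 h1.2.1).1
      constructor
      · intro hx
        refine ⟨?_, ?_⟩
        · simp only [List.mem_append, List.mem_cons] at hx ⊢; tauto
        · rintro ⟨rfl, rfl⟩
          rcases List.mem_append.1 hx with hx | hx
          · exact h1.2.2 _ hx _ (by simp) rfl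
          · exact h2 hx
      · rintro ⟨hx, hne⟩
        rcases List.mem_append.1 hx with hx | hx
        · exact List.mem_append_left _ hx
        · rcases List.mem_cons.1 hx with hx | hx
          · exact absurd (Prod.mk.inj hx) hne
          · exact List.mem_append_right _ hx
    · have hc := H.chain
      simp only [List.concat_eq_append, List.append_assoc, List.cons_append, List.nil_append,
        List.isChain_append_cons_cons] at hc ⊢
      rw [List.isChain_cons_cons] at hc
      exact ⟨hc.1, huv, hc.2.2.2⟩
  · rw [List.filter_eq_self.2]
    · refine H.congr ⟨rfl, rfl, rfl, rfl⟩ fun x y => ?_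
      rw [E, ← H.mem]
      refine ⟨And.left, fun h => ⟨h, ?_⟩⟩
      rintro ⟨rfl, rfl⟩; exact hm h
    · intro v hv
      simp only [ne_eq, decide_not, Bool.not_eq_true', decide_eq_false_iff_not]
      rintro rfl; exact hm hv

end Ham

/-- Insert `q` into `p` in front of the cell `v`. -/
def insertBefore (v : ℤ × ℤ) (q p : List (ℤ × ℤ)) : List (ℤ × ℤ) :=
  p.takeWhile (· ≠ v) ++ q ++ p.dropWhile (· ≠ v)

theorem takeWhile_dropWhile_ne {p₁ p₂ : List (ℤ × ℤ)} {v : ℤ × ℤ} (h : v ∉ p₁) :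
    (p₁ ++ v :: p₂).takeWhile (· ≠ v) = p₁ ∧ (p₁ ++ v :: p₂).dropWhile (· ≠ v) = v :: p₂ := by
  induction p₁ with
  | nil => simp
  | cons z p ih =>
    simp only [List.mem_cons, not_or] at h
    have := ih h.2
    have hz : z ≠ v := fun e => h.1 e.symm
    simp_all

/-- Inserting a path between two consecutive cells of another path. -/
theorem Ham.insertBefore {V V₁ V₂ : ℤ → ℤ → Prop} {a b c d e f g h : ℤ} {p q : List (ℤ × ℤ)}
    {u v : ℤ × ℤ} (H₁ : Ham V₁ a b c d p) (H₂ : Ham V₂ e f g h q) (hi : [u, v] <:+: p)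
    (h1 : Near u (e, f)) (h2 : Near (g, h) v)
    (E : ∀ x y, (V x y ↔ V₁ x y ∨ V₂ x y) ∧ ¬ (V₁ x y ∧ V₂ x y)) :
    Ham V a b c d (insertBefore v q p) := by
  obtain ⟨p₁, p₂, hp⟩ := hi
  have hp' : (p₁ ++ [u]) ++ v :: p₂ = p := by simpa using hp
  subst hp'
  have nd := H₁.nodup
  have nd' := nd
  rw [List.nodup_append] at nd'
  have hv : v ∉ p₁ ++ [u] := fun hm => nd'.2.2 v hm v (by simp) rfl
  have heq : Supergrid.insertBefore v q ((p₁ ++ [u]) ++ v :: p₂) =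
      (p₁ ++ [u]) ++ (q ++ v :: p₂) := by
    obtain ⟨e1, e2⟩ := takeWhile_dropWhile_ne (p₂ := p₂) hv
    rw [Supergrid.insertBefore, e1, e2, List.append_assoc]
  rw [heq]
  have hd : ∀ z, z ∈ (p₁ ++ [u]) ++ v :: p₂ → z ∉ q := fun z hz hq =>
    (E z.1 z.2).2 ⟨(H₁.mem _ _).1 hz, (H₂.mem _ _).1 hq⟩
  refine ⟨?_, ?_, ?_, ?_, ?_⟩
  · have := H₁.head
    rcases p₁ with _ | ⟨z, p₁'⟩ <;> simpa using this
  · have := H₁.last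
    simp only [List.getLast?_append, List.getLast?_cons] at this ⊢
    simpa using this
  · rw [List.nodup_append]
    refine ⟨nd'.1, ?_, ?_⟩
    · rw [List.nodup_append]
      refine ⟨H₂.nodup, nd'.2.1, ?_⟩
      rintro z hz w hw rfl
      exact hd z (List.mem_append_right _ hw) hz
    · rintro z hz w hw rfl
      rcases List.mem_append.1 hw with hw | hw
      · exact hd z (List.mem_append_left _ hz) hw
      · exact nd'.2.2 z hz z hw rfl
  · intro x y
    rw [(E x y).1, ← H₁.mem, ← H₂.mem]
    simp only [List.mem_append]
    tauto
  · have hc := H₁.chain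
    rw [List.isChain_append] at hc ⊢
    refine ⟨hc.1, ?_, ?_⟩
    · rw [List.isChain_append]
      refine ⟨H₂.chain, hc.2.1, ?_⟩
      rw [H₂.last]
      rintro _ ⟨⟩ _ ⟨⟩
      exact h2
    · rw [List.head?_append, H₂.head]
      simp only [List.getLast?_append, List.getLast?_singleton]
      rintro _ ⟨⟩ _ ⟨⟩
      exact h1

/-! ### Symmetries of the grid -/

/-- Reflection in the diagonal. -/
def tr (p : List (ℤ × ℤ)) : List (ℤ × ℤ) := p.map fun v => (v.2, v.1)

/-- Reflection `x ↦ w + 1 - x` of the columns. -/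
def fx (w : ℤ) (p : List (ℤ × ℤ)) : List (ℤ × ℤ) := p.map fun v => (w + 1 - v.1, v.2)

/-- Reflection `y ↦ h + 1 - y` of the rows. -/
def fy (h : ℤ) (p : List (ℤ × ℤ)) : List (ℤ × ℤ) := p.map fun v => (v.1, h + 1 - v.2)

/-- Translation. -/
def sh (dx dy : ℤ) (p : List (ℤ × ℤ)) : List (ℤ × ℤ) := p.map fun v => (v.1 + dx, v.2 + dy)

namespace Ham
variable {V : ℤ → ℤ → Prop} {a b c d : ℤ} {p : List (ℤ × ℤ)}

theorem tr (H : Ham V a b c d p) : Ham (fun x y => V y x) b a d c (tr p) :=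
  H.map (fun v => (v.2, v.1)) (fun v => (v.2, v.1)) (fun _ => rfl) (fun _ => rfl)
    fun _ _ h => ⟨h.2.2.1, h.2.2.2, h.1, h.2.1⟩

theorem fx (w : ℤ) (H : Ham V a b c d p) :
    Ham (fun x y => V (w + 1 - x) y) (w + 1 - a) b (w + 1 - c) d (fx w p) :=
  H.map (fun v => (w + 1 - v.1, v.2)) (fun v => (w + 1 - v.1, v.2)) (fun v => by simp) (fun v => by simp)
    fun u v h => by simp only [Near] at h ⊢; omega

theorem fy (w : ℤ) (H : Ham V a b c d p) :
    Ham (fun x y => V x (w + 1 - y)) a (w + 1 - b) c (w + 1 - d) (fy w p) :=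
  H.map (fun v => (v.1, w + 1 - v.2)) (fun v => (v.1, w + 1 - v.2)) (fun v => by simp) (fun v => by simp)
    fun u v h => by simp only [Near] at h ⊢; omega

theorem sh (dx dy : ℤ) (H : Ham V a b c d p) :
    Ham (fun x y => V (x - dx) (y - dy)) (a + dx) (b + dy) (c + dx) (d + dy) (sh dx dy p) :=
  H.map (fun v => (v.1 + dx, v.2 + dy)) (fun v => (v.1 - dx, v.2 - dy)) (fun v => by simp) (fun v => by simp)
    fun u v h => by simp only [Near] at h ⊢; omega

end Ham
end Supergrid

namespace Supergrid

/-! ### Hamiltonian paths of rectangles -/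

/-- The row `y` of a rectangle of width `w`, from left to right, or reversed. -/
def row (w y : ℤ) (rev : Bool) : List (ℤ × ℤ) :=
  (List.range w.toNat).map fun i : ℕ => (if rev then w - (i : ℤ) else (i : ℤ) + 1, y)

/-- The first `n` rows of width `w` one after the other, every second one reversed if `alt`. -/
def rows (w : ℤ) (alt : Bool) : ℕ → List (ℤ × ℤ)
  | 0 => []
  | n + 1 => rows w alt n ++ row w (n + 1) (alt && decide (n % 2 = 1))

theorem ham_row {w : ℤ} (y : ℤ) (hw : 1 ≤ w) : Ham (box 1 w y y) 1 y w y (row w y false) := by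
  obtain ⟨n, rfl⟩ : ∃ n : ℕ, w = n + 1 := ⟨(w - 1).toNat, by omega⟩
  clear hw
  have e : ((n : ℤ) + 1).toNat = n + 1 := by omega
  simp only [row, e]
  induction n with
  | zero => exact (Ham.singleton 1 y).congr
  | succ n ih =>
    rw [List.range_succ, List.map_append]
    have H := (ih (by omega)).append (V := box 1 (n + 2) y y) (Ham.singleton (n + 2) y)
    simp only [List.map_singleton, Bool.false_eq_true, if_false] at H ⊢
    have e2 : ((n + 1 : ℕ) : ℤ) + 1 = n + 2 := by push_cast; ring
    rw [e2]
    exact H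

theorem row_true (w y : ℤ) : row w y true = fx w (row w y false) := by
  simp only [row, fx, List.map_map]
  congr 1; funext i; simp

theorem ham_row_true {w : ℤ} (y : ℤ) (hw : 1 ≤ w) :
    Ham (box 1 w y y) w y 1 y (row w y true) := by
  rw [row_true]
  exact ((ham_row y hw).fx w).congr

theorem ham_rows {w : ℤ} (hw : 1 ≤ w) (n : ℕ) : Ham (box 1 w 1 (n + 1)) 1 1
    (if n % 2 = 0 then w else 1) (n + 1) (rows w true (n + 1)) := by
  induction n with
  | zero => exact (ham_row 1 hw).congr (by simp) (by simp)
  | succ n ih =>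
    rw [rows]
    rcases Nat.mod_two_eq_zero_or_one n with h | h
    · have h' : (n + 1) % 2 = 1 := by omega
      have H := ham_row_true (n + 2) hw
      have e : ((n + 1 : ℕ) : ℤ) + 1 = n + 2 := by push_cast; ring
      simp only [h', h, e, decide_true, Bool.and_self, if_true] at ih ⊢
      exact ih.join H
    · have h' : (n + 1) % 2 = 0 := by omega
      have H := ham_row (n + 2) hw
      have e : ((n + 1 : ℕ) : ℤ) + 1 = n + 2 := by push_cast; ring
      have h1 : ¬ n % 2 = 0 := by omega
      simp only [h', h1, e, if_true, if_false] at ih ⊢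
      exact ih.join H

theorem ham_rows_two (n : ℕ) : Ham (box 1 2 1 (n + 1)) 1 1 2 (n + 1) (rows 2 false (n + 1)) := by
  induction n with
  | zero => exact (ham_row 1 (by omega)).congr (by simp) (by simp)
  | succ n ih =>
    rw [rows]
    have H := ham_row (w := 2) (n + 2) (by omega)
    have e : ((n + 1 : ℕ) : ℤ) + 1 = n + 2 := by push_cast; ring
    simp only [e, Bool.false_and] at ih ⊢
    exact ih.join H

theorem ham_rows_odd {w h : ℤ} (hw : 1 ≤ w) (hh : 1 ≤ h) (ho : h % 2 = 1) :
    Ham (box 1 w 1 h) 1 1 w h (rows w true h.toNat) := by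
  obtain ⟨n, rfl⟩ : ∃ n : ℕ, h = n + 1 := ⟨(h - 1).toNat, by omega⟩
  have e : ((n : ℤ) + 1).toNat = n + 1 := by omega
  rw [e]
  exact (ham_rows hw n).congr ⟨rfl, rfl, by rw [if_pos (by omega)], rfl⟩

theorem ham_rows_even {w h : ℤ} (hw : 1 ≤ w) (hh : 1 ≤ h) (ho : ¬ h % 2 = 1) :
    Ham (box 1 w 1 h) 1 1 1 h (rows w true h.toNat) := by
  obtain ⟨n, rfl⟩ : ∃ n : ℕ, h = n + 1 := ⟨(h - 1).toNat, by omega⟩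
  have e : ((n : ℤ) + 1).toNat = n + 1 := by omega
  rw [e]
  exact (ham_rows hw n).congr ⟨rfl, rfl, by rw [if_neg (by omega)], rfl⟩

/-- A Hamiltonian path of the `w` by `h` rectangle from `(1, 1)` to the last row, ending at the
right side if `right` and at the left side otherwise.  It is a boustrophedon, with the first two
rows replaced by a zigzag through the columns where parity requires it. -/
def sweep (w h : ℤ) (right : Bool) : List (ℤ × ℤ) :=
  if decide (h % 2 = 1) = right then rows w true h.toNat
  else tr (rows 2 false w.toNat) ++ sh 0 2 (fx w (rows w true (h - 2).toNat))

/-- The zigzag through the columns of the first two rows. -/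
theorem ham_zigzag {w : ℤ} (hw : 1 ≤ w) :
    Ham (box 1 w 1 2) 1 1 w 2 (tr (rows 2 false w.toNat)) := by
  obtain ⟨n, rfl⟩ : ∃ n : ℕ, w = n + 1 := ⟨(w - 1).toNat, by omega⟩
  have e : ((n : ℤ) + 1).toNat = n + 1 := by omega
  rw [e]
  exact (ham_rows_two n).tr.congr

theorem ham_sweep_right {w h : ℤ} (hw : 1 ≤ w) (hh : 1 ≤ h) :
    Ham (box 1 w 1 h) 1 1 w h (sweep w h true) := by
  unfold sweep
  split_ifs with ho
  · exact ham_rows_odd hw hh (by simpa using ho)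
  · have ho' : ¬ h % 2 = 1 := by simpa using ho
    rcases eq_or_ne h 2 with rfl | h2
    · have := ham_zigzag hw
      simpa [sh, fx, rows] using this
    · exact (ham_zigzag hw).join
        (((ham_rows_even (h := h - 2) hw (by omega) (by omega)).fx w).sh 0 2)

theorem ham_sweep_left {w h : ℤ} (hw : 1 ≤ w) (hh : 2 ≤ h) :
    Ham (box 1 w 1 h) 1 1 1 h (sweep w h false) := by
  unfold sweep
  split_ifs with ho
  · exact ham_rows_even hw (by omega) (by simpa using ho)
  · have ho' : h % 2 = 1 := by simpa using ho
    exact (ham_zigzag hw).join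
      (((ham_rows_odd (h := h - 2) hw (by omega) (by omega)).fx w).sh 0 2)

/-- The transpose of `sweep`: from `(1, 1)` to the last column. -/
def csweep (w h : ℤ) (bottom : Bool) : List (ℤ × ℤ) := tr (sweep h w bottom)

theorem ham_csweep_bottom {w h : ℤ} (hw : 1 ≤ w) (hh : 1 ≤ h) :
    Ham (box 1 w 1 h) 1 1 w h (csweep w h true) :=
  (ham_sweep_right hh hw).tr.congr

theorem ham_csweep_top {w h : ℤ} (hw : 2 ≤ w) (hh : 1 ≤ h) :
    Ham (box 1 w 1 h) 1 1 w 1 (csweep w h false) :=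
  (ham_sweep_left hh hw).tr.congr

/-- A Hamiltonian path of the `w` by `h` rectangle from `(1, 1)` to `(x, h)`. -/
def cornerBottom (w h x : ℤ) : List (ℤ × ℤ) :=
  if x = 1 then sweep w h false
  else if x = w then sweep w h true
  else csweep (x - 1) h true ++ (sh (x - 1) 0 (fy (h - 1) (csweep (w - x + 1) (h - 1) false)) ++
    sh (x - 1) 0 (row (w - x + 1) h true))

theorem ham_cornerBottom {w h x : ℤ} (hh : 2 ≤ h) (hx : 1 ≤ x) (hx' : x ≤ w) :
    Ham (box 1 w 1 h) 1 1 x h (cornerBottom w h x) := by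
  unfold cornerBottom
  split_ifs with h1 h2
  · subst h1; exact ham_sweep_left hx' hh
  · subst h2; exact ham_sweep_right hx (by omega)
  · refine (ham_csweep_bottom (w := x - 1) (h := h) (by omega) (by omega)).join
      (V₂ := box x w 1 h) ((((ham_csweep_top (w := w - x + 1) (h := h - 1) (by omega)
        (by omega)).fy (h - 1)).sh (x - 1) 0).append
      ((ham_row_true (w := w - x + 1) h (by omega)).sh (x - 1) 0))

/-- A Hamiltonian path of the `w` by `h` rectangle from `(1, 1)` to `(x, y)`. -/
def corner (w h x y : ℤ) : List (ℤ × ℤ) :=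
  if w = 1 ∨ h = 1 then rows w true h.toNat
  else if y = 1 then
    csweep (x - 1) h true ++ sh (x - 1) 0 (fy h (sweep (w - x + 1) h false))
  else if y = h then cornerBottom w h x
  else if x = w then tr (cornerBottom h w y)
  else sweep w (y - 1) true ++
    (sh x (y - 1) (fx (w - x) (csweep (w - x) (h - y + 1) true)) ++
      sh 0 (y - 1) (fx x (fy (h - y + 1) (sweep x (h - y + 1) false))))

/-- The admissible ends of a Hamiltonian path of the `w` by `h` rectangle starting at `(1, 1)`. -/
def CornerOK (w h x y : ℤ) : Prop :=
  1 ≤ x ∧ x ≤ w ∧ 1 ≤ y ∧ y ≤ h ∧ (w = 1 → y = h) ∧ (h = 1 → x = w) ∧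
    (x = 1 → y = 1 → w = 1 ∧ h = 1)

theorem ham_corner {w h x y : ℤ} (H : CornerOK w h x y) :
    Ham (box 1 w 1 h) 1 1 x y (corner w h x y) := by
  obtain ⟨h1, h2, h3, h4, h5, h6, h7⟩ := H
  unfold corner
  split_ifs with a1 a2 a3 a4
  · by_cases ho : h % 2 = 1
    · exact (ham_rows_odd (by omega) (by omega) ho).congr
    · exact (ham_rows_even (by omega) (by omega) ho).congr
  · exact (ham_csweep_bottom (w := x - 1) (h := h) (by omega) (by omega)).join
      (((ham_sweep_left (w := w - x + 1) (h := h) (by omega) (by omega)).fy h).sh (x - 1) 0)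
  · exact (ham_cornerBottom (w := w) (h := h) (x := x) (by omega) h1 h2).congr
  · exact (ham_cornerBottom (w := h) (h := w) (x := y) (by omega) h3 h4).tr.congr
  · exact (ham_sweep_right (w := w) (h := y - 1) (by omega) (by omega)).join
      (V₂ := box 1 w y h)
      ((((ham_csweep_bottom (w := w - x) (h := h - y + 1) (by omega) (by omega)).fx (w - x)).sh
        x (y - 1)).append
        ((((ham_sweep_left (w := x) (h := h - y + 1) (by omega) (by omega)).fy (h - y + 1)).fx
          x).sh 0 (y - 1)))

/-- Cut the rectangle after column `j`; cross between the two parts in the first row. -/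
def split (w h a b c d j : ℤ) : List (ℤ × ℤ) :=
  (fx j (corner j h (j + 1 - a) b)).reverse ++ sh j 0 (corner (w - j) h (c - j) d)

theorem ham_split {w h a b c d j : ℤ} (h1 : CornerOK j h (j + 1 - a) b)
    (h2 : CornerOK (w - j) h (c - j) d) : Ham (box 1 w 1 h) a b c d (split w h a b c d j) := by
  have e1 := h1
  have e2 := h2
  simp only [CornerOK] at e1 e2
  exact ((ham_corner h1).fx j).reverse.join ((ham_corner h2).sh j 0)

/-- As `split`, crossing in the last row. -/
def splitB (w h a b c d j : ℤ) : List (ℤ × ℤ) := fy h (split w h a (h + 1 - b) c (h + 1 - d) j)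

theorem ham_splitB {w h a b c d j : ℤ} (h1 : CornerOK j h (j + 1 - a) (h + 1 - b))
    (h2 : CornerOK (w - j) h (c - j) (h + 1 - d)) :
    Ham (box 1 w 1 h) a b c d (splitB w h a b c d j) :=
  ((ham_split h1 h2).fy h).congr

/-- From `(1, b)` up the first column, back through the first `b` rows, then through the rows
below. -/
def around (w h b c d : ℤ) : List (ℤ × ℤ) :=
  tr (row b 1 true) ++ (sh 1 0 (sweep (w - 1) b false) ++ sh 0 b (corner w (h - b) c (d - b)))

theorem ham_around {w h b c d : ℤ} (hb : 2 ≤ b) (hw : 2 ≤ w) (H : CornerOK w (h - b) c (d - b)) :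
    Ham (box 1 w 1 h) 1 b c d (around w h b c d) := by
  have e1 := H
  simp only [CornerOK] at e1
  exact (ham_row_true (w := b) 1 (by omega)).tr.join (V₂ := fun x y => box 1 w 1 h x y ∧
      ¬ (x = 1 ∧ y ≤ b))
    (((ham_sweep_left (w := w - 1) (h := b) (by omega) hb).sh 1 0).append
      ((ham_corner H).sh 0 b))

/-- From `(1, b)` to `(2, b)`. -/
def adjacentInRow (w h b : ℤ) : List (ℤ × ℤ) :=
  [(1, b)] ++ (fy (b - 1) (csweep w (b - 1) false) ++
    (sh 2 (b - 1) (fx (w - 2) (sweep (w - 2) (h - b + 1) true)) ++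
      (sh 0 b (fx 2 (fy (h - b) (sweep 2 (h - b) true))) ++ [(2, b)])))

theorem ham_adjacentInRow {w h b : ℤ} (hw : 3 ≤ w) (h1 : 1 < b) (h2 : b < h) :
    Ham (box 1 w 1 h) 1 b 2 b (adjacentInRow w h b) := by
  refine (Ham.singleton 1 b).join (V₂ := fun x y => box 1 w 1 h x y ∧ ¬ (x = 1 ∧ y = b))
    (((ham_csweep_top (w := w) (h := b - 1) (by omega) (by omega)).fy (b - 1)).append
    (V₂ := fun x y => box 1 w b h x y ∧ ¬ (x = 1 ∧ y = b))
    ((((ham_sweep_right (w := w - 2) (h := h - b + 1) (by omega) (by omega)).fx (w - 2)).sh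
      2 (b - 1)).append
    (V₂ := fun x y => box 1 2 b h x y ∧ ¬ (x = 1 ∧ y = b))
    (((((ham_sweep_right (w := 2) (h := h - b) (by omega) (by omega)).fy (h - b)).fx
      2).sh 0 b).append (Ham.singleton 2 b) ?_) ?_) ?_) ?_
  all_goals omega

/-- From `(1, h - 1)` to `(2, h)`. -/
def diagonalAtCorner (w h : ℤ) : List (ℤ × ℤ) :=
  [(1, h - 1)] ++ (fy (h - 2) (csweep 2 (h - 2) true) ++ (sh 2 0 (sweep (w - 2) h false) ++
    ([(2, h - 1)] ++ ([(1, h)] ++ [(2, h)]))))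

theorem ham_diagonalAtCorner {w h : ℤ} (hw : 3 ≤ w) (hh : 3 ≤ h) :
    Ham (box 1 w 1 h) 1 (h - 1) 2 h (diagonalAtCorner w h) := by
  refine (Ham.singleton 1 (h - 1)).join
    (V₂ := fun x y => box 1 w 1 h x y ∧ ¬ (x = 1 ∧ y = h - 1))
    (((ham_csweep_bottom (w := 2) (h := h - 2) (by omega) (by omega)).fy (h - 2)).append
    (V₂ := fun x y => box 1 w 1 h x y ∧ ¬ (x = 1 ∧ y = h - 1) ∧ ¬ (x ≤ 2 ∧ y ≤ h - 2))
    (((ham_sweep_left (w := w - 2) (h := h) (by omega) (by omega)).sh 2 0).append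
    (V₂ := fun x y => box 1 2 (h - 1) h x y ∧ ¬ (x = 1 ∧ y = h - 1))
    ((Ham.singleton 2 (h - 1)).append (V₂ := box 1 2 h h)
      ((Ham.singleton 1 h).append (Ham.singleton 2 h) ?_) ?_) ?_) ?_) ?_
  all_goals omega

/-- From `(1, b)` to `(w, b)`. -/
def acrossRow (w h b : ℤ) : List (ℤ × ℤ) :=
  [(1, b)] ++ (fy (b - 1) (csweep w (b - 1) false) ++ (sh 1 0 (row (w - 2) b true) ++
    (sh 0 b (csweep w (h - b) false) ++ [(w, b)])))

theorem ham_acrossRow {w h b : ℤ} (hw : 3 ≤ w) (h1 : 1 < b) (h2 : b < h) :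
    Ham (box 1 w 1 h) 1 b w b (acrossRow w h b) := by
  refine (Ham.singleton 1 b).join (V₂ := fun x y => box 1 w 1 h x y ∧ ¬ (x = 1 ∧ y = b))
    (((ham_csweep_top (w := w) (h := b - 1) (by omega) (by omega)).fy (b - 1)).append
    (V₂ := fun x y => box 1 w b h x y ∧ ¬ (x = 1 ∧ y = b))
    (((ham_row_true (w := w - 2) b (by omega)).sh 1 0).append
    (V₂ := fun x y => box 1 w b h x y ∧ ¬ (x < w ∧ y = b))
    (((ham_csweep_top (w := w) (h := h - b) (by omega) (by omega)).sh 0 b).append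
      (Ham.singleton w b) ?_) ?_) ?_) ?_
  all_goals omega

/-- The pairs of ends of a Hamiltonian path of the `w` by `h` rectangle: distinct cells such that
neither one of them nor both together separate the rectangle. -/
def RectOK (w h a b c d : ℤ) : Prop :=
  box 1 w 1 h a b ∧ box 1 w 1 h c d ∧ ¬ (a = c ∧ b = d) ∧
  (w = 1 → (b = 1 ∨ b = h) ∧ (d = 1 ∨ d = h)) ∧ (h = 1 → (a = 1 ∨ a = w) ∧ (c = 1 ∨ c = w)) ∧
  ¬ (w = 2 ∧ b = d ∧ 1 < b ∧ b < h) ∧ ¬ (h = 2 ∧ a = c ∧ 1 < a ∧ a < w)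

/-- The first end lies in the first column and not below the second end, which lies in another
column. -/
def rectEdge (w h b c d : ℤ) : List (ℤ × ℤ) :=
  if b = 1 then corner w h c d
  else if b ≤ h - 2 ∨ c = w then around w h b c d
  else if c = 2 then diagonalAtCorner w h
  else split w h 1 b c d (c - 1)

theorem ham_rectEdge {w h b c d : ℤ} (H : RectOK w h 1 b c d) (hh : 2 ≤ h)
    (hc : 1 < c) (hbd : b < d) : Ham (box 1 w 1 h) 1 b c d (rectEdge w h b c d) := by
  simp only [RectOK, box] at H
  unfold rectEdge
  split_ifs with h1 h2 h3
  · subst h1; exact ham_corner (by simp only [CornerOK]; omega)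
  · exact ham_around (by omega) (by omega) (by simp only [CornerOK]; omega)
  · subst h3
    exact (ham_diagonalAtCorner (w := w) (h := h) (by omega) (by omega)).congr
  · exact ham_split (by simp only [CornerOK]; omega) (by simp only [CornerOK]; omega)

/-- The first end lies to the left of the second one and not below it. -/
def rectOrdered (w h a b c d : ℤ) : List (ℤ × ℤ) :=
  if b = d then
    if b = 1 then splitB w h a b c d a
    else if b = h then split w h a b c d a
    else if 2 ≤ a ∧ a ≤ w - 2 then split w h a b c d a
    else if a = 1 then
      if c = 2 then adjacentInRow w h b
      else if c = w then acrossRow w h b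
      else split w h a b c d (c - 1)
    else (fx w (adjacentInRow w h b)).reverse
  else if 2 ≤ a ∧ a ≤ w - 2 then
    if b = 1 then
      if c = a + 1 ∧ d = h then tr (around h w a d c) else splitB w h a b c d a
    else split w h a b c d a
  else if a = 1 then rectEdge w h b c d
  else (fx w (fy h (rectEdge w h (h + 1 - d) (w + 1 - a) (h + 1 - b)))).reverse

theorem ham_rectOrdered {w h a b c d : ℤ} (H : RectOK w h a b c d) (hh : 2 ≤ h)
    (hac : a < c) (hbd : b ≤ d) : Ham (box 1 w 1 h) a b c d (rectOrdered w h a b c d) := by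
  have H' := H
  simp only [RectOK, box] at H'
  unfold rectOrdered
  split_ifs
  · exact ham_splitB (by simp only [CornerOK]; omega) (by simp only [CornerOK]; omega)
  · exact ham_split (by simp only [CornerOK]; omega) (by simp only [CornerOK]; omega)
  · exact ham_split (by simp only [CornerOK]; omega) (by simp only [CornerOK]; omega)
  · exact (ham_adjacentInRow (w := w) (h := h) (b := b) (by omega) (by omega) (by omega)).congr
  · exact (ham_acrossRow (w := w) (h := h) (b := b) (by omega) (by omega) (by omega)).congr
  · exact ham_split (by simp only [CornerOK]; omega) (by simp only [CornerOK]; omega)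
  · exact ((ham_adjacentInRow (w := w) (h := h) (b := b) (by omega) (by omega) (by omega)).fx
      w).reverse.congr
  · exact (ham_around (w := h) (h := w) (b := a) (c := d) (d := c) (by omega) (by omega)
      (by simp only [CornerOK]; omega)).tr.congr
  · exact ham_splitB (by simp only [CornerOK]; omega) (by simp only [CornerOK]; omega)
  · exact ham_split (by simp only [CornerOK]; omega) (by simp only [CornerOK]; omega)
  · exact (ham_rectEdge (w := w) (h := h) (b := b) (c := c) (d := d)
      (by simp only [RectOK, box]; omega) hh (by omega) (by omega)).congr
  · exact (((ham_rectEdge (w := w) (h := h) (b := h + 1 - d) (c := w + 1 - a) (d := h + 1 - b)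
      (by simp only [RectOK, box]; omega) hh (by omega) (by omega)).fy h).fx w).reverse.congr

/-- The first end is not below the second one, and they lie in different columns. -/
def rectColumns (w h a b c d : ℤ) : List (ℤ × ℤ) :=
  if a < c then rectOrdered w h a b c d else fx w (rectOrdered w h (w + 1 - a) b (w + 1 - c) d)

theorem ham_rectColumns {w h a b c d : ℤ} (H : RectOK w h a b c d) (hh : 2 ≤ h)
    (hac : a ≠ c) (hbd : b ≤ d) : Ham (box 1 w 1 h) a b c d (rectColumns w h a b c d) := by
  have H' := H
  simp only [RectOK, box] at H'
  unfold rectColumns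
  split_ifs
  · exact ham_rectOrdered H hh (by omega) hbd
  · exact ((ham_rectOrdered (w := w) (h := h) (a := w + 1 - a) (b := b) (c := w + 1 - c) (d := d)
      (by simp only [RectOK, box]; omega) hh (by omega) hbd).fx w).congr

/-- The ends lie in different columns. -/
def rectAny (w h a b c d : ℤ) : List (ℤ × ℤ) :=
  if b ≤ d then rectColumns w h a b c d else (rectColumns w h c d a b).reverse

theorem ham_rectAny {w h a b c d : ℤ} (H : RectOK w h a b c d) (hh : 2 ≤ h) (hac : a ≠ c) :
    Ham (box 1 w 1 h) a b c d (rectAny w h a b c d) := by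
  have H' := H
  simp only [RectOK, box] at H'
  unfold rectAny
  split_ifs
  · exact ham_rectColumns H hh hac (by omega)
  · exact (ham_rectColumns (w := w) (h := h) (a := c) (b := d) (c := a) (d := b)
      (by simp only [RectOK, box]; omega) hh (by omega) (by omega)).reverse

/-- A Hamiltonian path of the `w` by `h` rectangle from `(a, b)` to `(c, d)`. -/
def rectPath (w h a b c d : ℤ) : List (ℤ × ℤ) :=
  if w = 1 ∨ h = 1 then
    if a = 1 ∧ b = 1 then rows w true h.toNat else (rows w true h.toNat).reverse
  else if a ≠ c then rectAny w h a b c d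
  else tr (rectAny h w b a d c)

theorem ham_rectPath {w h a b c d : ℤ} (H : RectOK w h a b c d) :
    Ham (box 1 w 1 h) a b c d (rectPath w h a b c d) := by
  have H' := H
  simp only [RectOK, box] at H'
  unfold rectPath
  split_ifs
  · by_cases ho : h % 2 = 1
    · exact (ham_rows_odd (by omega) (by omega) ho).congr
    · exact (ham_rows_even (by omega) (by omega) ho).congr
  · by_cases ho : h % 2 = 1
    · exact (ham_rows_odd (by omega) (by omega) ho).reverse.congr
    · exact (ham_rows_even (by omega) (by omega) ho).reverse.congr
  · exact ham_rectAny H (by omega) (by omega)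
  · exact (ham_rectAny (w := h) (h := w) (a := b) (b := a) (c := d) (d := c)
      (by simp only [RectOK, box]; omega) (by omega) (by omega)).tr.congr

/-- A Hamiltonian path of `[x₁, x₂] × [y₁, y₂]` from `(a, b)` to `(c, d)`. -/
def boxPath (x₁ x₂ y₁ y₂ a b c d : ℤ) : List (ℤ × ℤ) :=
  sh (x₁ - 1) (y₁ - 1) (rectPath (x₂ - x₁ + 1) (y₂ - y₁ + 1)
    (a - x₁ + 1) (b - y₁ + 1) (c - x₁ + 1) (d - y₁ + 1))

theorem ham_boxPath {x₁ x₂ y₁ y₂ a b c d : ℤ} (H : RectOK (x₂ - x₁ + 1) (y₂ - y₁ + 1)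
    (a - x₁ + 1) (b - y₁ + 1) (c - x₁ + 1) (d - y₁ + 1)) :
    Ham (box x₁ x₂ y₁ y₂) a b c d (boxPath x₁ x₂ y₁ y₂ a b c d) :=
  ((ham_rectPath H).sh (x₁ - 1) (y₁ - 1)).congr

end Supergrid

namespace Supergrid

/-! ### Enlarging a rectangle path by an outside path -/

/-- An inner cell of a path has a predecessor and a successor. -/
theorem Ham.exists_between {V : ℤ → ℤ → Prop} {a b c d e f : ℤ} {p : List (ℤ × ℤ)}
    (H : Ham V a b c d p) (hm : V e f) (hs : ¬ (a = e ∧ b = f)) (ht : ¬ (c = e ∧ d = f)) :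
    ∃ u v, [u, (e, f), v] <:+: p := by
  obtain ⟨p₁, p₂, rfl⟩ := List.append_of_mem ((H.mem e f).2 hm)
  rcases List.eq_nil_or_concat p₁ with rfl | ⟨p₁', u, rfl⟩
  · have := H.head; simp at this; omega
  rcases p₂ with _ | ⟨v, p₂'⟩
  · have := H.last; simp at this; omega
  exact ⟨u, v, p₁', p₂', by simp⟩

/-- Two consecutive cells of a path are near each other, distinct, and belong to the path. -/
theorem Ham.of_infix {V : ℤ → ℤ → Prop} {a b c d : ℤ} {p : List (ℤ × ℤ)} {u v : ℤ × ℤ}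
    (H : Ham V a b c d p) (hi : [u, v] <:+: p) :
    V u.1 u.2 ∧ V v.1 v.2 ∧ Near u v ∧ ¬ (u.1 = v.1 ∧ u.2 = v.2) := by
  have hc : [u, v].IsChain Near := H.chain.infix hi
  have hn : [u, v].Nodup := H.nodup.sublist hi.sublist
  refine ⟨(H.mem _ _).1 (hi.subset (by simp)), (H.mem _ _).1 (hi.subset (by simp)),
    by simpa using hc, fun h => ?_⟩
  simp only [List.nodup_cons, List.mem_singleton] at hn
  exact hn.1 (Prod.ext h.1 h.2)

theorem infix_pair_left {u v w : ℤ × ℤ} {p : List (ℤ × ℤ)} (h : [u, v, w] <:+: p) :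
    [u, v] <:+: p := List.IsInfix.trans ⟨[], [w], rfl⟩ h

theorem infix_pair_right {u v w : ℤ × ℤ} {p : List (ℤ × ℤ)} (h : [u, v, w] <:+: p) :
    [v, w] <:+: p := List.IsInfix.trans ⟨[u], [], rfl⟩ h

theorem infix_filter {u v w : ℤ × ℤ} {p : List (ℤ × ℤ)} (h : [u, w, v] <:+: p) (hp : p.Nodup) :
    [u, v] <:+: p.filter (· ≠ w) := by
  have hn : [u, w, v].Nodup := hp.sublist h.sublist
  obtain ⟨p₁, p₂, rfl⟩ := h
  simp only [List.nodup_cons, List.mem_cons, not_or] at hn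
  refine ⟨p₁.filter (· ≠ w), p₂.filter (· ≠ w), ?_⟩
  have h1 : u ≠ w := hn.1.1
  have h2 : v ≠ w := fun e => hn.2.1.1 e.symm
  simp [List.filter_append, h1, h2]

theorem infix_filter_of_ne {u v w : ℤ × ℤ} {p : List (ℤ × ℤ)} (h : [u, v] <:+: p) (hu : u ≠ w)
    (hv : v ≠ w) : [u, v] <:+: p.filter (· ≠ w) := by
  obtain ⟨p₁, p₂, rfl⟩ := h
  refine ⟨p₁.filter (· ≠ w), p₂.filter (· ≠ w), ?_⟩
  simp [List.filter_append, hu, hv]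

theorem infix_iff_second {u v : ℤ × ℤ} {p : List (ℤ × ℤ)} (hp : p.Nodup) :
    [u, v] <:+: p ↔ (p.dropWhile (· ≠ u))[1]? = some v := by
  constructor
  · rintro ⟨p₁, p₂, rfl⟩
    simp only [List.append_assoc, List.cons_append, List.nil_append] at hp ⊢
    have hu : u ∉ p₁ := fun hm => (List.nodup_append.1 hp).2.2 u hm u (by simp) rfl
    rw [(takeWhile_dropWhile_ne hu).2]
    rfl
  · intro h
    have h2 := List.takeWhile_append_dropWhile (p := (· ≠ u)) (l := p)
    rcases hd : p.dropWhile (· ≠ u) with _ | ⟨z, _ | ⟨z', r⟩⟩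
    · rw [hd] at h; simp at h
    · rw [hd] at h; simp at h
    · have h3 : z = u := by
        have := List.head?_dropWhile_not (· ≠ u) p
        rw [hd] at this
        simpa using this
      rw [hd] at h h2
      simp only [List.getElem?_cons_succ, List.getElem?_cons_zero, Option.some.injEq] at h
      subst h3 h
      exact ⟨p.takeWhile (· ≠ z), r, by rw [List.append_assoc]; exact h2⟩

/-- The pairs of ends for which `bump` yields a path.  Apart from the pairs that separate the
rectangle, those are excluded that block both attaching cells `(1, 1)` and `(2, 1)`, and diagonal
pairs in the leftmost square of a rectangle of height two. -/
def BumpOK (w h a b c d : ℤ) : Prop :=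
  2 ≤ w ∧ 2 ≤ h ∧ RectOK w h a b c d ∧
  ¬ (a = 1 ∧ b = 1 ∧ c = 2 ∧ d = 1) ∧ ¬ (a = 2 ∧ b = 1 ∧ c = 1 ∧ d = 1) ∧
  ¬ (h = 2 ∧ 3 ≤ w ∧ (a = 1 ∧ b = 1 ∧ c = 2 ∧ d = 2 ∨ a = 2 ∧ b = 2 ∧ c = 1 ∧ d = 1 ∨
    a = 2 ∧ b = 1 ∧ c = 1 ∧ d = 2 ∨ a = 1 ∧ b = 2 ∧ c = 2 ∧ d = 1))

theorem RectOK.symm {w h a b c d : ℤ} (H : RectOK w h a b c d) : RectOK w h c d a b :=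
  ⟨H.2.1, H.1, fun e => H.2.2.1 ⟨e.1.symm, e.2.symm⟩, fun e => (H.2.2.2.1 e).symm,
    fun e => (H.2.2.2.2.1 e).symm,
    fun e => H.2.2.2.2.2.1 ⟨e.1, e.2.1.symm, e.2.1 ▸ e.2.2.1, e.2.1 ▸ e.2.2.2⟩,
    fun e => H.2.2.2.2.2.2 ⟨e.1, e.2.1.symm, e.2.1 ▸ e.2.2.1, e.2.1 ▸ e.2.2.2⟩⟩

theorem BumpOK.symm {w h a b c d : ℤ} (H : BumpOK w h a b c d) : BumpOK w h c d a b := by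
  obtain ⟨hw, hh, hR, h1, h2, h3⟩ := H
  exact ⟨hw, hh, hR.symm, by clear hR; omega, by clear hR; omega, by clear hR; omega⟩

/-- The part of the rectangle to the right of the first column, without the cell `(2, 1)`. -/
def withoutCorner (w h b c d : ℤ) : List (ℤ × ℤ) :=
  (boxPath 2 w 1 h 2 b c d).filter (· ≠ (2, 1))

theorem ham_withoutCorner {w h b c d : ℤ} (H : RectOK (w - 1) h 1 b (c - 1) d) (hb : b ≠ 1)
    (ht : ¬ (c = 2 ∧ d = 1)) (hw : 3 ≤ w) (hh : 2 ≤ h) :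
    Ham (fun x y => box 2 w 1 h x y ∧ ¬ (x = 2 ∧ y = 1)) 2 b c d (withoutCorner w h b c d) := by
  have H' := H
  simp only [RectOK, box] at H'
  have HP : Ham (box 2 w 1 h) 2 b c d (boxPath 2 w 1 h 2 b c d) :=
    ham_boxPath (by simp only [RectOK, box]; omega)
  refine HP.filter_ne (by omega) (by omega) (fun u v hi => ?_) (fun x y => Iff.rfl)
  have h1 := HP.of_infix (infix_pair_left hi)
  have h2 := HP.of_infix (infix_pair_right hi)
  simp only [box, Near] at h1 h2 ⊢
  omega

/-- `bump` for a path that starts at `(1, 1)` or `(2, 1)`. It turns to the outside path `E` at once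
and returns through the other one of these two cells. If that is `(1, 1)` and there are at least
three columns, then it runs down the first column before it visits the others; if it has to end in
the first column, then it leaves that column above its end, and the rest of the column comes last.
-/
def bumpFrom (w h a c d : ℤ) (E : List (ℤ × ℤ)) : List (ℤ × ℤ) :=
  if a = 1 then [(1, 1)] ++ (E ++ (rectPath w h 2 1 c d).filter (· ≠ (1, 1)))
  else [(2, 1)] ++ (E.reverse ++
    if w = 2 then [(1, 1)] ++
      if c = 1 then boxPath 1 2 2 h 2 2 c d else boxPath 1 2 2 h 1 2 c d
    else if c = 1 then tr (row (d - 1) 1 false) ++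
      ((if d ≤ 3 then withoutCorner w h 2 2 h else withoutCorner w h (d - 1) 2 h) ++
        tr (sh (d - 1) 0 (row (h - d + 1) 1 true)))
    else tr (row h 1 false) ++
      if c = 2 ∧ d = h then withoutCorner w h (h - 1) c d else withoutCorner w h h c d)

section
variable {V V₁ V₂ W : ℤ → ℤ → Prop} {e₁ e₂ f₁ f₂ w h a b c d g₁ g₂ k₁ k₂ : ℤ}
  {E p q : List (ℤ × ℤ)}

/-- Insert the outside path `E` between two paths that partition the rectangle. -/
theorem ham_append_outside (Hp : Ham V₁ a b k₁ k₂ p) (HE : Ham W e₁ e₂ f₁ f₂ E)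
    (Hq : Ham V₂ g₁ g₂ c d q) (n₁ : Near (k₁, k₂) (e₁, e₂)) (n₂ : Near (f₁, f₂) (g₁, g₂))
    (hW : ∀ x y, W x y → ¬ box 1 w 1 h x y)
    (hV : ∀ x y, (box 1 w 1 h x y ↔ V₁ x y ∨ V₂ x y) ∧ ¬ (V₁ x y ∧ V₂ x y) := by
      (try simp only [box] at *); omega) :
    Ham (fun x y => box 1 w 1 h x y ∨ W x y) a b c d (p ++ (E ++ q)) := by
  refine Hp.append (V₂ := fun x y => W x y ∨ V₂ x y) (HE.append Hq n₂ fun x y => ?_) n₁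
    fun x y => ?_
  all_goals have h1 := hW x y; have h2 := hV x y; tauto

theorem ham_bumpFrom_one (HE : Ham W e₁ e₂ f₁ f₂ E) (n₁ : Near (1, 1) (e₁, e₂))
    (n₂ : Near (2, 1) (f₁, f₂)) (hW : ∀ x y, W x y → ¬ box 1 w 1 h x y) (hw : 2 ≤ w) (hh : 2 ≤ h)
    (hc : box 1 w 1 h c d) (h1 : ¬ (c = 1 ∧ d = 1)) (h2 : ¬ (c = 2 ∧ d = 1))
    (h3 : ¬ (h = 2 ∧ 3 ≤ w ∧ c = 2 ∧ d = 2)) :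
    Ham (fun x y => box 1 w 1 h x y ∨ W x y) 1 1 c d (bumpFrom w h 1 c d E) := by
  simp only [box] at hc
  have HP : Ham (box 1 w 1 h) 2 1 c d (rectPath w h 2 1 c d) :=
    ham_rectPath (by simp only [RectOK, box]; omega)
  have HQ := HP.filter_ne (e := 1) (f := 1)
    (V₁ := fun x y => box 1 w 1 h x y ∧ ¬ (x = 1 ∧ y = 1)) (by omega) (by omega)
    (fun u v hi => by
      have h1 := HP.of_infix (infix_pair_left hi)
      have h2 := HP.of_infix (infix_pair_right hi)
      simp only [box, Near] at h1 h2 ⊢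
      omega) (fun x y => Iff.rfl)
  rw [bumpFrom, if_pos rfl]
  exact ham_append_outside (Ham.singleton 1 1) HE HQ n₁ n₂.symm hW fun x y => by
    clear HP HQ HE hW; simp only [box]; omega

theorem ham_bumpFrom_two (HE : Ham W e₁ e₂ f₁ f₂ E) (n₁ : Near (1, 1) (e₁, e₂))
    (n₂ : Near (2, 1) (f₁, f₂)) (hW : ∀ x y, W x y → ¬ box 1 w 1 h x y) (hw : 2 ≤ w) (hh : 2 ≤ h)
    (hc : box 1 w 1 h c d) (h1 : ¬ (c = 1 ∧ d = 1)) (h2 : ¬ (c = 2 ∧ d = 1))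
    (h3 : ¬ (h = 2 ∧ 3 ≤ w ∧ c = 1 ∧ d = 2)) (h4 : ¬ (h = 2 ∧ 3 ≤ w ∧ c = 2 ∧ d = 2)) :
    Ham (fun x y => box 1 w 1 h x y ∨ W x y) 2 1 c d (bumpFrom w h 2 c d E) := by
  simp only [box] at hc
  rw [bumpFrom, if_neg (by omega)]
  refine ham_append_outside (V₂ := fun x y => box 1 w 1 h x y ∧ ¬ (x = 2 ∧ y = 1))
    (g₁ := 1) (g₂ := 1) (Ham.singleton 2 1) HE.reverse ?_ n₂ n₁.symm hW
  split_ifs with a2 a3 a4 a5 a6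
  · subst a2 a3
    exact (Ham.singleton 1 1).join (ham_boxPath (x₁ := 1) (x₂ := 2) (y₁ := 2) (y₂ := h) (a := 2)
        (b := 2) (c := 1) (d := d) (by simp [RectOK, box]; omega))
  · subst a2
    exact (Ham.singleton 1 1).join (ham_boxPath (x₁ := 1) (x₂ := 2) (y₁ := 2) (y₂ := h) (a := 1)
        (b := 2) (c := c) (d := d) (by simp only [RectOK, box]; omega))
  · subst a4
    exact (ham_row (w := d - 1) 1 (by omega)).tr.join
      (V₂ := fun x y => (box 2 w 1 h x y ∧ ¬ (x = 2 ∧ y = 1)) ∨ box 1 1 d h x y)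
      ((ham_withoutCorner (w := w) (h := h) (b := 2) (c := 2) (d := h)
        (by simp only [RectOK, box]; omega) (by omega) (by omega) (by omega) (by omega)).append
        ((ham_row_true (w := h - d + 1) 1 (by omega)).sh (d - 1) 0).tr)
  · subst a4
    exact (ham_row (w := d - 1) 1 (by omega)).tr.join
      (V₂ := fun x y => (box 2 w 1 h x y ∧ ¬ (x = 2 ∧ y = 1)) ∨ box 1 1 d h x y)
      ((ham_withoutCorner (w := w) (h := h) (b := d - 1) (c := 2) (d := h)
        (by simp only [RectOK, box]; omega) (by omega) (by omega) (by omega) (by omega)).append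
        ((ham_row_true (w := h - d + 1) 1 (by omega)).sh (d - 1) 0).tr)
  · exact (ham_row (w := h) 1 (by omega)).tr.join
      (ham_withoutCorner (w := w) (h := h) (b := h - 1) (c := c) (d := d)
        (by simp only [RectOK, box]; omega) (by omega) (by omega) (by omega) (by omega))
  · exact (ham_row (w := h) 1 (by omega)).tr.join
      (ham_withoutCorner (w := w) (h := h) (b := h) (c := c) (d := d)
        (by simp only [RectOK, box]; omega) (by omega) (by omega) (by omega) (by omega))

theorem ham_bumpFrom (HE : Ham W e₁ e₂ f₁ f₂ E) (n₁ : Near (1, 1) (e₁, e₂))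
    (n₂ : Near (2, 1) (f₁, f₂)) (hW : ∀ x y, W x y → ¬ box 1 w 1 h x y)
    (H : BumpOK w h a 1 c d) (ha : a = 1 ∨ a = 2) :
    Ham (fun x y => box 1 w 1 h x y ∨ W x y) a 1 c d (bumpFrom w h a c d E) := by
  obtain ⟨hw, hh, hR, x1, x2, x3⟩ := H
  have hc := hR.2.1
  have hne := hR.2.2.1
  have hcol := hR.2.2.2.2.2.2
  clear hR
  rcases ha with rfl | rfl
  · exact ham_bumpFrom_one HE n₁ n₂ hW hw hh hc (by omega) (by omega) (by omega)
  · exact ham_bumpFrom_two HE n₁ n₂ hW hw hh hc (by omega) (by omega) (by omega) (by omega)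
end

/-- Insert `E` together with the cell `(1, 1)` into a path of a rectangle without `(1, 1)`: next to
`(2, 1)` if one of `(1, 2)`, `(2, 2)` is a neighbour of `(2, 1)` on the path.  Otherwise these two
cells are consecutive, and `(2, 1)` is taken out and inserted between them as well. -/
def bumpInsert (E Q : List (ℤ × ℤ)) : List (ℤ × ℤ) :=
  if [(2, 1), (1, 2)] <:+: Q then insertBefore (1, 2) (E.reverse ++ [(1, 1)]) Q
  else if [(2, 1), (2, 2)] <:+: Q then insertBefore (2, 2) (E.reverse ++ [(1, 1)]) Q
  else if [(1, 2), (2, 1)] <:+: Q then insertBefore (2, 1) ([(1, 1)] ++ E) Q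
  else if [(2, 2), (2, 1)] <:+: Q then insertBefore (2, 1) ([(1, 1)] ++ E) Q
  else if [(1, 2), (2, 2)] <:+: Q then
    insertBefore (2, 2) ([(1, 1)] ++ (E ++ [(2, 1)])) (Q.filter (· ≠ (2, 1)))
  else insertBefore (1, 2) ([(1, 1)] ++ (E ++ [(2, 1)])) (Q.filter (· ≠ (2, 1)))

section
variable {W : ℤ → ℤ → Prop} {e₁ e₂ f₁ f₂ w h a b c d : ℤ} {E : List (ℤ × ℤ)}

theorem partition_prop₁ {B A C : Prop} (h1 : C → ¬ B) (h2 : A → B) :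
    ((B ∨ C) ↔ (B ∧ ¬ A) ∨ (C ∨ A)) ∧ ¬ ((B ∧ ¬ A) ∧ (C ∨ A)) := by
  by_cases A <;> by_cases B <;> by_cases C <;> simp_all

theorem partition_prop₂ {B A C : Prop} (h1 : C → ¬ B) (h2 : A → B) :
    ((B ∨ C) ↔ (B ∧ ¬ A) ∨ (A ∨ C)) ∧ ¬ ((B ∧ ¬ A) ∧ (A ∨ C)) := by
  by_cases A <;> by_cases B <;> by_cases C <;> simp_all

theorem partition_prop₃ {B A A' C : Prop} (h1 : C → ¬ B) (h2 : A → B) (h3 : A' → B) (h4 : A → ¬ A') :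
    ((B ∨ C) ↔ ((B ∧ ¬ A) ∧ ¬ A') ∨ (A ∨ C ∨ A')) ∧ ¬ (((B ∧ ¬ A) ∧ ¬ A') ∧ (A ∨ C ∨ A')) := by
  by_cases A <;> by_cases A' <;> by_cases B <;> by_cases C <;> simp_all

set_option maxHeartbeats 1000000 in
theorem ham_bumpInsert (HE : Ham W e₁ e₂ f₁ f₂ E) (n₁ : Near (1, 1) (e₁, e₂))
    (n₂ : Near (2, 1) (f₁, f₂)) (hW : ∀ x y, W x y → ¬ box 1 w 1 h x y) (hw : 2 ≤ w) (hh : 2 ≤ h)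
    {P : List (ℤ × ℤ)} (HP : Ham (box 1 w 1 h) a b c d P)
    (hs : ¬ ((a = 1 ∨ a = 2) ∧ b = 1)) (ht : ¬ ((c = 1 ∨ c = 2) ∧ d = 1)) :
    Ham (fun x y => box 1 w 1 h x y ∨ W x y) a b c d (bumpInsert E (P.filter (· ≠ (1, 1)))) := by
  have HQ := HP.filter_ne (e := 1) (f := 1)
    (V₁ := fun x y => box 1 w 1 h x y ∧ ¬ (x = 1 ∧ y = 1)) (by omega) (by omega)
    (fun u v hi => by
      have h1 := HP.of_infix (infix_pair_left hi)
      have h2 := HP.of_infix (infix_pair_right hi)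
      simp only [box, Near] at h1 h2 ⊢
      omega) (fun x y => Iff.rfl)
  obtain ⟨u, v, huv⟩ := HP.exists_between (e := 1) (f := 1) (by simp only [box]; omega) (by omega)
    (by omega)
  have hu := HP.of_infix (infix_pair_left huv)
  have hv := HP.of_infix (infix_pair_right huv)
  have hQ := infix_filter huv HP.nodup
  have huv' := HQ.of_infix hQ
  set Q := P.filter (· ≠ (1, 1)) with hQdef
  -- the two neighbours of `(1, 1)` on `P` are consecutive on `Q`
  have key : [(2, 1), (1, 2)] <:+: Q ∨ [(2, 1), (2, 2)] <:+: Q ∨ [(1, 2), (2, 1)] <:+: Q ∨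
      [(2, 2), (2, 1)] <:+: Q ∨ [(1, 2), (2, 2)] <:+: Q ∨ [(2, 2), (1, 2)] <:+: Q := by
    obtain ⟨u1, u2⟩ := u
    obtain ⟨v1, v2⟩ := v
    simp only [box, Near] at hu hv
    have cu : (u1 = 2 ∧ u2 = 1) ∨ (u1 = 1 ∧ u2 = 2) ∨ (u1 = 2 ∧ u2 = 2) := by omega
    have cv : (v1 = 2 ∧ v2 = 1) ∨ (v1 = 1 ∧ v2 = 2) ∨ (v1 = 2 ∧ v2 = 2) := by omega
    rcases cu with ⟨rfl, rfl⟩ | ⟨rfl, rfl⟩ | ⟨rfl, rfl⟩ <;>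
      rcases cv with ⟨rfl, rfl⟩ | ⟨rfl, rfl⟩ | ⟨rfl, rfl⟩ <;>
      first | exact absurd ⟨rfl, rfl⟩ huv'.2.2.2 | simp only [hQ, true_or, or_true]
  have hc₁ : ∀ x y, x = 1 ∧ y = 1 → box 1 w 1 h x y := by simp only [box]; omega
  have hc₂ : ∀ x y, x = 2 ∧ y = 1 → box 1 w 1 h x y := by simp only [box]; omega
  have hc₁₂ : ∀ x y : ℤ, x = 1 ∧ y = 1 → ¬ (x = 2 ∧ y = 1) := by omega
  have HE₁ : Ham (fun x y => W x y ∨ (x = 1 ∧ y = 1)) f₁ f₂ 1 1 (E.reverse ++ [(1, 1)]) :=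
    HE.reverse.append (Ham.singleton 1 1) n₁.symm fun x y =>
      ⟨Iff.rfl, fun h => hW x y h.1 (hc₁ x y h.2)⟩
  have HE₂ : Ham (fun x y => (x = 1 ∧ y = 1) ∨ W x y) 1 1 f₁ f₂ ([(1, 1)] ++ E) :=
    (Ham.singleton 1 1).append HE n₁ fun x y =>
      ⟨Iff.rfl, fun h => hW x y h.2 (hc₁ x y h.1)⟩
  have HE₃ : Ham (fun x y => (x = 1 ∧ y = 1) ∨ W x y ∨ (x = 2 ∧ y = 1)) 1 1 2 1
      ([(1, 1)] ++ (E ++ [(2, 1)])) :=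
    (Ham.singleton 1 1).append (V₂ := fun x y => W x y ∨ (x = 2 ∧ y = 1))
      (HE.append (Ham.singleton 2 1) n₂.symm fun x y =>
        ⟨Iff.rfl, fun h => hW x y h.1 (hc₂ x y h.2)⟩) n₁ fun x y =>
        ⟨Iff.rfl, fun h => h.2.elim (fun h' => hW x y h' (hc₁ x y h.1)) (hc₁₂ x y h.1)⟩
  unfold bumpInsert
  split_ifs with a1 a2 a3 a4 a5
  · exact HQ.insertBefore HE₁ a1 n₂ (by simp [Near]) fun x y => partition_prop₁ (hW x y) (hc₁ x y)
  · exact HQ.insertBefore HE₁ a2 n₂ (by simp [Near]) fun x y => partition_prop₁ (hW x y) (hc₁ x y)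
  · exact HQ.insertBefore HE₂ a3 (by simp [Near]) n₂.symm fun x y => partition_prop₂ (hW x y) (hc₁ x y)
  · exact HQ.insertBefore HE₂ a4 (by simp [Near]) n₂.symm fun x y => partition_prop₂ (hW x y) (hc₁ x y)
  all_goals
    have HQ' := HQ.filter_ne (e := 2) (f := 1)
      (V₁ := fun x y => (box 1 w 1 h x y ∧ ¬ (x = 1 ∧ y = 1)) ∧ ¬ (x = 2 ∧ y = 1))
      (by omega) (by omega) (fun u v hi => by
        have i1 := infix_pair_left hi
        have i2 := infix_pair_right hi
        have h1 := HQ.of_infix i1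
        have h2 := HQ.of_infix i2
        obtain ⟨u1, u2⟩ := u
        obtain ⟨v1, v2⟩ := v
        have hu1 : ¬ (u1 = 1 ∧ u2 = 2) := by rintro ⟨rfl, rfl⟩; exact a3 i1
        have hu2 : ¬ (u1 = 2 ∧ u2 = 2) := by rintro ⟨rfl, rfl⟩; exact a4 i1
        have hv1 : ¬ (v1 = 1 ∧ v2 = 2) := by rintro ⟨rfl, rfl⟩; exact a1 i2
        have hv2 : ¬ (v1 = 2 ∧ v2 = 2) := by rintro ⟨rfl, rfl⟩; exact a2 i2
        simp only [box, Near] at h1 h2 ⊢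
        omega) (fun x y => Iff.rfl)
  · exact HQ'.insertBefore HE₃ (infix_filter_of_ne a5 (by simp) (by simp)) (by simp [Near])
      (by simp [Near])
      fun x y => partition_prop₃ (hW x y) (hc₁ x y) (hc₂ x y) (hc₁₂ x y)
  · have a6 : [(2, 2), (1, 2)] <:+: Q := by simpa only [a1, a2, a3, a4, a5, false_or] using key
    exact HQ'.insertBefore HE₃ (infix_filter_of_ne a6 (by simp) (by simp)) (by simp [Near])
      (by simp [Near])
      fun x y => partition_prop₃ (hW x y) (hc₁ x y) (hc₂ x y) (hc₁₂ x y)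

/-- A Hamiltonian path from `(a, b)` to `(c, d)` of the union of the `w` by `h` rectangle and an
outside region with Hamiltonian path `E`, where `E` starts near `(1, 1)` and ends near `(2, 1)`. -/
def bump (w h a b c d : ℤ) (E : List (ℤ × ℤ)) : List (ℤ × ℤ) :=
  if (a = 1 ∨ a = 2) ∧ b = 1 then bumpFrom w h a c d E
  else if (c = 1 ∨ c = 2) ∧ d = 1 then (bumpFrom w h c a b E).reverse
  else bumpInsert E ((rectPath w h a b c d).filter (· ≠ (1, 1)))

theorem ham_bump (HE : Ham W e₁ e₂ f₁ f₂ E) (n₁ : Near (1, 1) (e₁, e₂))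
    (n₂ : Near (2, 1) (f₁, f₂)) (hW : ∀ x y, W x y → ¬ box 1 w 1 h x y)
    (H : BumpOK w h a b c d) :
    Ham (fun x y => box 1 w 1 h x y ∨ W x y) a b c d (bump w h a b c d E) := by
  unfold bump
  split_ifs with h1 h2
  · obtain ⟨h1, rfl⟩ := h1
    exact ham_bumpFrom HE n₁ n₂ hW H h1
  · obtain ⟨h2, rfl⟩ := h2
    exact (ham_bumpFrom HE n₁ n₂ hW H.symm h2).reverse
  · exact ham_bumpInsert HE n₁ n₂ hW H.1 H.2.1 (ham_rectPath H.2.2.1) h1 h2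
end

end Supergrid

namespace Supergrid

/-! ### Hamiltonian paths of L-shapes with both arms of width at least two -/

instance (w h a b c d : ℤ) : Decidable (RectOK w h a b c d) := by
  unfold RectOK box; infer_instance

instance (w h a b c d : ℤ) : Decidable (BumpOK w h a b c d) := by
  unfold BumpOK; infer_instance

/-- The cells of `L(m, n; k, l)`. -/
def lCells (m n k l x y : ℤ) : Prop := box 1 m 1 n x y ∧ ¬ (m - k < x ∧ y ≤ l)

/-- The ends of a Hamiltonian path of `L(m, n; k, l)`, where `m - k` and `n - l` are at least 2. -/
def LOK (m n k l a b c d : ℤ) : Prop :=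
  2 ≤ m - k ∧ 2 ≤ n - l ∧ 1 ≤ k ∧ 1 ≤ l ∧ lCells m n k l a b ∧ lCells m n k l c d ∧
  ¬ (a = c ∧ b = d) ∧ ¬ (m - k = 2 ∧ b = d ∧ 2 ≤ b ∧ b ≤ l) ∧
  ¬ (n - l = 2 ∧ a = c ∧ m - k + 1 ≤ a ∧ a ≤ m - 1)

theorem LOK.symm {m n k l a b c d : ℤ} (H : LOK m n k l a b c d) : LOK m n k l c d a b := by
  obtain ⟨h1, h2, h3, h4, h5, h6, h7, h8, h9⟩ := H
  exact ⟨h1, h2, h3, h4, h6, h5, by omega, by omega, by omega⟩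

/-- From `(m - 1, b)` to `(m, b)`, where `k = 2` and `l + 1 < b < n`. -/
def armRowPair (m n l b : ℤ) : List (ℤ × ℤ) :=
  [(m - 1, b)] ++ (boxPath (m - 1) m (l + 1) (b - 1) m (b - 1) (m - 1) (l + 1) ++
    (boxPath 1 (m - 2) 1 n (m - 2) (l + 1) (m - 2) n ++
      (boxPath (m - 1) m (b + 1) n (m - 1) n m (b + 1) ++ [(m, b)])))

theorem ham_armRowPair {m n l b : ℤ} (hm : 2 ≤ m - 2) (hl : 1 ≤ l) (h1 : l + 1 < b) (h2 : b < n) :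
    Ham (lCells m n 2 l) (m - 1) b m b (armRowPair m n l b) := by
  refine (Ham.singleton (m - 1) b).join
    (V₂ := fun x y => lCells m n 2 l x y ∧ ¬ (x = m - 1 ∧ y = b))
    ((ham_boxPath (x₁ := m - 1) (x₂ := m) (y₁ := l + 1) (y₂ := b - 1) (a := m) (b := b - 1)
      (c := m - 1) (d := l + 1) (by unfold RectOK box; omega)).append
    (V₂ := fun x y => (box 1 (m - 2) 1 n x y) ∨ box (m - 1) m b n x y ∧ ¬ (x = m - 1 ∧ y = b))
    ((ham_boxPath (x₁ := 1) (x₂ := m - 2) (y₁ := 1) (y₂ := n) (a := m - 2) (b := l + 1)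
      (c := m - 2) (d := n) (by unfold RectOK box; omega)).append
    (V₂ := fun x y => box (m - 1) m b n x y ∧ ¬ (x = m - 1 ∧ y = b))
    ((ham_boxPath (x₁ := m - 1) (x₂ := m) (y₁ := b + 1) (y₂ := n) (a := m - 1) (b := n)
      (c := m) (d := b + 1) (by unfold RectOK box; omega)).append
      (Ham.singleton m b) ?_) ?_ ?_) ?_ ?_) ?_ ?_
  all_goals (try unfold lCells); (try unfold box); omega

/-- Both ends lie in the horizontal arm. -/
def armPath (m n k l a b c d : ℤ) : List (ℤ × ℤ) :=
  if BumpOK (n - l) k (n + 1 - b) (a - (m - k)) (n + 1 - d) (c - (m - k)) then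
    sh (m - k) 0 (tr (fx n (bump (n - l) k (n + 1 - b) (a - (m - k)) (n + 1 - d) (c - (m - k))
      (boxPath 1 n (1 - (m - k)) 0 1 0 2 0))))
  else if BumpOK (n - l) k (b - l) (a - (m - k)) (d - l) (c - (m - k)) then
    sh (m - k) l (tr (bump (n - l) k (b - l) (a - (m - k)) (d - l) (c - (m - k))
      (boxPath (1 - l) (n - l) (1 - (m - k)) 0 1 0 2 0)))
  else if a < c then armRowPair m n l b else (armRowPair m n l b).reverse

theorem ham_armPath {m n k l a b c d : ℤ} (H : LOK m n k l a b c d) (hk : 2 ≤ k)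
    (ha : m - k < a) (hc : m - k < c) :
    Ham (lCells m n k l) a b c d (armPath m n k l a b c d) := by
  obtain ⟨h1, h2, -, h4, h5, h6, h7, -, h9⟩ := H
  unfold armPath
  split_ifs with b1 b2 b3
  · exact (((ham_bump (W := box 1 n (1 - (m - k)) 0) (ham_boxPath (by
      clear h5 h6 h7 h9 b1; unfold RectOK box; omega)) (by simp [Near]) (by simp [Near])
      (by clear h5 h6 h7 h9 b1; simp only [box]; omega) b1).fx n).tr.sh (m - k) 0).congr
      (by clear h5 h6 h7 h9 b1; omega)
      (by clear h5 h6 h7 h9 b1; simp only [lCells, box]; omega)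
  · exact ((ham_bump (W := box (1 - l) (n - l) (1 - (m - k)) 0) (ham_boxPath (by
      clear h5 h6 h7 h9 b1 b2; unfold RectOK box; omega)) (by simp [Near]) (by simp [Near])
      (by clear h5 h6 h7 h9 b1 b2; simp only [box]; omega) b2).tr.sh (m - k) l).congr
      (by clear h5 h6 h7 h9 b1 b2; omega)
      (by clear h5 h6 h7 h9 b1 b2; simp only [lCells, box]; omega)
  all_goals
    simp only [lCells, box] at h5 h6
    have e : k = 2 ∧ b = d ∧ l + 1 < b ∧ b < n := by
      simp only [BumpOK, RectOK, box] at b1 b2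
      omega
    obtain ⟨rfl, rfl, e1, e2⟩ := e
    clear b1 b2
  · exact (ham_armRowPair h1 h4 e1 e2).congr (by omega)
  · exact (ham_armRowPair h1 h4 e1 e2).reverse.congr (by omega)

/-- From `(m - k, n)` to `(m - k, n - 1)`. -/
def leftCorner (m n k l : ℤ) : List (ℤ × ℤ) :=
  [(m - k, n)] ++ (boxPath (m - k + 1) m (l + 1) n (m - k + 1) n (m - k + 1) (n - 1) ++
    (boxPath 1 (m - k) 1 (n - 2) (m - k) (n - 2) 1 (n - 2) ++
      (boxPath 1 (m - k - 1) (n - 1) n 1 (n - 1) (m - k - 1) n ++ [(m - k, n - 1)])))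

theorem ham_leftCorner {m n k l : ℤ} (h1 : 2 ≤ m - k) (h2 : 2 ≤ n - l) (hk : 2 ≤ k) (hl : 1 ≤ l) :
    Ham (lCells m n k l) (m - k) n (m - k) (n - 1) (leftCorner m n k l) := by
  refine (Ham.singleton (m - k) n).join
    (V₂ := fun x y => lCells m n k l x y ∧ ¬ (x = m - k ∧ y = n))
    ((ham_boxPath (x₁ := m - k + 1) (x₂ := m) (y₁ := l + 1) (y₂ := n) (a := m - k + 1) (b := n)
      (c := m - k + 1) (d := n - 1) (by unfold RectOK box; omega)).append
    (V₂ := fun x y => box 1 (m - k) 1 n x y ∧ ¬ (x = m - k ∧ y = n))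
    ((ham_boxPath (x₁ := 1) (x₂ := m - k) (y₁ := 1) (y₂ := n - 2) (a := m - k) (b := n - 2)
      (c := 1) (d := n - 2) (by unfold RectOK box; omega)).append
    (V₂ := fun x y => box 1 (m - k) (n - 1) n x y ∧ ¬ (x = m - k ∧ y = n))
    ((ham_boxPath (x₁ := 1) (x₂ := m - k - 1) (y₁ := n - 1) (y₂ := n) (a := 1) (b := n - 1)
      (c := m - k - 1) (d := n) (by unfold RectOK box; omega)).append
      (Ham.singleton (m - k) (n - 1)) ?_ ?_) ?_ ?_) ?_ ?_) ?_ ?_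
  all_goals (try unfold lCells); (try unfold box); omega

/-- From `(1, b)` to `(2, b)`, where `m - k = 2` and `l + 1 ≤ b < n`. -/
def leftRowPair (m n l b : ℤ) : List (ℤ × ℤ) :=
  [(1, b)] ++ (boxPath 1 2 1 (b - 1) 1 (b - 1) 2 (b - 1) ++
    (boxPath 3 m (l + 1) n 3 b 3 (b + 1) ++
      (boxPath 1 2 (b + 1) n 2 (b + 1) 1 (b + 1) ++ [(2, b)])))

theorem ham_leftRowPair {m n k l b : ℤ} (h1 : m - k = 2) (hk : 2 ≤ k) (hl : 1 ≤ l)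
    (h2 : l + 1 ≤ b) (h3 : b < n) : Ham (lCells m n k l) 1 b 2 b (leftRowPair m n l b) := by
  refine (Ham.singleton 1 b).join
    (V₂ := fun x y => lCells m n k l x y ∧ ¬ (x = 1 ∧ y = b))
    ((ham_boxPath (x₁ := 1) (x₂ := 2) (y₁ := 1) (y₂ := b - 1) (a := 1) (b := b - 1)
      (c := 2) (d := b - 1) (by unfold RectOK box; omega)).append
    (V₂ := fun x y => box 3 m (l + 1) n x y ∨ box 1 2 b n x y ∧ ¬ (x = 1 ∧ y = b))
    ((ham_boxPath (x₁ := 3) (x₂ := m) (y₁ := l + 1) (y₂ := n) (a := 3) (b := b)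
      (c := 3) (d := b + 1) (by unfold RectOK box; omega)).append
    (V₂ := fun x y => box 1 2 b n x y ∧ ¬ (x = 1 ∧ y = b))
    ((ham_boxPath (x₁ := 1) (x₂ := 2) (y₁ := b + 1) (y₂ := n) (a := 2) (b := b + 1)
      (c := 1) (d := b + 1) (by unfold RectOK box; omega)).append
      (Ham.singleton 2 b) ?_ ?_) ?_ ?_) ?_ ?_) ?_ ?_
  all_goals (try unfold lCells); (try unfold box); omega

/-- From `(1, n - 1)` to `(2, n)`, where `m - k = 2`. -/
def leftDiagonal (m n l : ℤ) : List (ℤ × ℤ) :=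
  [(1, n - 1)] ++ (boxPath 1 2 1 (n - 2) 1 (n - 2) 2 (n - 2) ++
    (boxPath 3 m (l + 1) n 3 (n - 1) 3 n ++ ([(2, n - 1)] ++ ([(1, n)] ++ [(2, n)]))))

theorem ham_leftDiagonal {m n k l : ℤ} (h1 : m - k = 2) (hk : 2 ≤ k) (hl : 1 ≤ l)
    (h2 : 2 ≤ n - l) : Ham (lCells m n k l) 1 (n - 1) 2 n (leftDiagonal m n l) := by
  refine (Ham.singleton 1 (n - 1)).join
    (V₂ := fun x y => lCells m n k l x y ∧ ¬ (x = 1 ∧ y = n - 1))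
    ((ham_boxPath (x₁ := 1) (x₂ := 2) (y₁ := 1) (y₂ := n - 2) (a := 1) (b := n - 2)
      (c := 2) (d := n - 2) (by unfold RectOK box; omega)).append
    (V₂ := fun x y => box 3 m (l + 1) n x y ∨ box 1 2 (n - 1) n x y ∧ ¬ (x = 1 ∧ y = n - 1))
    ((ham_boxPath (x₁ := 3) (x₂ := m) (y₁ := l + 1) (y₂ := n) (a := 3) (b := n - 1)
      (c := 3) (d := n) (by unfold RectOK box; omega)).append
    (V₂ := fun x y => box 1 2 (n - 1) n x y ∧ ¬ (x = 1 ∧ y = n - 1))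
    ((Ham.singleton 2 (n - 1)).append (V₂ := box 1 2 n n)
      ((Ham.singleton 1 n).append (Ham.singleton 2 n) ?_ ?_) ?_ ?_) ?_ ?_) ?_ ?_) ?_ ?_
  all_goals (try unfold lCells); (try unfold box); omega

/-- From `(1, n)` to `(2, n - 1)`, where `m - k = 2`. -/
def leftAntidiagonal (m n l : ℤ) : List (ℤ × ℤ) :=
  [(1, n)] ++ ([(2, n)] ++ (boxPath 3 m (l + 1) n 3 n 3 (n - 1) ++
    (boxPath 1 2 1 (n - 2) 2 (n - 2) 1 (n - 2) ++ ([(1, n - 1)] ++ [(2, n - 1)]))))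

theorem ham_leftAntidiagonal {m n k l : ℤ} (h1 : m - k = 2) (hk : 2 ≤ k) (hl : 1 ≤ l)
    (h2 : 2 ≤ n - l) : Ham (lCells m n k l) 1 n 2 (n - 1) (leftAntidiagonal m n l) := by
  refine (Ham.singleton 1 n).join
    (V₂ := fun x y => lCells m n k l x y ∧ ¬ (x = 1 ∧ y = n))
    ((Ham.singleton 2 n).append
    (V₂ := fun x y => box 3 m (l + 1) n x y ∨ box 1 2 1 (n - 1) x y)
    ((ham_boxPath (x₁ := 3) (x₂ := m) (y₁ := l + 1) (y₂ := n) (a := 3) (b := n)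
      (c := 3) (d := n - 1) (by unfold RectOK box; omega)).append
    (V₂ := box 1 2 1 (n - 1))
    ((ham_boxPath (x₁ := 1) (x₂ := 2) (y₁ := 1) (y₂ := n - 2) (a := 2) (b := n - 2)
      (c := 1) (d := n - 2) (by unfold RectOK box; omega)).append (V₂ := box 1 2 (n - 1) (n - 1))
      ((Ham.singleton 1 (n - 1)).append (Ham.singleton 2 (n - 1)) ?_ ?_) ?_ ?_) ?_ ?_) ?_ ?_) ?_ ?_
  all_goals (try unfold lCells); (try unfold box); omega

/-- Both ends lie in the first `m - k` columns. -/
def leftPath (m n k l a b c d : ℤ) : List (ℤ × ℤ) :=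
  if BumpOK n (m - k) (n + 1 - b) (m - k + 1 - a) (n + 1 - d) (m - k + 1 - c) then
    fx (m - k) (fy n (tr (bump n (m - k) (n + 1 - b) (m - k + 1 - a) (n + 1 - d) (m - k + 1 - c)
      (boxPath 1 (n - l) (1 - k) 0 1 0 2 0))))
  else if a = c then
    if b = n then leftCorner m n k l else (leftCorner m n k l).reverse
  else if b = d then
    if a = 1 then leftRowPair m n l b else (leftRowPair m n l b).reverse
  else if a = 1 then
    if b = n then leftAntidiagonal m n l else leftDiagonal m n l
  else
    if d = n then (leftAntidiagonal m n l).reverse else (leftDiagonal m n l).reverse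

theorem ham_leftPath {m n k l a b c d : ℤ} (H : LOK m n k l a b c d) (hk : 2 ≤ k)
    (ha : a ≤ m - k) (hc : c ≤ m - k) :
    Ham (lCells m n k l) a b c d (leftPath m n k l a b c d) := by
  obtain ⟨h1, h2, -, h4, h5, h6, h7, h8, -⟩ := H
  unfold leftPath
  by_cases b1 : BumpOK n (m - k) (n + 1 - b) (m - k + 1 - a) (n + 1 - d) (m - k + 1 - c)
  · rw [if_pos b1]
    exact (((ham_bump (W := box 1 (n - l) (1 - k) 0) (ham_boxPath (by
      clear h5 h6 h7 h8 b1; unfold RectOK box; omega)) (by simp [Near]) (by simp [Near])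
      (by clear h5 h6 h7 h8 b1; simp only [box]; omega) b1).tr.fy n).fx (m - k)).congr
      (by clear h5 h6 h7 h8 b1; omega)
      (by clear h5 h6 h7 h8 b1; simp only [lCells, box]; omega)
  · rw [if_neg b1]
    simp only [lCells, box] at h5 h6
    have e : (a = m - k ∧ c = m - k ∧ (b = n ∧ d = n - 1 ∨ b = n - 1 ∧ d = n)) ∨
        (m - k = 2 ∧ (a = 1 ∧ c = 2 ∨ a = 2 ∧ c = 1) ∧ ((b = d ∧ l + 1 ≤ b ∧ b < n) ∨
          (b = n ∧ d = n - 1) ∨ (b = n - 1 ∧ d = n))) := by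
      simp only [BumpOK, RectOK, box] at b1
      omega
    clear b1
    split_ifs
    · exact (ham_leftCorner h1 h2 hk h4).congr (by omega)
    · exact (ham_leftCorner h1 h2 hk h4).reverse.congr (by omega)
    · exact (ham_leftRowPair (b := b) (by omega) hk h4 (by omega) (by omega)).congr (by omega)
    · exact (ham_leftRowPair (b := b) (by omega) hk h4 (by omega) (by omega)).reverse.congr
        (by omega)
    · exact (ham_leftAntidiagonal (by omega) hk h4 h2).congr (by omega)
    · exact (ham_leftDiagonal (by omega) hk h4 h2).congr (by omega)
    · exact (ham_leftAntidiagonal (by omega) hk h4 h2).reverse.congr (by omega)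
    · exact (ham_leftDiagonal (by omega) hk h4 h2).reverse.congr (by omega)

/-- The second half of `mixedPath`. -/
def mixedRight (m n k l c d : ℤ) : List (ℤ × ℤ) :=
  if c = m - k + 1 ∧ d = n then boxPath (m - k + 1) m (l + 1) n (m - k + 1) (n - 1) c d
  else boxPath (m - k + 1) m (l + 1) n (m - k + 1) n c d

/-- The first end lies in the first `m - k` columns and the second one does not. -/
def mixedPath (m n k l a b c d : ℤ) : List (ℤ × ℤ) :=
  (if a = m - k ∧ b = n then boxPath 1 (m - k) 1 n a b (m - k) (n - 1)
  else boxPath 1 (m - k) 1 n a b (m - k) n) ++ mixedRight m n k l c d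

theorem ham_mixedPath {m n k l a b c d : ℤ} (H : LOK m n k l a b c d) (hk : 2 ≤ k)
    (ha : a ≤ m - k) (hc : m - k < c) :
    Ham (lCells m n k l) a b c d (mixedPath m n k l a b c d) := by
  obtain ⟨h1, h2, -, h4, h5, h6, -, -, -⟩ := H
  simp only [lCells, box] at h5 h6
  unfold mixedPath mixedRight
  split_ifs with c1 c2 c2
  all_goals
    refine (ham_boxPath ?_).join (ham_boxPath ?_) ?_ ?_
    · clear h6; unfold RectOK box; omega
    · clear h5; unfold RectOK box; omega
    · omega
    · clear h5 h6 c1 c2; simp only [lCells, box]; omega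

/-- A Hamiltonian path of `L(m, n; k, l)` for `k ≥ 2`. -/
def lPathWide (m n k l a b c d : ℤ) : List (ℤ × ℤ) :=
  if a ≤ m - k then
    if c ≤ m - k then leftPath m n k l a b c d else mixedPath m n k l a b c d
  else if c ≤ m - k then (mixedPath m n k l c d a b).reverse else armPath m n k l a b c d

theorem ham_lPathWide {m n k l a b c d : ℤ} (H : LOK m n k l a b c d) (hk : 2 ≤ k) :
    Ham (lCells m n k l) a b c d (lPathWide m n k l a b c d) := by
  unfold lPathWide
  split_ifs with h1 h2 h2
  · exact ham_leftPath H hk h1 h2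
  · exact ham_mixedPath H hk h1 (by omega)
  · exact (ham_mixedPath H.symm hk h2 (by omega)).reverse
  · exact ham_armPath H hk (by omega) (by omega)

/-- The reflection of `L(n, m; l, k)` onto `L(m, n; k, l)` applied to the cells of a path. -/
def mir (m n : ℤ) (p : List (ℤ × ℤ)) : List (ℤ × ℤ) := fx m (fy n (tr p))

theorem Ham.mir {m n k l a b c d : ℤ} {p : List (ℤ × ℤ)}
    (H : Ham (lCells n m l k) (n + 1 - b) (m + 1 - a) (n + 1 - d) (m + 1 - c) p) :
    Ham (lCells m n k l) a b c d (mir m n p) :=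
  ((H.tr.fy n).fx m).congr (by omega) (by simp only [lCells, box]; omega)

/-- A Hamiltonian path of `L(m, n; k, l)` from `(a, b)` to `(c, d)`. -/
def lPath (m n k l a b c d : ℤ) : List (ℤ × ℤ) :=
  if 2 ≤ k then lPathWide m n k l a b c d
  else if 2 ≤ l then
    mir m n (lPathWide n m l k (n + 1 - b) (m + 1 - a) (n + 1 - d) (m + 1 - c))
  else (rectPath m n a b c d).filter (· ≠ (m, 1))

theorem LOK.mir {m n k l a b c d : ℤ} (H : LOK m n k l a b c d) :
    LOK n m l k (n + 1 - b) (m + 1 - a) (n + 1 - d) (m + 1 - c) := by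
  obtain ⟨h1, h2, h3, h4, h5, h6, h7, h8, h9⟩ := H
  refine ⟨h2, h1, h4, h3, ?_, ?_, ?_, ?_, ?_⟩
  · clear h6 h7 h8 h9; simp only [lCells, box] at *; omega
  · clear h5 h7 h8 h9; simp only [lCells, box] at *; omega
  · clear h5 h6 h8 h9; omega
  · clear h5 h6 h7 h8; omega
  · clear h5 h6 h7 h9; omega

theorem ham_lPath {m n k l a b c d : ℤ} (H : LOK m n k l a b c d) :
    Ham (lCells m n k l) a b c d (lPath m n k l a b c d) := by
  unfold lPath
  split_ifs with h1 h2
  · exact ham_lPathWide H h1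
  · exact (ham_lPathWide H.mir h2).mir
  · obtain ⟨h3, h4, h5, h6, h7, h8, h9, -, -⟩ := H
    simp only [lCells, box] at h7 h8
    have HP : Ham (box 1 m 1 n) a b c d (rectPath m n a b c d) :=
      ham_rectPath (by unfold RectOK box; omega)
    refine HP.filter_ne (by omega) (by omega) (fun u v hi => ?_) fun x y => ?_
    · have h1 := HP.of_infix (infix_pair_left hi)
      have h2 := HP.of_infix (infix_pair_right hi)
      clear h7 h8 h9
      simp only [box, Near] at h1 h2 ⊢
      omega
    · clear h7 h8 h9; simp only [lCells, box]; omega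

end Supergrid

namespace Supergrid

/-! ### Paths and their crossings with a set of cells -/

theorem adj_iff {u v : ℤ × ℤ} : supergrid.Adj u v ↔ u ≠ v ∧ Near u v := by
  simp only [supergrid, Near, abs_le]
  constructor
  · rintro ⟨h, h1, h2⟩; exact ⟨h, by omega⟩
  · rintro ⟨h, h1⟩; exact ⟨h, by omega, by omega⟩

section
variable {V V' : Set (ℤ × ℤ)} {s t : ℤ × ℤ} {p q : List (ℤ × ℤ)} {D : ℤ × ℤ → Prop}

theorem isChain_adj (hn : p.Nodup) (hc : p.IsChain Near) : p.IsChain supergrid.Adj := by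
  induction p with
  | nil => simp
  | cons a p ih =>
    obtain _ | ⟨b, p⟩ := p
    · simp
    · rw [List.isChain_cons_cons] at hc ⊢
      refine ⟨adj_iff.2 ⟨?_, hc.1⟩, ih (List.nodup_cons.1 hn).2 hc.2⟩
      rintro rfl
      exact (List.nodup_cons.1 hn).1 (by simp)

theorem IsSTPath.chain_near (H : IsSTPath V s t p) : p.IsChain Near :=
  H.2.2.2.2.imp fun _ _ h => (adj_iff.1 h).2

theorem IsSTPath.mono (H : IsSTPath V s t p) (h : ∀ v ∈ p, v ∈ V') : IsSTPath V' s t p :=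
  ⟨H.1, H.2.1, H.2.2.1, h, H.2.2.2.2⟩

theorem IsSTPath.reverse (H : IsSTPath V s t p) : IsSTPath V t s p.reverse := by
  refine ⟨by rw [List.head?_reverse, H.2.1], by rw [List.getLast?_reverse, H.1],
    List.nodup_reverse.2 H.2.2.1, fun v hv => H.2.2.2.1 v (List.mem_reverse.1 hv), ?_⟩
  rw [List.isChain_reverse]
  exact H.2.2.2.2.imp fun _ _ h => h.symm

theorem IsSTPath.map (H : IsSTPath V s t p) (φ : ℤ × ℤ → ℤ × ℤ) (hi : Function.Injective φ)
    (hn : ∀ u v, Near u v → Near (φ u) (φ v)) (hV : ∀ v ∈ V, φ v ∈ V') :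
    IsSTPath V' (φ s) (φ t) (p.map φ) := by
  refine ⟨by rw [List.head?_map, H.1]; rfl, by rw [List.getLast?_map, H.2.1]; rfl,
    H.2.2.1.map hi, ?_, ?_⟩
  · intro v hv
    obtain ⟨u, hu, rfl⟩ := List.mem_map.1 hv
    exact hV u (H.2.2.2.1 u hu)
  · rw [List.isChain_map]
    exact H.2.2.2.2.imp fun u v h => adj_iff.2 ⟨hi.ne (adj_iff.1 h).1, hn _ _ (adj_iff.1 h).2⟩

theorem exists_entry {α : Type*} {L : List α} {D : α → Prop} {s : α} (h : L.head? = some s)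
    (hs : ¬ D s) (hD : ∃ d ∈ L, D d) : ∃ A u x B, L = A ++ u :: x :: B ∧ ¬ D u ∧ D x := by
  induction L generalizing s with
  | nil => simp at h
  | cons a L ih =>
    obtain rfl : a = s := by simpa using h
    obtain ⟨d, hd, hDd⟩ := hD
    have hd' : d ∈ L := (List.mem_cons.1 hd).resolve_left (by rintro rfl; exact hs hDd)
    obtain _ | ⟨z, L⟩ := L
    · simp at hd'
    · by_cases hz : D z
      · exact ⟨[], a, z, L, rfl, hs, hz⟩
      · obtain ⟨A, u, x, B, h1, h2, h3⟩ := ih (s := z) rfl hz ⟨d, hd', hDd⟩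
        exact ⟨a :: A, u, x, B, by rw [h1]; rfl, h2, h3⟩

theorem IsSTPath.ne_of_infix (H : IsSTPath V s t p) {u x : ℤ × ℤ} (h : [u, x] <:+: p) :
    u ≠ t ∧ x ≠ s ∧ u ∈ V ∧ x ∈ V ∧ Near u x := by
  have hV := H.2.2.2.1
  have hn := H.2.2.1
  have h1 := H.1
  have h2 := H.2.1
  refine ⟨?_, ?_, hV _ (h.subset (by simp)), hV _ (h.subset (by simp)), ?_⟩
  · rintro rfl
    obtain ⟨A, B, rfl⟩ := h
    rw [List.append_assoc, List.getLast?_append_of_ne_nil _ (by simp)] at h2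
    have : u ∈ x :: B := by
      have : (x :: B).getLast? = some u := by simpa using h2
      exact List.mem_of_mem_getLast? this
    rw [List.append_assoc, List.nodup_append] at hn
    exact (List.nodup_cons.1 hn.2.1).1 this
  · rintro rfl
    obtain ⟨A, B, rfl⟩ := h
    obtain _ | ⟨a, A⟩ := A
    · have : u = x := by simpa using h1
      subst this
      simp at hn
    · have : a = x := by simpa using h1
      subst this
      simp at hn
  · simpa using H.chain_near.infix h

/-- A path with ends outside `D` that visits `D` enters and leaves it through different cells. -/
theorem IsSTPath.exists_crossings (H : IsSTPath V s t p) (hs : ¬ D s) (ht : ¬ D t) {d : ℤ × ℤ}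
    (hd : d ∈ p) (hD : D d) : ∃ u x y v, [u, x] <:+: p ∧ [y, v] <:+: p ∧ ¬ D u ∧ D x ∧ D y ∧
      ¬ D v ∧ u ≠ v := by
  obtain ⟨p₁, p₂, rfl⟩ := List.append_of_mem hd
  have hn := H.2.2.1
  obtain ⟨A, u, x, B, e1, hu, hx⟩ := exists_entry (L := p₁ ++ [d]) (D := D) (s := s) (by
    have := H.1
    rcases p₁ with _ | ⟨z, p₁⟩ <;> simpa using this) hs ⟨d, by simp, hD⟩
  obtain ⟨A', v, y, B', e2, hv, hy⟩ := exists_entry (L := (d :: p₂).reverse) (D := D) (s := t) (by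
    have := H.2.1
    rw [List.head?_reverse]
    simpa using this) ht ⟨d, by simp, hD⟩
  have e2' : d :: p₂ = B'.reverse ++ y :: v :: A'.reverse := by
    rw [← List.reverse_reverse (d :: p₂), e2]; simp
  refine ⟨u, x, y, v, ⟨A, B ++ p₂, ?_⟩, ⟨p₁ ++ B'.reverse, A'.reverse, ?_⟩, hu, hx, hy, hv, ?_⟩
  · have : p₁ ++ d :: p₂ = (p₁ ++ [d]) ++ p₂ := by simp
    rw [this, e1]; simp
  · rw [e2']; simp
  · rintro rfl
    have h1 : u ∈ p₁ := by
      have : u ∈ p₁ ++ [d] := by rw [e1]; simp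
      rcases List.mem_append.1 this with h | h
      · exact h
      · rw [List.mem_singleton.1 h] at hu; exact absurd hD hu
    have h2 : u ∈ d :: p₂ := by rw [e2']; simp
    exact (List.nodup_append.1 hn).2.2 u h1 u h2 rfl

/-- A path does not visit a set that is attached to the rest through a single cell. -/
theorem IsSTPath.avoids (H : IsSTPath V s t p) (hs : ¬ D s) (ht : ¬ D t) {c : ℤ × ℤ}
    (hc : ∀ u ∈ V, ∀ x ∈ V, ¬ D u → D x → Near u x → u = c) : ∀ v ∈ p, ¬ D v := by
  intro d hd hD
  obtain ⟨u, x, y, v, h1, h2, hu, hx, hy, hv, huv⟩ := H.exists_crossings hs ht hd hD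
  obtain ⟨-, -, h3, h4, h5⟩ := H.ne_of_infix h1
  obtain ⟨-, -, h6, h7, h8⟩ := H.ne_of_infix h2
  exact huv ((hc u h3 x h4 hu hx h5).trans (hc v h7 y h6 hv hy h8.symm).symm)

theorem infix_right_unique {u x x' : ℤ × ℤ} (hn : p.Nodup) (h : [u, x] <:+: p)
    (h' : [u, x'] <:+: p) : x = x' := by
  rw [infix_iff_second hn] at h h'
  exact Option.some.inj (h.symm.trans h')

theorem infix_left_unique {u x x' : ℤ × ℤ} (hn : p.Nodup) (h : [x, u] <:+: p)
    (h' : [x', u] <:+: p) : x = x' :=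
  infix_right_unique (p := p.reverse) (u := u) (List.nodup_reverse.2 hn)
    (by simpa using List.reverse_infix.2 h) (by simpa using List.reverse_infix.2 h')

/-- If the ends of a path separate `D` from the other cells, then the path stays on one side. -/
theorem IsSTPath.one_side (H : IsSTPath V s t p) (hs : ¬ D s) (ht : ¬ D t)
    (hc : ∀ u ∈ V, ∀ x ∈ V, ¬ D u → D x → Near u x → u = s ∨ u = t) :
    (∀ v ∈ p, ¬ D v) ∨ ∀ v ∈ p, D v ∨ v = s ∨ v = t := by
  by_contra! hcon
  obtain ⟨⟨d, hd, hD⟩, d', hd', hD', hs', ht'⟩ := hcon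
  obtain ⟨u, x, -, -, h1, -, hu, hx, -⟩ := H.exists_crossings hs ht hd hD
  obtain ⟨n1, -, m1, m2, a1⟩ := H.ne_of_infix h1
  obtain rfl : u = s := (hc u m1 x m2 hu hx a1).resolve_right n1
  obtain ⟨u', x', -, -, h2, -, hu', hx', -⟩ := H.exists_crossings
    (D := fun v => ¬ D v ∧ v ≠ u ∧ v ≠ t) (by simp) (by simp) hd' ⟨hD', hs', ht'⟩
  obtain ⟨n2, -, m3, m4, a2⟩ := H.ne_of_infix h2
  have : u' = u := by
    by_contra hne
    have hDu : D u' := by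
      by_contra hDu
      exact hu' ⟨hDu, hne, n2⟩
    rcases hc x' m4 u' m3 hx'.1 hDu a2.symm with h | h
    · exact hx'.2.1 h
    · exact hx'.2.2 h
  subst this
  rw [infix_right_unique H.2.2.1 h1 h2] at hx
  exact hx'.1 hx

/-! ### Longest paths -/

theorem Ham.isSTPath {U : ℤ → ℤ → Prop} {a b c d : ℤ} (H : Ham U a b c d p)
    (hU : ∀ x y, U x y → (x, y) ∈ V) : IsSTPath V (a, b) (c, d) p :=
  ⟨H.head, H.last, H.nodup, fun v hv => hU _ _ ((H.mem v.1 v.2).1 hv), isChain_adj H.nodup H.chain⟩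

theorem Ham.length_le {U : ℤ → ℤ → Prop} {a b c d : ℤ} (H : Ham U a b c d p) (hn : q.Nodup)
    (hq : ∀ v ∈ q, U v.1 v.2) : q.length ≤ p.length :=
  (List.subperm_of_subset hn fun v hv => (H.mem v.1 v.2).2 (hq v hv)).length_le

theorem Ham.length_eq {U : ℤ → ℤ → Prop} {a b c d : ℤ} (H : Ham U a b c d p)
    (F : Finset (ℤ × ℤ)) (hF : ∀ x y, (x, y) ∈ F ↔ U x y) : p.length = F.card := by
  rw [← List.toFinset_card_of_nodup H.nodup]
  congr 1
  ext ⟨x, y⟩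
  rw [List.mem_toFinset, H.mem, hF]

theorem mem_Icc_product {x₁ x₂ y₁ y₂ x y : ℤ} :
    (x, y) ∈ Finset.Icc x₁ x₂ ×ˢ Finset.Icc y₁ y₂ ↔ box x₁ x₂ y₁ y₂ x y := by
  simp only [Finset.mem_product, Finset.mem_Icc, box, and_assoc]

theorem card_Icc_product (x₁ x₂ y₁ y₂ : ℤ) : (Finset.Icc x₁ x₂ ×ˢ Finset.Icc y₁ y₂).card =
    (x₂ + 1 - x₁).toNat * (y₂ + 1 - y₁).toNat := by
  rw [Finset.card_product, Int.card_Icc, Int.card_Icc]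

theorem Ham.length_box {x₁ x₂ y₁ y₂ a b c d : ℤ} (H : Ham (box x₁ x₂ y₁ y₂) a b c d p) :
    p.length = (x₂ + 1 - x₁).toNat * (y₂ + 1 - y₁).toNat := by
  rw [H.length_eq _ fun x y => mem_Icc_product, card_Icc_product]

/-- A Hamiltonian path of the set of all cells that can be visited is a longest path. -/
theorem Ham.isLongest {U : ℤ → ℤ → Prop} {a b c d : ℤ} (H : Ham U a b c d p)
    (hU : ∀ x y, U x y → (x, y) ∈ V)
    (h : ∀ q, IsSTPath V (a, b) (c, d) q → ∀ v ∈ q, U v.1 v.2) :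
    IsLongestSTPath V (a, b) (c, d) p :=
  ⟨H.isSTPath hU, fun q hq => H.length_le hq.2.2.1 (h q hq)⟩

/-- If every path stays within one of two sets with Hamiltonian paths, then the longer one of these
is a longest path. -/
theorem Ham.isLongest_of_two {U U' : ℤ → ℤ → Prop} {a b c d : ℤ} (H : Ham U a b c d p)
    (H' : Ham U' a b c d q) (hU : ∀ x y, U x y → (x, y) ∈ V)
    (h : ∀ r, IsSTPath V (a, b) (c, d) r → (∀ v ∈ r, U v.1 v.2) ∨ ∀ v ∈ r, U' v.1 v.2)
    (hle : q.length ≤ p.length) : IsLongestSTPath V (a, b) (c, d) p := by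
  refine ⟨H.isSTPath hU, fun r hr => ?_⟩
  rcases h r hr with h | h
  · exact H.length_le hr.2.2.1 h
  · exact (H'.length_le hr.2.2.1 h).trans hle

theorem IsLongestSTPath.reverse (H : IsLongestSTPath V s t p) : IsLongestSTPath V t s p.reverse :=
  ⟨H.1.reverse, fun q hq => by
    have := H.2 _ hq.reverse
    simpa using this⟩

theorem IsLongestSTPath.map (H : IsLongestSTPath V s t p) {φ ψ : ℤ × ℤ → ℤ × ℤ}
    (h₁ : ∀ v, ψ (φ v) = v) (h₂ : ∀ v, φ (ψ v) = v) (hn : ∀ u v, Near u v → Near (φ u) (φ v))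
    (hn' : ∀ u v, Near u v → Near (ψ u) (ψ v)) (hV : ∀ v, φ v ∈ V' ↔ v ∈ V) :
    IsLongestSTPath V' (φ s) (φ t) (p.map φ) := by
  have hφ : Function.Injective φ := fun u v h => by rw [← h₁ u, h, h₁]
  have hψ : Function.Injective ψ := fun u v h => by rw [← h₂ u, h, h₂]
  refine ⟨H.1.map φ hφ hn fun v hv => (hV v).2 hv, fun q hq => ?_⟩
  have := H.2 (q.map ψ) (by
    have := hq.map (V' := V) ψ hψ hn' fun v hv => (hV _).1 (by rwa [h₂])
    rwa [h₁, h₁] at this)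
  simpa using this

theorem IsLongestSTPath.longestLength_eq (H : IsLongestSTPath V s t p) :
    longestLength V s t = p.length :=
  IsGreatest.csSup_eq ⟨⟨p, H.1, rfl⟩, by rintro N ⟨q, hq, rfl⟩; exact H.2 q hq⟩

/-- The maximum over two subgraphs, if every path stays within one of them. -/
theorem IsLongestSTPath.max_eq (H : IsLongestSTPath V s t p) {V₁ V₂ : Set (ℤ × ℤ)}
    (h : ∀ q, IsSTPath V s t q ↔ IsSTPath V₁ s t q ∨ IsSTPath V₂ s t q) :
    max (longestLength V₁ s t) (longestLength V₂ s t) = p.length := by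
  have hle : ∀ V', (∀ q, IsSTPath V' s t q → IsSTPath V s t q) → longestLength V' s t ≤ p.length := by
    intro V' hV'
    exact csSup_le' (by rintro N ⟨q, hq, rfl⟩; exact H.2 q (hV' q hq))
  have hge : ∀ V', (∀ q, IsSTPath V' s t q → IsSTPath V s t q) → IsSTPath V' s t p →
      p.length ≤ longestLength V' s t := by
    intro V' hV' hp
    exact le_csSup ⟨p.length, by rintro N ⟨q, hq, rfl⟩; exact H.2 q (hV' q hq)⟩ ⟨p, hp, rfl⟩
  have h₁ : ∀ q, IsSTPath V₁ s t q → IsSTPath V s t q := fun q hq => (h q).2 (Or.inl hq)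
  have h₂ : ∀ q, IsSTPath V₂ s t q → IsSTPath V s t q := fun q hq => (h q).2 (Or.inr hq)
  refine le_antisymm (max_le (hle _ h₁) (hle _ h₂)) ?_
  rcases (h p).1 H.1 with hp | hp
  · exact (hge _ h₁ hp).trans (le_max_left _ _)
  · exact (hge _ h₂ hp).trans (le_max_right _ _)

theorem longestLength_congr (h : ∀ q, IsSTPath V s t q ↔ IsSTPath V' s t q) :
    longestLength V s t = longestLength V' s t := by
  simp only [longestLength, h]

/-- Translations preserve the lengths of longest paths. -/
theorem longestLength_sub (c : ℤ × ℤ) (h : ∀ v, v ∈ V' ↔ v + c ∈ V) :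
    longestLength V' (s - c) (t - c) = longestLength V s t := by
  unfold longestLength
  congr 1
  ext N
  constructor
  · rintro ⟨q, hq, rfl⟩
    have := hq.map (V' := V) (· + c) (add_left_injective c)
      (fun u v h => by simp only [Near, Prod.fst_add, Prod.snd_add] at h ⊢; omega)
      fun v hv => (h v).1 hv
    simp only [sub_add_cancel] at this
    exact ⟨_, this, by simp⟩
  · rintro ⟨q, hq, rfl⟩
    exact ⟨_, hq.map (V' := V') (· - c) (sub_left_injective)
      (fun u v h => by simp only [Near, Prod.fst_sub, Prod.snd_sub] at h ⊢; omega)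
      fun v hv => (h _).2 (by simpa using hv), by simp⟩

/-! ### Connectivity -/

theorem isVertexCut_of_separation {S : Set (ℤ × ℤ)} (D : ℤ × ℤ → Prop) {u v : ℤ × ℤ}
    (hu : u ∈ V \ S) (hv : v ∈ V \ S) (hDu : D u) (hDv : ¬ D v)
    (h : ∀ x ∈ V \ S, ∀ y ∈ V \ S, D x → ¬ D y → ¬ Near x y) : IsVertexCut V S := by
  intro hcon
  obtain ⟨w⟩ := hcon ⟨u, hu⟩ ⟨v, hv⟩
  have key : ∀ (x y : ↥(V \ S)), (supergrid.induce (V \ S)).Walk x y → D x → D y := by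
    intro x y w
    induction w with
    | nil => exact id
    | @cons x y z hxy _ ih =>
      intro hx
      refine ih ?_
      by_contra hy
      have : supergrid.Adj x.1 y.1 := hxy
      exact h _ x.2 _ y.2 hx hy (adj_iff.1 this).2
  exact hDv (key _ _ w hDu)

theorem reachable_of_chain {W : Set (ℤ × ℤ)} (hc : p.IsChain Near) (hp : ∀ v ∈ p, v ∈ W)
    {u v : ℤ × ℤ} (hu : u ∈ p) (hv : v ∈ p) :
    (supergrid.induce W).Reachable ⟨u, hp u hu⟩ ⟨v, hp v hv⟩ := by
  induction p generalizing u v with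
  | nil => simp at hu
  | cons a p ih =>
    have hp' : ∀ v ∈ p, v ∈ W := fun v hv => hp v (List.mem_cons_of_mem _ hv)
    have ha : ∀ v (hv : v ∈ a :: p), (supergrid.induce W).Reachable ⟨a, hp a (by simp)⟩
        ⟨v, hp v hv⟩ := by
      intro v hv
      by_cases hva : v = a
      · subst hva; exact SimpleGraph.Reachable.refl _
      · have hv' : v ∈ p := (List.mem_cons.1 hv).resolve_left hva
        obtain _ | ⟨z, p⟩ := p
        · simp at hv'
        · rw [List.isChain_cons_cons] at hc
          have h1 := ih hc.2 hp' (u := z) (by simp) hv'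
          by_cases haz : a = z
          · subst haz; exact h1
          · have : (supergrid.induce W).Adj ⟨a, hp a (by simp)⟩ ⟨z, hp z (by simp)⟩ :=
              adj_iff.2 ⟨haz, hc.1⟩
            exact this.reachable.trans h1
    exact (ha u hu).symm.trans (ha v hv)

theorem preconnected_of_chain {W : Set (ℤ × ℤ)} (hc : p.IsChain Near) (hp : ∀ v, v ∈ W ↔ v ∈ p) :
    (supergrid.induce W).Preconnected := fun u v =>
  reachable_of_chain hc (fun v hv => (hp v).2 hv) ((hp u).1 u.2) ((hp v).1 v.2)

theorem preconnected_of_two_chains {W : Set (ℤ × ℤ)} (hc : p.IsChain Near) (hc' : q.IsChain Near)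
    {c : ℤ × ℤ} (hp : c ∈ p) (hq : c ∈ q) (h : ∀ v, v ∈ W ↔ v ∈ p ∨ v ∈ q) :
    (supergrid.induce W).Preconnected := by
  have key : ∀ v : W, (supergrid.induce W).Reachable ⟨c, (h c).2 (Or.inl hp)⟩ v := by
    rintro ⟨v, hv⟩
    rcases (h v).1 hv with h1 | h1
    · exact reachable_of_chain hc (fun v hv => (h v).2 (Or.inl hv)) hp h1
    · exact reachable_of_chain hc' (fun v hv => (h v).2 (Or.inr hv)) hq h1
  exact fun u v => (key u).symm.trans (key v)

theorem mem_tail_iff {v : ℤ × ℤ} (hn : p.Nodup) (hh : p.head? = some s) :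
    v ∈ p.tail ↔ v ∈ p ∧ v ≠ s := by
  obtain _ | ⟨a, p⟩ := p
  · simp at hh
  · obtain rfl : a = s := by simpa using hh
    have := (List.nodup_cons.1 hn).1
    simp only [List.tail_cons, List.mem_cons]
    constructor
    · intro h; exact ⟨Or.inr h, by rintro rfl; exact this h⟩
    · rintro ⟨h | h, h'⟩
      · exact absurd h h'
      · exact h

theorem mem_dropLast_iff {v : ℤ × ℤ} (hn : p.Nodup) (hl : p.getLast? = some t) :
    v ∈ p.dropLast ↔ v ∈ p ∧ v ≠ t := by
  have := mem_tail_iff (p := p.reverse) (s := t) (v := v) (List.nodup_reverse.2 hn)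
    (by rw [List.head?_reverse, hl])
  rw [List.tail_reverse] at this
  simpa using this

theorem IsSTPath.mem_inner_iff (H : IsSTPath V s t p) (hst : s ≠ t) {v : ℤ × ℤ} :
    v ∈ p.tail.dropLast ↔ v ∈ p ∧ v ≠ s ∧ v ≠ t := by
  have hl : p.tail.getLast? = some t := by
    obtain _ | ⟨a, _ | ⟨b, p⟩⟩ := p
    · have := H.1; simp at this
    · have h1 := H.1; have h2 := H.2.1
      simp at h1 h2
      exact absurd (h1.symm.trans h2) hst
    · have := H.2.1
      simpa using this
  rw [mem_dropLast_iff (H.2.2.1.sublist (List.tail_sublist _)) hl, mem_tail_iff H.2.2.1 H.1,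
    and_assoc]

theorem IsSTPath.chain_inner (H : IsSTPath V s t p) : p.tail.dropLast.IsChain Near :=
  (H.chain_near.suffix (List.tail_suffix _)).prefix (List.dropLast_prefix _)

/-- Neither the ends of a Hamiltonian path nor one of them separate the graph. -/
theorem not_isVertexCut_of_covering (H : IsSTPath V s t p) (hst : s ≠ t) (hV : ∀ v ∈ V, v ∈ p) :
    ¬ IsVertexCut V {s} ∧ ¬ IsVertexCut V {t} ∧ ¬ IsVertexCut V {s, t} := by
  have hc := H.chain_near
  have hm : ∀ v, v ∈ V ↔ v ∈ p := fun v => ⟨hV v, H.2.2.2.1 v⟩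
  simp only [IsVertexCut, not_not]
  refine ⟨preconnected_of_chain (p := p.tail) (hc.suffix (List.tail_suffix _)) fun v => ?_,
    preconnected_of_chain (p := p.dropLast) (hc.prefix (List.dropLast_prefix _)) fun v => ?_,
    preconnected_of_chain H.chain_inner fun v => ?_⟩
  · rw [mem_tail_iff H.2.2.1 H.1, ← hm]; rfl
  · rw [mem_dropLast_iff H.2.2.1 H.2.1, ← hm]; rfl
  · rw [H.mem_inner_iff hst, ← hm]
    simp only [Set.mem_sdiff, Set.mem_insert_iff, Set.mem_singleton_iff, not_or]

/-- A Hamiltonian path shows that its inner cells have degree at least two. -/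
theorem ncard_neighborSet_ne_one (H : IsSTPath V s t p) (hV : ∀ v ∈ V, v ∈ p) {w : V}
    (hs : (w : ℤ × ℤ) ≠ s) (ht : (w : ℤ × ℤ) ≠ t) :
    ((supergrid.induce V).neighborSet w).ncard ≠ 1 := by
  intro h
  obtain ⟨z, hz⟩ := Set.ncard_eq_one.1 h
  obtain ⟨u, x, y, v, h1, h2, -, rfl, rfl, -, huv⟩ := H.exists_crossings
    (D := fun v => v = w) (fun h => hs h.symm) (fun h => ht h.symm) (hV w w.2) rfl
  obtain ⟨-, -, m1, -, a1⟩ := H.ne_of_infix h1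
  obtain ⟨-, -, -, m2, a2⟩ := H.ne_of_infix h2
  have n1 : u ≠ w := by
    rintro rfl
    have := H.2.2.1.sublist h1.sublist
    simp at this
  have n2 : v ≠ w := by
    rintro rfl
    have := H.2.2.1.sublist h2.sublist
    simp at this
  have b1 : (⟨u, m1⟩ : V) ∈ (supergrid.induce V).neighborSet w :=
    (adj_iff.2 ⟨n1.symm, a1.symm⟩ : supergrid.Adj w u)
  have b2 : (⟨v, m2⟩ : V) ∈ (supergrid.induce V).neighborSet w :=
    (adj_iff.2 ⟨n2.symm, a2⟩ : supergrid.Adj w v)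
  rw [hz, Set.mem_singleton_iff] at b1 b2
  exact huv (congrArg Subtype.val (b1.trans b2.symm))

theorem ncard_neighborSet_eq_one {w z : ℤ × ℤ} (hw : w ∈ V) (hz : z ∈ V) (hn : Near w z)
    (hne : z ≠ w) (h : ∀ x ∈ V, Near w x → x = w ∨ x = z) :
    ((supergrid.induce V).neighborSet ⟨w, hw⟩).ncard = 1 := by
  refine Set.ncard_eq_one.2 ⟨⟨z, hz⟩, Set.ext fun x => ?_⟩
  rw [Set.mem_singleton_iff]
  constructor
  · intro hx
    have hx' : supergrid.Adj w x.1 := hx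
    rw [adj_iff] at hx'
    exact Subtype.ext ((h _ x.2 hx'.2).resolve_left hx'.1.symm)
  · rintro rfl
    exact (adj_iff.2 ⟨hne.symm, hn⟩ : supergrid.Adj w z)

end
end Supergrid

namespace Supergrid

/-! ### Confinement of paths in an L-shape -/

theorem mem_lShape {m n k l : ℤ} {v : ℤ × ℤ} : v ∈ lShape m n k l ↔ lCells m n k l v.1 v.2 :=
  Iff.rfl

section
variable {m n k l : ℤ} {s t : ℤ × ℤ} {q : List (ℤ × ℤ)}

theorem IsSTPath.le_row (H : IsSTPath (lShape m n k l) s t q) (hk : m - k = 1) {r : ℤ} (hr : r ≤ l)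
    (hs : r ≤ s.2) (ht : r ≤ t.2) : ∀ v ∈ q, r ≤ v.2 := by
  have := H.avoids (D := fun v => v.2 < r) (c := (1, r)) (by omega) (by omega) fun u hu x hx h1 h2 h3 => by
    simp only [mem_lShape, lCells, box, Near] at *
    exact Prod.ext (by dsimp only; omega) (by dsimp only; omega)
  exact fun v hv => not_lt.1 (this v hv)

theorem IsSTPath.row_le (H : IsSTPath (lShape m n k l) s t q) (hk : m - k = 1) {r : ℤ} (hr : r ≤ l)
    (hs : s.2 ≤ r) (ht : t.2 ≤ r) : ∀ v ∈ q, v.2 ≤ r := by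
  have := H.avoids (D := fun v => r < v.2) (c := (1, r)) (by omega) (by omega) fun u hu x hx h1 h2 h3 => by
    simp only [mem_lShape, lCells, box, Near] at *
    exact Prod.ext (by dsimp only; omega) (by dsimp only; omega)
  exact fun v hv => not_lt.1 (this v hv)

theorem IsSTPath.column_le (H : IsSTPath (lShape m n k l) s t q) (hk : m - k = 1) (hl : n - l = 1)
    {r : ℤ} (hr : 2 ≤ r) (hs : s.1 ≤ r) (ht : t.1 ≤ r) : ∀ v ∈ q, v.1 ≤ r := by
  have := H.avoids (D := fun v => r < v.1) (c := (r, n)) (by omega) (by omega) fun u hu x hx h1 h2 h3 => by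
    simp only [mem_lShape, lCells, box, Near] at *
    exact Prod.ext (by dsimp only; omega) (by dsimp only; omega)
  exact fun v hv => not_lt.1 (this v hv)

theorem IsSTPath.le_column (H : IsSTPath (lShape m n k l) s t q) (hk : m - k = 1) (hl : n - l = 1)
    {r : ℤ} (hr : 2 ≤ r) (hs : r ≤ s.1) (ht : r ≤ t.1) : ∀ v ∈ q, r ≤ v.1 := by
  have := H.avoids (D := fun v => v.1 < r) (c := (r, n)) (by omega) (by omega) fun u hu x hx h1 h2 h3 => by
    simp only [mem_lShape, lCells, box, Near] at *
    exact Prod.ext (by dsimp only; omega) (by dsimp only; omega)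
  exact fun v hv => not_lt.1 (this v hv)

/-- If the ends form a full row, then a path stays above or below that row. -/
theorem IsSTPath.row_pair {V : Set (ℤ × ℤ)} (H : IsSTPath V s t q) {y : ℤ} (hs : s.2 = y)
    (ht : t.2 = y) (h : ∀ v ∈ V, v.2 = y → v = s ∨ v = t) :
    (∀ v ∈ q, v.2 ≤ y) ∨ ∀ v ∈ q, y ≤ v.2 := by
  rcases H.one_side (D := fun v => v.2 < y) (by omega) (by omega) fun u hu x hx h1 h2 h3 =>
    h u hu (by simp only [Near] at h3; omega) with h | h
  · exact Or.inr fun v hv => not_lt.1 (h v hv)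
  · refine Or.inl fun v hv => ?_
    rcases h v hv with h | rfl | rfl <;> omega

/-- If the ends form a full column, then a path stays to the left or to the right of it. -/
theorem IsSTPath.column_pair {V : Set (ℤ × ℤ)} (H : IsSTPath V s t q) {x : ℤ} (hs : s.1 = x)
    (ht : t.1 = x) (h : ∀ v ∈ V, v.1 = x → v = s ∨ v = t) :
    (∀ v ∈ q, v.1 ≤ x) ∨ ∀ v ∈ q, x ≤ v.1 := by
  rcases H.one_side (D := fun v => v.1 < x) (by omega) (by omega) fun u hu x hx h1 h2 h3 =>
    h u hu (by simp only [Near] at h3; omega) with h | h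
  · exact Or.inr fun v hv => not_lt.1 (h v hv)
  · refine Or.inl fun v hv => ?_
    rcases h v hv with h | rfl | rfl <;> omega

/-- The exceptional condition (F5): a path between two diagonal neighbours at the left end of a
horizontal arm of height two that visits the cell `(1, l)` above cannot visit both `(1, l + 2)` and
the third column. -/
theorem IsSTPath.false_of_diagonal {V : Set (ℤ × ℤ)} (H : IsSTPath V s t q)
    (hV : ∀ v ∈ V, 1 ≤ v.1 ∧ l ≤ v.2 ∧ v.2 ≤ l + 2 ∧ (v.2 ≤ l → v.1 = 1))
    (hst : s = (1, l + 1) ∧ t = (2, l + 2) ∨ s = (1, l + 2) ∧ t = (2, l + 1))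
    (he : (1, l) ∈ q) (hf : (1, l + 2) ∈ q) {z : ℤ × ℤ} (hz : z ∈ q) (hz3 : 3 ≤ z.1) : False := by
  have key : ∀ (D : ℤ × ℤ → Prop) (d : ℤ × ℤ), d ∈ q → D d → ¬ D s → ¬ D t →
      ∃ u x y v : ℤ × ℤ, ([u, x] <:+: q ∧ ¬ D u ∧ D x ∧ u ∈ V ∧ Near u x ∧ u ≠ t) ∧
        ([y, v] <:+: q ∧ ¬ D v ∧ D y ∧ v ∈ V ∧ Near y v ∧ v ≠ s) ∧ u ≠ v := by
    intro D d hd hD hs ht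
    obtain ⟨u, x, y, v, h1, h2, hu, hx, hy, hv, huv⟩ := H.exists_crossings hs ht hd hD
    obtain ⟨a1, -, a3, -, a5⟩ := H.ne_of_infix h1
    obtain ⟨-, b2, -, b4, b5⟩ := H.ne_of_infix h2
    exact ⟨u, x, y, v, ⟨h1, hu, hx, a3, a5, a1⟩, ⟨h2, hv, hy, b4, b5, b2⟩, huv⟩
  have hn := H.2.2.1
  obtain ⟨u, x, y, v, ⟨i1, hu, rfl, mu, nu, hut⟩, ⟨i2, hv, rfl, mv, nv, hvs⟩, huv⟩ :=
    key (fun v => v = (1, l)) _ he rfl (by rintro rfl; simp at hst) (by rintro rfl; simp at hst)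
  obtain ⟨u', x', y', v', ⟨i3, hu', hx', mu', nu', hut'⟩, ⟨i4, hv', hy', mv', nv', hvs'⟩, huv'⟩ :=
    key (fun v => 3 ≤ v.1) _ hz hz3 (by rcases hst with ⟨rfl, -⟩ | ⟨rfl, -⟩ <;> simp)
      (by rcases hst with ⟨-, rfl⟩ | ⟨-, rfl⟩ <;> simp)
  have bu := hV u mu
  have bv := hV v mv
  have bu' := hV u' mu'
  have bv' := hV v' mv'
  rcases hst with ⟨rfl, rfl⟩ | ⟨rfl, rfl⟩ <;> simp only [Near, ne_eq, Prod.ext_iff] at *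
  · obtain rfl : v = (2, l + 1) := Prod.ext (by dsimp only; omega) (by dsimp only; omega)
    obtain rfl : u = (1, l + 1) := Prod.ext (by dsimp only at *; omega) (by dsimp only at *; omega)
    obtain rfl : u' = (2, l + 1) := Prod.ext (by dsimp only; omega) (by dsimp only; omega)
    obtain rfl : v' = (2, l + 2) := Prod.ext (by dsimp only at *; omega) (by dsimp only at *; omega)
    obtain ⟨u₃, x₃, -, -, ⟨i5, hu₃, hx₃, mu₃, nu₃, hut₃⟩, -⟩ :=
      key (fun v => v = (1, l + 2)) _ hf rfl (by simp) (by simp)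
    obtain rfl := hx₃
    have bu₃ := hV u₃ mu₃
    simp only [Prod.ext_iff] at hu₃ hut₃
    dsimp only at nu₃
    by_cases h1 : u₃ = (1, l + 1)
    · subst h1
      have := infix_right_unique hn i1 i5
      simp at this
    · by_cases h2 : u₃ = (2, l + 1)
      · subst h2
        have := infix_right_unique hn i3 i5
        rw [this] at hx'
        simp at hx'
      · simp only [Prod.ext_iff] at h1 h2
        dsimp only at *
        omega
  · obtain rfl : u = (1, l + 1) := Prod.ext (by dsimp only; omega) (by dsimp only; omega)
    obtain rfl : v = (2, l + 1) := Prod.ext (by dsimp only at *; omega) (by dsimp only at *; omega)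
    obtain rfl : u' = (2, l + 2) := Prod.ext (by dsimp only at *; omega) (by dsimp only at *; omega)
    obtain rfl : v' = (2, l + 1) := Prod.ext (by dsimp only at *; omega) (by dsimp only at *; omega)
    have := infix_left_unique hn i2 i4
    rw [← this] at hy'
    simp at hy'

end

/-! ### Longest paths for a vertical arm of width one -/

/-- The row `y` from column `x₁` to column `x₂`. -/
def segment (x₁ x₂ y : ℤ) : List (ℤ × ℤ) := sh (x₁ - 1) 0 (row (x₂ - x₁ + 1) y false)

theorem ham_segment {x₁ x₂ : ℤ} (y : ℤ) (h : x₁ ≤ x₂) :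
    Ham (box x₁ x₂ y y) x₁ y x₂ y (segment x₁ x₂ y) :=
  ((ham_row (w := x₂ - x₁ + 1) y (by omega)).sh (x₁ - 1) 0).congr

/-- A longest path between the cells `(1, b)` and `(1, d)` of the vertical arm. -/
def columnPath (b d : ℤ) : List (ℤ × ℤ) :=
  if b ≤ d then tr (segment b d 1) else (tr (segment d b 1)).reverse

theorem ham_columnPath (b d : ℤ) : Ham (box 1 1 (min b d) (max b d)) 1 b 1 d (columnPath b d) := by
  unfold columnPath
  split_ifs with h
  · exact (ham_segment (x₁ := b) (x₂ := d) 1 h).tr.congr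
  · exact (ham_segment (x₁ := d) (x₂ := b) 1 (by omega)).tr.reverse.congr

/-- A longest path from the cell `(1, b)` of the vertical arm to a cell `(c, d)` below that arm. -/
def descentPath (m n l b c d : ℤ) : List (ℤ × ℤ) :=
  tr (segment b l 1) ++
    if 2 ≤ n - l then
      if c = 1 ∧ d = l + 1 then boxPath 1 m (l + 1) n 2 (l + 1) c d
      else boxPath 1 m (l + 1) n 1 (l + 1) c d
    else if c = 1 then [(2, n)] ++ [(1, n)]
    else segment 1 c n

section
variable {m n k l a b c d : ℤ}

theorem ham_descentPath_high (hm : 2 ≤ m) (hk : m - k = 1) (hn : 2 ≤ n - l) (hb : 1 ≤ b)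
    (hbl : b ≤ l) (hcd : lCells m n k l c d) (hd : l < d) :
    Ham (fun x y => lCells m n k l x y ∧ b ≤ y) 1 b c d (descentPath m n l b c d) := by
  unfold lCells box at *
  unfold descentPath
  rw [if_pos hn]
  split_ifs with h
  · exact (ham_segment (x₁ := b) (x₂ := l) 1 hbl).tr.join (ham_boxPath (x₁ := 1) (x₂ := m)
      (y₁ := l + 1) (y₂ := n) (a := 2) (b := l + 1) (c := c) (d := d) (by unfold RectOK box; omega))
  · exact (ham_segment (x₁ := b) (x₂ := l) 1 hbl).tr.join (ham_boxPath (x₁ := 1) (x₂ := m)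
      (y₁ := l + 1) (y₂ := n) (a := 1) (b := l + 1) (c := c) (d := d) (by unfold RectOK box; omega))

theorem ham_descentPath_corner (hn : n - l = 1) (hbl : b ≤ l) :
    Ham (fun x y => box 1 1 b n x y ∨ x = 2 ∧ y = n) 1 b 1 n (descentPath m n l b 1 n) := by
  unfold descentPath
  rw [if_neg (by omega), if_pos rfl]
  exact (ham_segment (x₁ := b) (x₂ := l) 1 hbl).tr.join (V₂ := box 1 2 n n)
    ((Ham.singleton 2 n).append (Ham.singleton 1 n))

theorem ham_descentPath_right (hn : n - l = 1) (hbl : b ≤ l) (hc : 2 ≤ c) :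
    Ham (fun x y => box 1 1 b n x y ∨ box 1 c n n x y) 1 b c n (descentPath m n l b c n) := by
  unfold descentPath
  rw [if_neg (by omega), if_neg (by omega)]
  exact (ham_segment (x₁ := b) (x₂ := l) 1 hbl).tr.join
    (ham_segment (x₁ := 1) (x₂ := c) n (by omega))

/-- A longest path from `(a, n)` to `(c, n)`, where `a < c` and the horizontal arm has height one. A
path that starts in the first column can make a detour to the cell above. -/
def rowPath (n a c : ℤ) : List (ℤ × ℤ) :=
  if a = 1 then [(1, n)] ++ ([(1, n - 1)] ++ segment 2 c n) else segment a c n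

theorem ham_rowPath_one (hc : 2 ≤ c) :
    Ham (fun x y => box 1 c n n x y ∨ x = 1 ∧ y = n - 1) 1 n c n (rowPath n 1 c) := by
  unfold rowPath
  rw [if_pos rfl]
  exact (Ham.singleton 1 n).join
    (V₂ := fun x y => box 2 c n n x y ∨ x = 1 ∧ y = n - 1)
    ((Ham.singleton 1 (n - 1)).append (ham_segment (x₁ := 2) (x₂ := c) n hc))

theorem ham_rowPath (ha : a ≠ 1) (hc : a ≤ c) : Ham (box a c n n) a n c n (rowPath n a c) := by
  unfold rowPath
  rw [if_neg ha]
  exact ham_segment n hc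

/-- The rectangle in the rows below `l`, enlarged by the cell `(1, l)`. -/
def bumpLow (w h l a b c d : ℤ) : List (ℤ × ℤ) := sh 0 l (bump w h a (b - l) c (d - l) [(1, 0)])

theorem ham_bumpLow {w h : ℤ} (H : BumpOK w h a (b - l) c (d - l)) :
    Ham (fun x y => box 1 w (l + 1) (l + h) x y ∨ x = 1 ∧ y = l) a b c d
      (bumpLow w h l a b c d) := by
  exact ((ham_bump (Ham.singleton 1 0) (by simp [Near]) (by simp [Near])
    (by clear H; simp only [box]; omega) H).sh 0 l).congr
    (by clear H; omega) (by clear H; simp only [box]; omega)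

/-- A longest path between two cells below the vertical arm, where the horizontal arm has height at
least two.  Of the cells in the vertical arm only `(1, l)` can be visited. -/
def lowPath (m n l a b c d : ℤ) : List (ℤ × ℤ) :=
  if BumpOK m (n - l) a (b - l) c (d - l) then bumpLow m (n - l) l a b c d
  else if m = 2 ∧ b = d ∧ l + 2 ≤ b ∧ b < n then
    if (n - b + 1) + (n - b + 1) ≤ (b - l) + (b - l) then bumpLow 2 (b - l) l a b c d
    else boxPath 1 2 b n a b c d
  else if n - l = 2 ∧ a = c ∧ 2 ≤ a ∧ a < m then
    if (m - a + 1) + (m - a + 1) ≤ a + a then bumpLow a 2 l a b c d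
    else boxPath a m (l + 1) n a b c d
  else boxPath 1 m (l + 1) n a b c d

/-- A longest path of `L(m, n; m - 1, l)`. -/
def narrowPath (m n l a b c d : ℤ) : List (ℤ × ℤ) :=
  if b ≤ l then if d ≤ l then columnPath b d else descentPath m n l b c d
  else if d ≤ l then (descentPath m n l d a b).reverse
  else if 2 ≤ n - l then lowPath m n l a b c d
  else if a < c then rowPath n a c else (rowPath n c a).reverse

theorem isLongest_columnPath (hk : m - k = 1) (hs : lCells m n k l a b) (ht : lCells m n k l c d)
    (hb : b ≤ l) (hd : d ≤ l) :
    IsLongestSTPath (lShape m n k l) (a, b) (c, d) (columnPath b d) := by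
  have hs' := hs
  have ht' := ht
  unfold lCells box at hs' ht'
  obtain rfl : a = 1 := by omega
  obtain rfl : c = 1 := by omega
  refine (ham_columnPath b d).isLongest (fun x y h => ?_) fun q hq v hv => ?_
  · simp only [mem_lShape, lCells, box] at *; omega
  · have h1 := hq.le_row hk (r := min b d) (by omega) (min_le_left _ _) (min_le_right _ _) v hv
    have h2 := hq.row_le hk (r := max b d) (by omega) (le_max_left _ _) (le_max_right _ _) v hv
    have h3 := hq.2.2.2.1 v hv
    simp only [mem_lShape, lCells, box] at *
    omega

theorem isLongest_descentPath (hm : 2 ≤ m) (hk : m - k = 1) (hl : 1 ≤ n - l)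
    (hs : lCells m n k l a b) (ht : lCells m n k l c d) (hb : b ≤ l) (hd : l < d) :
    IsLongestSTPath (lShape m n k l) (a, b) (c, d) (descentPath m n l b c d) := by
  have hs' := hs
  have ht' := ht
  unfold lCells box at hs' ht'
  obtain rfl : a = 1 := by omega
  have h1 : ∀ q, IsSTPath (lShape m n k l) (1, b) (c, d) q → ∀ v ∈ q, b ≤ v.2 := fun q hq =>
    hq.le_row hk hb le_rfl (show b ≤ d by omega)
  by_cases hn : 2 ≤ n - l
  · exact (ham_descentPath_high hm hk hn (by omega) hb ht hd).isLongest (fun x y h => h.1)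
      fun q hq v hv => ⟨hq.2.2.2.1 v hv, h1 q hq v hv⟩
  · have hn' : n - l = 1 := by omega
    obtain rfl : d = n := by omega
    by_cases hc : c = 1
    · subst hc
      refine (ham_descentPath_corner hn' hb).isLongest (fun x y h => ?_) fun q hq v hv => ?_
      · simp only [mem_lShape, lCells, box] at *; omega
      · have h2 := h1 q hq v hv
        have h3 := hq.2.2.2.1 v hv
        have h4 := hq.column_le hk hn' le_rfl (show (1 : ℤ) ≤ 2 by omega)
          (show (1 : ℤ) ≤ 2 by omega) v hv
        simp only [mem_lShape, lCells, box] at *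
        omega
    · refine (ham_descentPath_right hn' hb (by omega)).isLongest (fun x y h => ?_) fun q hq v hv => ?_
      · simp only [mem_lShape, lCells, box] at *; omega
      · have h2 := h1 q hq v hv
        have h3 := hq.2.2.2.1 v hv
        have h4 := hq.column_le hk hn' (r := c) (by omega) (show (1 : ℤ) ≤ c by omega) le_rfl v hv
        simp only [mem_lShape, lCells, box] at *
        omega

theorem isLongest_rowPath (hk : m - k = 1) (hl : 1 ≤ l) (hn : n - l = 1)
    (ha : 1 ≤ a) (hac : a < c) (hc : c ≤ m) :
    IsLongestSTPath (lShape m n k l) (a, n) (c, n) (rowPath n a c) := by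
  by_cases h1 : a = 1
  · subst h1
    refine (ham_rowPath_one (by omega)).isLongest (fun x y h => ?_) fun q hq v hv => ?_
    · simp only [mem_lShape, lCells, box] at *; omega
    · have h1 := hq.le_row hk (r := l) le_rfl (show l ≤ n by omega) (show l ≤ n by omega) v hv
      have h3 := hq.2.2.2.1 v hv
      have h4 := hq.column_le hk hn (r := c) (by omega) (show (1 : ℤ) ≤ c by omega) le_rfl v hv
      simp only [mem_lShape, lCells, box] at *
      omega
  · refine (ham_rowPath h1 hac.le).isLongest (fun x y h => ?_) fun q hq v hv => ?_
    · simp only [mem_lShape, lCells, box] at *; omega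
    · have h1 := hq.le_column hk hn (r := a) (by omega) le_rfl hac.le v hv
      have h3 := hq.2.2.2.1 v hv
      have h4 := hq.column_le hk hn (r := c) (by omega) hac.le le_rfl v hv
      simp only [mem_lShape, lCells, box] at *
      omega

theorem length_bumpLow {w h : ℤ} (H : BumpOK w h a (b - l) c (d - l)) :
    (bumpLow w h l a b c d).length = w.toNat * h.toNat + 1 := by
  have hn : (1, l) ∉ Finset.Icc 1 w ×ˢ Finset.Icc (l + 1) (l + h) := by
    rw [mem_Icc_product]; unfold box; omega
  rw [(ham_bumpLow H).length_eq (insert (1, l) (Finset.Icc 1 w ×ˢ Finset.Icc (l + 1) (l + h)))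
    fun x y => by rw [Finset.mem_insert, mem_Icc_product, Prod.mk.injEq, or_comm],
    Finset.card_insert_of_notMem hn, card_Icc_product]
  congr 3 <;> omega

/-- The ends are diagonal neighbours at the left end of a horizontal arm of height two. -/
theorem isLongest_diagonal (hm : 3 ≤ m) (hk : m - k = 1) (hl : 1 ≤ l) (hn : n - l = 2)
    (h : a = 1 ∧ b = l + 1 ∧ c = 2 ∧ d = l + 2 ∨ a = 1 ∧ b = l + 2 ∧ c = 2 ∧ d = l + 1)
    {p : List (ℤ × ℤ)} (HP : Ham (box 1 m (l + 1) n) a b c d p) :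
    IsLongestSTPath (lShape m n k l) (a, b) (c, d) p := by
  refine ⟨HP.isSTPath fun x y h => ?_, fun q hq => ?_⟩
  · simp only [mem_lShape, lCells, box] at *; omega
  · -- A path that visits `(1, l)` misses some cell `z` of the rectangle, and `z` may replace `(1, l)`.
    have h1 := hq.le_row hk (r := l) le_rfl (show l ≤ b by omega) (show l ≤ d by omega)
    have hV : ∀ v ∈ q, v ∈ {v | v ∈ lShape m n k l ∧ l ≤ v.2} := fun v hv =>
      ⟨hq.2.2.2.1 v hv, h1 v hv⟩
    have hq' := hq.mono hV
    have hbox : ∀ v ∈ q, v ≠ (1, l) → box 1 m (l + 1) n v.1 v.2 := by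
      intro v hv hne
      have h2 := hV v hv
      simp only [Set.mem_ofPred_eq, mem_lShape, lCells, box, ne_eq, Prod.ext_iff] at *
      omega
    by_cases he : (1, l) ∈ q
    · obtain ⟨z, hz, hzq⟩ : ∃ z : ℤ × ℤ, box 1 m (l + 1) n z.1 z.2 ∧ z ∉ q := by
        by_contra! hcon
        refine hq'.false_of_diagonal (l := l) (fun v hv => ?_) ?_ he
          (hcon (1, l + 2) (by simp only [box]; omega))
          (hcon (3, l + 1) (by simp only [box]; omega)) le_rfl
        · simp only [Set.mem_ofPred_eq, mem_lShape, lCells, box] at hv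
          omega
        · simp only [Prod.mk.injEq]; omega
      have h2 := HP.length_le (q := z :: q.erase (1, l)) (List.nodup_cons.2
        ⟨fun h => hzq (List.mem_of_mem_erase h), hq.2.2.1.erase _⟩) fun v hv => by
        rcases List.mem_cons.1 hv with rfl | hv
        · exact hz
        · rw [hq.2.2.1.mem_erase_iff] at hv
          exact hbox v hv.2 hv.1
      rw [List.length_cons, List.length_erase_of_mem he] at h2
      have := List.length_pos_of_mem he
      omega
    · exact HP.length_le hq.2.2.1 fun v hv => hbox v hv (by rintro rfl; exact he hv)

/-- The ends are the two leftmost cells of the first row of the horizontal arm. They separate `(1,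
l)` from the other cells. -/
theorem isLongest_top (hm : 2 ≤ m) (hk : m - k = 1) (hn : 2 ≤ n - l) (hl : 1 ≤ l)
    {p : List (ℤ × ℤ)} (HP : Ham (box 1 m (l + 1) n) 1 (l + 1) 2 (l + 1) p) :
    IsLongestSTPath (lShape m n k l) (1, l + 1) (2, l + 1) p := by
  have HT : Ham (fun x y => x = 1 ∧ y = l + 1 ∨ x = 1 ∧ y = l ∨ x = 2 ∧ y = l + 1) 1 (l + 1) 2 (l + 1)
      ([(1, l + 1)] ++ ([(1, l)] ++ [(2, l + 1)])) :=
    (Ham.singleton 1 (l + 1)).append (V₂ := fun x y => x = 1 ∧ y = l ∨ x = 2 ∧ y = l + 1)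
      ((Ham.singleton 1 l).append (Ham.singleton 2 (l + 1)) (by omega)
        fun x y => by omega) (by omega) fun x y => by omega
  refine HP.isLongest_of_two HT (fun x y h => ?_) (fun q hq => ?_) ?_
  · simp only [mem_lShape, lCells, box] at *; omega
  · have h1 := hq.le_row hk (r := l) le_rfl (show l ≤ l + 1 by omega) (show l ≤ l + 1 by omega)
    rcases hq.one_side (D := fun v => v.2 ≤ l) (by simp) (by simp) fun u hu x hx h1 h2 h3 => by
      simp only [mem_lShape, lCells, box, Near, Prod.ext_iff] at *; omega with h | h
    · refine Or.inl fun v hv => ?_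
      have h2 := h v hv
      have h3 := hq.2.2.2.1 v hv
      simp only [mem_lShape, lCells, box] at *; omega
    · refine Or.inr fun v hv => ?_
      have h2 := h v hv
      have h3 := hq.2.2.2.1 v hv
      have h4 := h1 v hv
      simp only [mem_lShape, lCells, box, Prod.ext_iff] at *; omega
  · exact HP.length_le (q := [(1, l + 1), (2, l + 1), (1, l + 2)]) (by simp) (by
      simp only [List.mem_cons, List.not_mem_nil, or_false, box]
      rintro v (rfl | rfl | rfl) <;> dsimp only <;> omega)

/-- The pairs of ends that are excluded by `BumpOK`. -/
theorem exceptions_of_not_bumpOK {w h : ℤ} (hw : 2 ≤ w) (hh : 2 ≤ h) (hs : box 1 w 1 h a b)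
    (ht : box 1 w 1 h c d) (hst : ¬ (a = c ∧ b = d)) (H : ¬ BumpOK w h a b c d) :
    (w = 2 ∧ b = d ∧ 1 < b ∧ b < h) ∨ (h = 2 ∧ a = c ∧ 1 < a ∧ a < w) ∨
      (b = 1 ∧ d = 1 ∧ (a = 1 ∧ c = 2 ∨ a = 2 ∧ c = 1)) ∨
      (h = 2 ∧ 3 ≤ w ∧ ((a = 1 ∧ b = 1 ∧ c = 2 ∧ d = 2 ∨ a = 1 ∧ b = 2 ∧ c = 2 ∧ d = 1) ∨
        (c = 1 ∧ d = 1 ∧ a = 2 ∧ b = 2 ∨ c = 1 ∧ d = 2 ∧ a = 2 ∧ b = 1))) := by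
  by_contra hcon
  simp only [not_or] at hcon
  obtain ⟨h1, h2, h3, h4⟩ := hcon
  refine H ⟨hw, hh, ⟨hs, ht, hst, fun h => ?_, fun h => ?_, h1, h2⟩, ?_, ?_, ?_⟩
  · omega
  · omega
  · clear h1 h2 h4 hs ht; omega
  · clear h1 h2 h4 hs ht; omega
  · clear h1 h2 h3 hs ht; omega

theorem isLongest_lowPath (hm : 2 ≤ m) (hk : m - k = 1) (hl : 1 ≤ l) (hn : 2 ≤ n - l)
    (hs : lCells m n k l a b) (ht : lCells m n k l c d) (hb : l < b) (hd : l < d)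
    (hst : ¬ (a = c ∧ b = d)) :
    IsLongestSTPath (lShape m n k l) (a, b) (c, d) (lowPath m n l a b c d) := by
  unfold lCells box at hs ht
  have hlow : ∀ q, IsSTPath (lShape m n k l) (a, b) (c, d) q → ∀ v ∈ q, l ≤ v.2 := fun q hq =>
    hq.le_row hk le_rfl hb.le hd.le
  unfold lowPath
  by_cases h1 : BumpOK m (n - l) a (b - l) c (d - l)
  · rw [if_pos h1]
    refine (ham_bumpLow h1).isLongest (fun x y h => ?_) fun q hq v hv => ?_
    · clear h1; simp only [mem_lShape, lCells, box] at *; omega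
    · have h2 := hq.2.2.2.1 v hv
      have h3 := hlow q hq v hv
      clear h1; simp only [mem_lShape, lCells, box] at *; omega
  rw [if_neg h1]
  have hE := exceptions_of_not_bumpOK (w := m) (h := n - l) hm hn (by unfold box; omega)
      (by unfold box; omega) (by omega) h1
  clear h1
  by_cases h2 : m = 2 ∧ b = d ∧ l + 2 ≤ b ∧ b < n
  · rw [if_pos h2]
    clear hE
    obtain ⟨rfl, rfl, h4, h5⟩ := h2
    have hac : a = 1 ∧ c = 2 ∨ a = 2 ∧ c = 1 := by omega
    have HB : BumpOK 2 (b - l) a (b - l) c (b - l) := by unfold BumpOK RectOK box; omega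
    have HP : Ham (box 1 2 b n) a b c b (boxPath 1 2 b n a b c b) :=
      ham_boxPath (by clear HB; unfold RectOK box; omega)
    have eB := length_bumpLow HB
    have eP := HP.length_box
    rw [show (2 : ℤ) + 1 - 1 = 2 by norm_num] at eP
    rw [show (2 : ℤ).toNat = 2 from rfl] at eB eP
    have HL := ham_bumpLow HB
    clear HB
    have hpair : ∀ v ∈ lShape 2 n k l, v.2 = b → v = (a, b) ∨ v = (c, b) := fun v hv hvb => by
      simp only [mem_lShape, lCells, box, Prod.ext_iff] at *; omega
    have hlow' : ∀ v ∈ lShape 2 n k l, l ≤ v.2 → v.2 ≤ b →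
        box 1 2 (l + 1) (l + (b - l)) v.1 v.2 ∨ v.1 = 1 ∧ v.2 = l := fun v hv h1 h2 => by
      simp only [mem_lShape, lCells, box] at *; omega
    have hhigh : ∀ v ∈ lShape 2 n k l, b ≤ v.2 → box 1 2 b n v.1 v.2 := fun v hv h2 => by
      simp only [mem_lShape, lCells, box] at *; omega
    have hside : ∀ q, IsSTPath (lShape 2 n k l) (a, b) (c, b) q →
        (∀ v ∈ q, box 1 2 (l + 1) (l + (b - l)) v.1 v.2 ∨ v.1 = 1 ∧ v.2 = l) ∨
          ∀ v ∈ q, box 1 2 b n v.1 v.2 := fun q hq =>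
      (hq.row_pair rfl rfl hpair).imp (fun h v hv => hlow' v (hq.2.2.2.1 v hv) (hlow q hq v hv) (h v hv))
        fun h v hv => hhigh v (hq.2.2.2.1 v hv) (h v hv)
    split_ifs with h3
    · refine HL.isLongest_of_two HP (fun x y h => ?_) hside (by omega)
      simp only [mem_lShape, lCells, box] at *; omega
    · refine HP.isLongest_of_two HL (fun x y h => ?_) (fun q hq => (hside q hq).symm) (by omega)
      simp only [mem_lShape, lCells, box] at *; omega
  rw [if_neg h2]
  by_cases h3 : n - l = 2 ∧ a = c ∧ 2 ≤ a ∧ a < m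
  · rw [if_pos h3]
    clear hE h2
    obtain ⟨h2, rfl, h4, h5⟩ := h3
    obtain rfl : n = l + 2 := by omega
    have hbd : b = l + 1 ∧ d = l + 2 ∨ b = l + 2 ∧ d = l + 1 := by omega
    have HB : BumpOK a 2 a (b - l) a (d - l) := by unfold BumpOK RectOK box; omega
    have HP : Ham (box a m (l + 1) (l + 2)) a b a d (boxPath a m (l + 1) (l + 2) a b a d) :=
      ham_boxPath (by clear HB; unfold RectOK box; omega)
    have eB := length_bumpLow HB
    have eP := HP.length_box
    rw [show l + 2 + 1 - (l + 1) = 2 by ring] at eP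
    rw [show (2 : ℤ).toNat = 2 from rfl] at eB eP
    have HL := ham_bumpLow HB
    clear HB
    have hpair : ∀ v ∈ lShape m (l + 2) k l, l ≤ v.2 → v.1 = a → v = (a, b) ∨ v = (a, d) :=
      fun v hv _ hvb => by simp only [mem_lShape, lCells, box, Prod.ext_iff] at *; omega
    have hleft : ∀ v ∈ lShape m (l + 2) k l, l ≤ v.2 → v.1 ≤ a →
        box 1 a (l + 1) (l + 2) v.1 v.2 ∨ v.1 = 1 ∧ v.2 = l := fun v hv h1 h2 => by
      simp only [mem_lShape, lCells, box] at *; omega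
    have hright : ∀ v ∈ lShape m (l + 2) k l, l ≤ v.2 → a ≤ v.1 →
        box a m (l + 1) (l + 2) v.1 v.2 := fun v hv h1 h2 => by
      simp only [mem_lShape, lCells, box] at *; omega
    have hside : ∀ q, IsSTPath (lShape m (l + 2) k l) (a, b) (a, d) q →
        (∀ v ∈ q, box 1 a (l + 1) (l + 2) v.1 v.2 ∨ v.1 = 1 ∧ v.2 = l) ∨
          ∀ v ∈ q, box a m (l + 1) (l + 2) v.1 v.2 := fun q hq =>
      (hq.column_pair rfl rfl fun v hv hva => hpair v hv (by
        simp only [mem_lShape, lCells, box] at hv; omega) hva).imp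
        (fun h v hv => hleft v (hq.2.2.2.1 v hv) (hlow q hq v hv) (h v hv))
        fun h v hv => hright v (hq.2.2.2.1 v hv) (hlow q hq v hv) (h v hv)
    split_ifs with h3
    · refine HL.isLongest_of_two HP (fun x y h => ?_) hside (by omega)
      simp only [mem_lShape, lCells, box] at *; omega
    · refine HP.isLongest_of_two HL (fun x y h => ?_) (fun q hq => (hside q hq).symm) (by omega)
      simp only [mem_lShape, lCells, box] at *; omega
  rw [if_neg h3]
  have HP : Ham (box 1 m (l + 1) n) a b c d (boxPath 1 m (l + 1) n a b c d) :=
    ham_boxPath (by unfold RectOK box; omega)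
  rcases hE with h | h | ⟨h4, h5, ⟨rfl, rfl⟩ | ⟨rfl, rfl⟩⟩ | ⟨h4, h5, h6 | h6⟩
  · omega
  · omega
  · obtain rfl : b = l + 1 := by omega
    obtain rfl : d = l + 1 := by omega
    exact isLongest_top hm hk hn hl HP
  · obtain rfl : b = l + 1 := by omega
    obtain rfl : d = l + 1 := by omega
    have := (isLongest_top hm hk hn hl HP.reverse).reverse
    rwa [List.reverse_reverse] at this
  · exact isLongest_diagonal h5 hk hl h4 (by omega) HP
  · have := (isLongest_diagonal h5 hk hl h4 (by omega) HP.reverse).reverse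
    rwa [List.reverse_reverse] at this

theorem isLongest_narrowPath (hm : 2 ≤ m) (hk : m - k = 1) (hl : 1 ≤ l) (hn : 1 ≤ n - l)
    (hs : lCells m n k l a b) (ht : lCells m n k l c d) (hst : ¬ (a = c ∧ b = d)) :
    IsLongestSTPath (lShape m n k l) (a, b) (c, d) (narrowPath m n l a b c d) := by
  have hs' := hs
  have ht' := ht
  unfold lCells box at hs' ht'
  unfold narrowPath
  split_ifs with h1 h2 h3 h4 h5
  · exact isLongest_columnPath hk hs ht h1 h2
  · exact isLongest_descentPath hm hk hn hs ht h1 (by omega)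
  · exact (isLongest_descentPath hm hk hn ht hs h3 (by omega)).reverse
  · exact isLongest_lowPath hm hk hl h4 hs ht (by omega) (by omega) hst
  · obtain rfl : b = n := by omega
    obtain rfl : d = b := by omega
    exact isLongest_rowPath hk hl (by omega) (by omega) h5 (by omega)
  · obtain rfl : b = n := by omega
    obtain rfl : d = b := by omega
    exact (isLongest_rowPath hk hl (by omega) (by omega) (by omega) (by omega)).reverse

end
end Supergrid

namespace RAM

/-! ### Reasoning about programs -/

/-- Started in `σ`, the program `p` halts within `t` units of time in a state satisfying `Q`, and
all words it stores are bounded by `W`. -/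
def Run (W : ℤ) (p : Prog) (σ : State) (t : ℕ) (Q : State → Prop) : Prop :=
  ∃ T τ, Exec W p σ T τ ∧ T ≤ t ∧ Q τ

theorem Exec.mono {W W' : ℤ} (hW : W ≤ W') {p : Prog} {σ τ : State} {T : ℕ}
    (h : Exec W p σ T τ) : Exec W' p σ T τ := by
  induction h with
  | skip σ => exact .skip σ
  | assign i e σ h => exact .assign i e σ (h.trans hW)
  | store a e σ ha h => exact .store a e σ (ha.trans hW) (h.trans hW)
  | write e σ h => exact .write e σ (h.trans hW)
  | seq _ _ h₁ h₂ => exact .seq h₁ h₂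
  | cond_true hc _ h => exact .cond_true hc h
  | cond_false hc _ h => exact .cond_false hc h
  | loop_false hc => exact .loop_false hc
  | loop_true hc _ _ h₁ h₂ => exact .loop_true hc h₁ h₂

theorem Run.mono {W W' : ℤ} {p : Prog} {σ : State} {t t' : ℕ} {Q Q' : State → Prop}
    (h : Run W p σ t Q) (hW : W ≤ W') (ht : t ≤ t') (hQ : ∀ τ, Q τ → Q' τ) :
    Run W' p σ t' Q' := by
  obtain ⟨T, τ, h1, h2, h3⟩ := h
  exact ⟨T, τ, h1.mono hW, h2.trans ht, hQ τ h3⟩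

theorem Run.seq {W : ℤ} {p q : Prog} {σ : State} {t u : ℕ} {Q R : State → Prop}
    (h : Run W p σ t Q) (h' : ∀ τ, Q τ → Run W q τ u R) : Run W (.seq p q) σ (t + u) R := by
  obtain ⟨T, τ, h1, h2, h3⟩ := h
  obtain ⟨U, ρ, h4, h5, h6⟩ := h' τ h3
  exact ⟨T + U, ρ, .seq h1 h4, by omega, h6⟩

theorem Run.cond {W : ℤ} {c : Test} {p q : Prog} {σ : State} {t : ℕ} {Q : State → Prop}
    (h₁ : c.holds σ → Run W p σ t Q) (h₂ : ¬ c.holds σ → Run W q σ t Q) :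
    Run W (.cond c p q) σ (c.cost + t + 1) Q := by
  by_cases hc : c.holds σ
  · obtain ⟨T, τ, h1, h2, h3⟩ := h₁ hc
    exact ⟨_, τ, .cond_true hc h1, by omega, h3⟩
  · obtain ⟨T, τ, h1, h2, h3⟩ := h₂ hc
    exact ⟨_, τ, .cond_false hc h1, by omega, h3⟩

/-- The loop rule: `I n` holds whenever `n` more iterations are to come. -/
theorem Run.loop {W : ℤ} {c : Test} {p : Prog} {t : ℕ} (I : ℕ → State → Prop)
    (h₀ : ∀ σ, I 0 σ → ¬ c.holds σ)
    (h₁ : ∀ n σ, I (n + 1) σ → c.holds σ ∧ Run W p σ t (I n)) {n : ℕ} {σ : State} (h : I n σ) :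
    Run W (.loop c p) σ (n * (t + c.cost + 1) + (c.cost + 1)) (I 0) := by
  induction n generalizing σ with
  | zero => exact ⟨_, σ, .loop_false (h₀ σ h), by omega, h⟩
  | succ n ih =>
    obtain ⟨hc, T, τ, h1, h2, h3⟩ := h₁ n σ h
    obtain ⟨U, ρ, h4, h5, h6⟩ := ih h3
    refine ⟨_, ρ, .loop_true hc h1 h4, ?_, h6⟩
    have : (n + 1) * (t + c.cost + 1) = n * (t + c.cost + 1) + (t + c.cost + 1) := by ring
    omega

/-- An upper bound for the running time of a program without loops. -/
def Prog.cost : Prog → ℕ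
  | .skip => 1
  | .assign _ e => e.cost + 1
  | .store a e => a.cost + e.cost + 1
  | .write e => e.cost + 1
  | .seq p q => p.cost + q.cost
  | .cond c p q => c.cost + (p.cost + q.cost) + 1
  | .loop _ _ => 0

/-- The weakest precondition of a program without loops. -/
def wp (W : ℤ) : Prog → State → (State → Prop) → Prop
  | .skip, σ, Q => Q σ
  | .assign i e, σ, Q => |e.eval σ| ≤ W ∧ Q { σ with reg := Function.update σ.reg i (e.eval σ) }
  | .store a e, σ, Q => |a.eval σ| ≤ W ∧ |e.eval σ| ≤ W ∧
      Q { σ with mem := Function.update σ.mem (a.eval σ) (e.eval σ) }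
  | .write e, σ, Q => |e.eval σ| ≤ W ∧ Q { σ with out := σ.out ++ [e.eval σ] }
  | .seq p q, σ, Q => wp W p σ fun τ => wp W q τ Q
  | .cond c p q, σ, Q => (c.holds σ → wp W p σ Q) ∧ (¬ c.holds σ → wp W q σ Q)
  | .loop _ _, _, _ => False

theorem Run.of_wp {W : ℤ} {p : Prog} {σ : State} {Q : State → Prop} (h : wp W p σ Q) :
    Run W p σ p.cost Q := by
  induction p generalizing σ Q with
  | skip => exact ⟨_, _, .skip σ, le_rfl, h⟩
  | assign i e => exact ⟨_, _, .assign i e σ h.1, le_rfl, h.2⟩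
  | store a e => exact ⟨_, _, .store a e σ h.1 h.2.1, le_rfl, h.2.2⟩
  | write e => exact ⟨_, _, .write e σ h.1, le_rfl, h.2⟩
  | seq p q hp hq => exact (hp h).seq fun τ hτ => hq hτ
  | cond c p q hp hq =>
    exact Run.cond (fun hc => (hp (h.1 hc)).mono le_rfl (Nat.le_add_right _ _) fun _ => id)
      (fun hc => (hq (h.2 hc)).mono le_rfl (Nat.le_add_left _ _) fun _ => id)
  | loop c p => exact h.elim

theorem wp.mono {W : ℤ} {p : Prog} {σ : State} {Q R : State → Prop} (h : wp W p σ Q)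
    (hQ : ∀ τ, Q τ → R τ) : wp W p σ R := by
  induction p generalizing σ Q R with
  | skip => exact hQ _ h
  | assign i e => exact ⟨h.1, hQ _ h.2⟩
  | store a e => exact ⟨h.1, h.2.1, hQ _ h.2.2⟩
  | write e => exact ⟨h.1, hQ _ h.2⟩
  | seq p q hp hq => exact hp h fun τ hτ => hq hτ hQ
  | cond c p q hp hq => exact ⟨fun hc => hp (h.1 hc) hQ, fun hc => hq (h.2 hc) hQ⟩
  | loop c p => exact h.elim

/-! ### Lists of cells in memory -/

/-- The memory holds the list at the positions `s, s + 1, …`; position `i` consists of the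
addresses `i` and `-1 - i`. -/
def Arr (mem : ℤ → ℤ) : ℤ → List (ℤ × ℤ) → Prop
  | _, [] => True
  | s, v :: L => mem s = v.1 ∧ mem (-1 - s) = v.2 ∧ Arr mem (s + 1) L

theorem arr_append {mem : ℤ → ℤ} {s : ℤ} {L M : List (ℤ × ℤ)} :
    Arr mem s (L ++ M) ↔ Arr mem s L ∧ Arr mem (s + L.length) M := by
  induction L generalizing s with
  | nil => simp [Arr]
  | cons v L ih =>
    simp only [List.cons_append, Arr, ih, List.length_cons, Nat.cast_add, Nat.cast_one]
    have : s + 1 + (L.length : ℤ) = s + (L.length + 1) := by ring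
    rw [this]
    tauto

theorem Arr.congr {mem mem' : ℤ → ℤ} {s : ℤ} {L : List (ℤ × ℤ)} (h : Arr mem s L)
    (hm : ∀ z, s ≤ z → z < s + L.length → mem' z = mem z ∧ mem' (-1 - z) = mem (-1 - z)) :
    Arr mem' s L := by
  induction L generalizing s with
  | nil => trivial
  | cons v L ih =>
    simp only [List.length_cons] at hm
    refine ⟨(hm s le_rfl (by omega)).1.trans h.1, (hm s le_rfl (by omega)).2.trans h.2.1,
      ih h.2.2 fun z h1 h2 => hm z (by omega) (by omega)⟩

/-- The input registers hold `e`. -/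
def Agree (σ : State) (e : ℕ → ℤ) : Prop := ∀ i < 8, σ.reg i = e i

/-- In the state `σ`, register 8 and the memory hold the stack `L`, while the other registers below
`b` and the output are as in `σ₀`. -/
structure Ok (b : ℕ) (σ₀ : State) (L : List (ℤ × ℤ)) (σ : State) : Prop where
  sp : σ.reg 8 = L.length
  arr : Arr σ.mem 0 L
  frame : ∀ i < b, i ≠ 8 → σ.reg i = σ₀.reg i
  out : σ.out = σ₀.out

theorem Ok.trans {b b' : ℕ} (hb : b ≤ b') {σ₀ σ₁ σ₂ : State} {L M : List (ℤ × ℤ)}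
    (h₁ : Ok b σ₀ L σ₁) (h₂ : Ok b' σ₁ M σ₂) : Ok b σ₀ M σ₂ :=
  ⟨h₂.sp, h₂.arr, fun i hi h8 => (h₂.frame i (by omega) h8).trans (h₁.frame i hi h8),
    h₂.out.trans h₁.out⟩

theorem Ok.self {b b' : ℕ} {σ₀ σ : State} {L : List (ℤ × ℤ)} (h : Ok b σ₀ L σ) : Ok b' σ L σ :=
  ⟨h.sp, h.arr, fun _ _ _ => rfl, rfl⟩

theorem Ok.agree {b : ℕ} (hb : 9 ≤ b) {σ₀ σ : State} {L : List (ℤ × ℤ)} {e : ℕ → ℤ}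
    (h : Ok b σ₀ L σ) (he : Agree σ₀ e) : Agree σ e :=
  fun i hi => (h.frame i (by omega) (by omega)).trans (he i hi)

/-- Push a cell onto the stack. -/
def push (E₁ E₂ : Expr) : Prog :=
  .seq (.store (.reg 8) E₁) (.seq (.store (.sub (.const (-1)) (.reg 8)) E₂)
    (.assign 8 (.add (.reg 8) (.const 1))))

theorem wp_push {W : ℤ} {E₁ E₂ : Expr} {b : ℕ} {σ₀ σ : State} {L : List (ℤ × ℤ)} {v : ℤ × ℤ}
    (h : Ok b σ₀ L σ) (hL : L.length + 1 ≤ W) (h1 : |v.1| ≤ W) (h2 : |v.2| ≤ W)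
    (hv : ∀ τ : State, τ.reg = σ.reg → E₁.eval τ = v.1 ∧ E₂.eval τ = v.2) :
    wp W (push E₁ E₂) σ fun τ => Ok b σ₀ (L ++ [v]) τ ∧ (∀ i, i ≠ 8 → τ.reg i = σ.reg i) ∧
      ∀ z : ℤ, z ≠ L.length → z ≠ -1 - L.length → τ.mem z = σ.mem z := by
  have e1 := (hv σ rfl).1
  have e2 := hv { σ with mem := Function.update σ.mem L.length v.1 } rfl
  have hsp := h.sp
  simp only [push, wp, Expr.eval, hsp, e1, e2.2]
  refine ⟨by rw [abs_of_nonneg] <;> omega, h1, by rw [abs_of_nonpos] <;> omega, h2,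
    by rw [abs_of_nonneg] <;> omega, ⟨by simp, ?_, ?_, h.out⟩, ?_, ?_⟩
  · refine arr_append.2 ⟨h.arr.congr fun z hz hz' => ?_, ?_⟩
    · dsimp only
      constructor <;> rw [Function.update_of_ne (by omega), Function.update_of_ne (by omega)]
    · simp only [Arr, zero_add, Function.update_self, and_true]
      rw [Function.update_of_ne (by omega), Function.update_self]
  · intro i hi h8
    dsimp only
    rw [Function.update_of_ne h8]
    exact h.frame i hi h8
  · intro i h8
    rw [Function.update_of_ne h8]
  · intro z hz hz'
    rw [Function.update_of_ne hz', Function.update_of_ne hz]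

/-! ### Functions of the input -/

/-- The inputs are bounded by `B`, and so is the area `e 0 * e 1`. -/
structure Adm (e : ℕ → ℤ) (B : ℕ) : Prop where
  one_le : 1 ≤ B
  abs_le : ∀ i < 8, |e i| ≤ B
  area_le : e 0 * e 1 ≤ B

/-- The integer function `g` of the input is given by an expression without memory access, and is
linearly bounded. -/
class Lin (g : (ℕ → ℤ) → ℤ) : Prop where
  expr : ∃ E : Expr, ∀ σ e, Agree σ e → E.eval σ = g e
  bound : ∃ c : ℕ, ∀ e B, Adm e B → |g e| ≤ ((c * B : ℕ) : ℤ)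

theorem lin_const (c : ℤ) : Lin fun _ => c :=
  ⟨⟨.const c, fun _ _ _ => rfl⟩, c.natAbs, fun e B h => by
    have := h.one_le
    push_cast
    rw [Int.abs_eq_natAbs]
    have h0 : (0 : ℤ) ≤ (c.natAbs : ℤ) := by positivity
    nlinarith⟩

theorem lin_var (i : ℕ) (hi : i < 8) : Lin fun e => e i :=
  ⟨⟨.reg i, fun _ _ h => h i hi⟩, 1, fun e B h => by simpa using h.abs_le i hi⟩

theorem Lin.add {g h : (ℕ → ℤ) → ℤ} (hg : Lin g) (hh : Lin h) : Lin fun e => g e + h e := by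
  obtain ⟨⟨E, hE⟩, c, hc⟩ := hg
  obtain ⟨⟨F, hF⟩, d, hd⟩ := hh
  refine ⟨⟨.add E F, fun σ e h => by simp only [Expr.eval, hE σ e h, hF σ e h]⟩, c + d,
    fun e B h => ?_⟩
  have h1 := hc e B h
  have h2 := hd e B h
  rw [abs_le] at *
  rw [add_mul]
  omega

theorem Lin.sub {g h : (ℕ → ℤ) → ℤ} (hg : Lin g) (hh : Lin h) : Lin fun e => g e - h e := by
  obtain ⟨⟨E, hE⟩, c, hc⟩ := hg
  obtain ⟨⟨F, hF⟩, d, hd⟩ := hh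
  refine ⟨⟨.sub E F, fun σ e h => by simp only [Expr.eval, hE σ e h, hF σ e h]⟩, c + d,
    fun e B h => ?_⟩
  have h1 := hc e B h
  have h2 := hd e B h
  rw [abs_le] at *
  rw [add_mul]
  omega

/-- The condition `p` on the input is decided by a test without memory access. -/
class LinTest (p : (ℕ → ℤ) → Prop) : Prop where
  test : ∃ c : Test, ∀ σ e, Agree σ e → (c.holds σ ↔ p e)

theorem LinTest.not {p : (ℕ → ℤ) → Prop} (hp : LinTest p) : LinTest fun e => ¬ p e := by
  obtain ⟨c, hc⟩ := hp
  exact ⟨.not c, fun σ e h => by simp only [Test.holds, hc σ e h]⟩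

theorem LinTest.and {p q : (ℕ → ℤ) → Prop} (hp : LinTest p) (hq : LinTest q) :
    LinTest fun e => p e ∧ q e := by
  obtain ⟨c, hc⟩ := hp
  obtain ⟨d, hd⟩ := hq
  exact ⟨.and c d, fun σ e h => by simp only [Test.holds, hc σ e h, hd σ e h]⟩

theorem LinTest.congr {p q : (ℕ → ℤ) → Prop} (hp : LinTest p) (h : ∀ e, p e ↔ q e) :
    LinTest q := by
  obtain ⟨c, hc⟩ := hp
  exact ⟨c, fun σ e h' => (hc σ e h').trans (h e)⟩

theorem LinTest.or {p q : (ℕ → ℤ) → Prop} (hp : LinTest p) (hq : LinTest q) :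
    LinTest fun e => p e ∨ q e :=
  (hp.not.and hq.not).not.congr fun e => by tauto

theorem LinTest.imp {p q : (ℕ → ℤ) → Prop} (hp : LinTest p) (hq : LinTest q) :
    LinTest fun e => p e → q e :=
  (hp.and hq.not).not.congr fun e => by tauto

theorem Lin.lt {g h : (ℕ → ℤ) → ℤ} (hg : Lin g) (hh : Lin h) : LinTest fun e => g e < h e := by
  obtain ⟨⟨E, hE⟩, -⟩ := hg
  obtain ⟨⟨F, hF⟩, -⟩ := hh
  exact ⟨.lt E F, fun σ e h => by simp only [Test.holds, hE σ e h, hF σ e h]⟩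

theorem Lin.eq {g h : (ℕ → ℤ) → ℤ} (hg : Lin g) (hh : Lin h) : LinTest fun e => g e = h e := by
  obtain ⟨⟨E, hE⟩, -⟩ := hg
  obtain ⟨⟨F, hF⟩, -⟩ := hh
  exact ⟨.eq E F, fun σ e h => by simp only [Test.holds, hE σ e h, hF σ e h]⟩

theorem Lin.le {g h : (ℕ → ℤ) → ℤ} (hg : Lin g) (hh : Lin h) : LinTest fun e => g e ≤ h e :=
  (hh.lt hg).not.congr fun e => by simp

/-! ### Computable lists of cells -/

/-- The list has at most `N` cells, with coordinates of absolute value at most `N`. -/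
def Small (N : ℕ) (p : List (ℤ × ℤ)) : Prop :=
  p.length ≤ N ∧ ∀ v ∈ p, |v.1| ≤ N ∧ |v.2| ≤ N

theorem Small.mono {N N' : ℕ} {p : List (ℤ × ℤ)} (h : Small N p) (hN : N ≤ N') : Small N' p :=
  ⟨h.1.trans hN, fun v hv => ⟨(h.2 v hv).1.trans (by exact_mod_cast hN),
    (h.2 v hv).2.trans (by exact_mod_cast hN)⟩⟩

theorem small_append {N : ℕ} {p q : List (ℤ × ℤ)} (h : Small N (p ++ q)) :
    Small N p ∧ Small N q := by
  have h1 := h.1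
  rw [List.length_append] at h1
  exact ⟨⟨by omega, fun v hv => h.2 v (List.mem_append_left _ hv)⟩,
    ⟨by omega, fun v hv => h.2 v (List.mem_append_right _ hv)⟩⟩

/-- A program using registers from `b` on pushes the list `f e` onto the stack for every input `e`
in the domain `D`.  As long as the lists are of linear size, it takes linear time and stores words
of linear size only. -/
class Comp (D : (ℕ → ℤ) → Prop) (f : (ℕ → ℤ) → List (ℤ × ℤ)) : Prop where
  prog : ∀ b, 9 ≤ b → ∃ P : Prog, ∀ K : ℕ, ∃ C : ℕ, ∀ e B, Adm e B → D e → Small (K * B) (f e) →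
    ∀ σ L, Agree σ e → Ok b σ L σ → L.length ≤ K * B →
      Run ((C * B : ℕ) : ℤ) P σ (C * B) (Ok b σ (L ++ f e))

variable {D D' : (ℕ → ℤ) → Prop} {f g : (ℕ → ℤ) → List (ℤ × ℤ)}

theorem Comp.congr (hf : Comp D f) (hD : ∀ e, D' e → D e) (h : ∀ e, D' e → g e = f e) :
    Comp D' g := by
  refine ⟨fun b hb => ?_⟩
  obtain ⟨P, hP⟩ := hf.prog b hb
  refine ⟨P, fun K => ?_⟩
  obtain ⟨C, hC⟩ := hP K
  refine ⟨C, fun e B hB hDe hs σ L hσ hL hlen => ?_⟩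
  rw [h e hDe] at hs ⊢
  exact hC e B hB (hD e hDe) hs σ L hσ hL hlen

theorem Comp.mono (hf : Comp D f) (hD : ∀ e, D' e → D e) : Comp D' f :=
  hf.congr hD fun _ _ => rfl

theorem comp_single {x y : (ℕ → ℤ) → ℤ} (hx : Lin x) (hy : Lin y) :
    Comp D fun e => [(x e, y e)] := by
  obtain ⟨⟨E, hE⟩, -⟩ := hx
  obtain ⟨⟨F, hF⟩, -⟩ := hy
  refine ⟨fun b hb => ⟨push E F, fun K => ⟨K + 1 + (push E F).cost,
    fun e B hB _ hs σ L hσ hL hlen => ?_⟩⟩⟩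
  have h1 := hB.one_le
  have h2 := hs.2 _ (List.mem_singleton_self _)
  have h3 : (K + 1 + (push E F).cost) * B = K * B + B + (push E F).cost * B := by ring
  have h4 : (push E F).cost ≤ (push E F).cost * B := Nat.le_mul_of_pos_right _ h1
  have hagr : ∀ τ : State, τ.reg = σ.reg → Agree τ e := fun τ hτ i hi => by rw [hτ]; exact hσ i hi
  refine (Run.of_wp (wp_push (v := (x e, y e)) (W := ((K + 1 + (push E F).cost) * B : ℕ)) hL
    ?_ ?_ ?_ fun τ hτ => ⟨hE τ e (hagr τ hτ), hF τ e (hagr τ hτ)⟩)).mono le_rfl ?_ fun τ h => h.1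
  · rw [h3]; push_cast; omega
  · rw [h3]; refine h2.1.trans ?_; push_cast; omega
  · rw [h3]; refine h2.2.trans ?_; push_cast; omega
  · omega

theorem Comp.append (hf : Comp D f) (hg : Comp D g) : Comp D fun e => f e ++ g e := by
  refine ⟨fun b hb => ?_⟩
  obtain ⟨P, hP⟩ := hf.prog b hb
  obtain ⟨Q, hQ⟩ := hg.prog b hb
  refine ⟨.seq P Q, fun K => ?_⟩
  obtain ⟨C₁, hC₁⟩ := hP K
  obtain ⟨C₂, hC₂⟩ := hQ (2 * K)
  refine ⟨C₁ + C₂, fun e B hB hDe hs σ L hσ hL hlen => ?_⟩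
  obtain ⟨s1, s2⟩ := small_append hs
  have e1 : (C₁ + C₂) * B = C₁ * B + C₂ * B := by ring
  have e2 : 2 * K * B = 2 * (K * B) := by ring
  rw [e1]
  refine ((hC₁ e B hB hDe s1 σ L hσ hL hlen).mono (by push_cast; omega) le_rfl fun _ => id).seq
    fun τ hτ => ?_
  refine (hC₂ e B hB hDe (s2.mono (by omega)) τ _ (hτ.agree hb hσ) hτ.self ?_).mono
    (by push_cast; omega) le_rfl fun ρ hρ => ?_
  · rw [List.length_append]; have := s1.1; omega
  · have := hτ.trans le_rfl hρ
    rwa [List.append_assoc] at this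

theorem Comp.ite {p : (ℕ → ℤ) → Prop} [∀ e, Decidable (p e)] (hp : LinTest p)
    (hf : Comp (fun e => D e ∧ p e) f) (hg : Comp (fun e => D e ∧ ¬ p e) g) :
    Comp D fun e => if p e then f e else g e := by
  obtain ⟨c, hc⟩ := hp
  refine ⟨fun b hb => ?_⟩
  obtain ⟨P, hP⟩ := hf.prog b hb
  obtain ⟨Q, hQ⟩ := hg.prog b hb
  refine ⟨.cond c P Q, fun K => ?_⟩
  obtain ⟨C₁, hC₁⟩ := hP K
  obtain ⟨C₂, hC₂⟩ := hQ K
  refine ⟨C₁ + C₂ + (c.cost + 1), fun e B hB hDe hs σ L hσ hL hlen => ?_⟩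
  have h1 := hB.one_le
  have e1 : (C₁ + C₂ + (c.cost + 1)) * B = C₁ * B + C₂ * B + (c.cost + 1) * B := by ring
  have h4 : c.cost + 1 ≤ (c.cost + 1) * B := Nat.le_mul_of_pos_right _ h1
  refine (Run.cond (t := C₁ * B + C₂ * B) (W := (((C₁ + C₂ + (c.cost + 1)) * B : ℕ) : ℤ))
    (Q := Ok b σ (L ++ if p e then f e else g e)) (fun h => ?_)
    fun h => ?_).mono le_rfl (by omega) fun _ => id
  · rw [hc σ e hσ] at h
    simp only [if_pos h] at hs ⊢
    exact (hC₁ e B hB ⟨hDe, h⟩ hs σ L hσ hL hlen).mono (Int.ofNat_le.2 (by omega)) (by omega)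
      fun _ => id
  · rw [hc σ e hσ] at h
    simp only [if_neg h] at hs ⊢
    exact (hC₂ e B hB ⟨hDe, h⟩ hs σ L hσ hL hlen).mono (Int.ofNat_le.2 (by omega)) (by omega)
      fun _ => id

end RAM

namespace RAM

/-! ### In-place transformations of the top of the stack -/

/-- Run through a list with a flag that is raised at the cell `c`, apply `φ` to the cells, and keep
those for which `k flag hit` holds, where `hit` tells whether the cell is `c`. -/
def scan (k : Bool → Bool → Bool) (φ : ℤ × ℤ → ℤ × ℤ) (c : ℤ × ℤ) :
    Bool → List (ℤ × ℤ) → List (ℤ × ℤ)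
  | _, [] => []
  | b, v :: R =>
    if k (b || decide (v = c)) (decide (v = c)) then φ v :: scan k φ c (b || decide (v = c)) R
    else scan k φ c (b || decide (v = c)) R

/-- The Boolean function `k` of two registers is decided by a test. -/
def KeepTest (k : Bool → Bool → Bool) : Prop :=
  ∀ r₁ r₂ : ℕ, ∃ c : Test, ∀ (σ : State) (x y : Bool), σ.reg r₁ = x.toNat → σ.reg r₂ = y.toNat →
    (c.holds σ ↔ k x y = true)

/-- The map `φ e` of cells is given by expressions in two registers. -/
def LinMap (φ : (ℕ → ℤ) → ℤ × ℤ → ℤ × ℤ) : Prop :=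
  ∀ r₁ r₂ : ℕ, ∃ E₁ E₂ : Expr, ∀ (σ : State) e v, Agree σ e → σ.reg r₁ = v.1 → σ.reg r₂ = v.2 →
    E₁.eval σ = (φ e v).1 ∧ E₂.eval σ = (φ e v).2

/-- The invariant of the loop for `scan`: `n` cells `R` are left to read. -/
structure ScanInv (b : ℕ) (σ : State) (L T : List (ℤ × ℤ)) (N : ℤ)
    (F : Bool → List (ℤ × ℤ) → List (ℤ × ℤ)) (n : ℕ) (τ : State) (out R : List (ℤ × ℤ))
    (fl : Bool) : Prop where
  len : R.length = n
  eq : out ++ F fl R = T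
  ok : Ok b σ (L ++ out) τ
  flag : τ.reg (b + 2) = fl.toNat
  pos : τ.reg (b + 1) + n = N
  limit : τ.reg (b + 5) = N
  le : (L ++ out).length ≤ τ.reg (b + 1)
  arr : Arr τ.mem (τ.reg (b + 1)) R

variable {D D' : (ℕ → ℤ) → Prop} {f g : (ℕ → ℤ) → List (ℤ × ℤ)}

/-- The body of the loop for `scan`. -/
def scanBody (b : ℕ) (X Y : Expr) (kt : Test) (E₁ E₂ : Expr) : Prog :=
  .seq (.assign (b + 3) (.load (.reg (b + 1))))
    (.seq (.assign (b + 4) (.load (.sub (.const (-1)) (.reg (b + 1)))))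
    (.seq (.assign (b + 1) (.add (.reg (b + 1)) (.const 1)))
    (.seq (.cond (.and (.eq (.reg (b + 3)) X) (.eq (.reg (b + 4)) Y))
      (.seq (.assign (b + 6) (.const 1)) (.assign (b + 2) (.const 1)))
      (.assign (b + 6) (.const 0)))
    (.cond kt (push E₁ E₂) .skip))))

theorem wp_scanBody {k : Bool → Bool → Bool} {φ : ℤ × ℤ → ℤ × ℤ} {b : ℕ} (hb : 9 ≤ b)
    {X Y E₁ E₂ : Expr} {kt : Test} {e : ℕ → ℤ} {x y : ℤ}
    (hX : ∀ σ, Agree σ e → X.eval σ = x) (hY : ∀ σ, Agree σ e → Y.eval σ = y)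
    (hk : ∀ (σ : State) (p q : Bool), σ.reg (b + 2) = p.toNat → σ.reg (b + 6) = q.toNat →
      (kt.holds σ ↔ k p q = true))
    (hE : ∀ (σ : State) v, Agree σ e → σ.reg (b + 3) = v.1 → σ.reg (b + 4) = v.2 →
      E₁.eval σ = (φ v).1 ∧ E₂.eval σ = (φ v).2)
    {W N : ℤ} {σ : State} (hσ : Agree σ e) {L T : List (ℤ × ℤ)}
    (hT : ∀ v ∈ T, |v.1| ≤ W ∧ |v.2| ≤ W) (hLT : L.length + T.length + 1 ≤ W) (hN : N + 1 ≤ W)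
    (hW : 1 ≤ W)
    {n : ℕ} {τ : State} {out R : List (ℤ × ℤ)} {v : ℤ × ℤ} {fl : Bool}
    (hv : |v.1| ≤ W ∧ |v.2| ≤ W)
    (H : ScanInv b σ L T N (scan k φ (x, y)) (n + 1) τ out (v :: R) fl) :
    wp W (scanBody b X Y kt E₁ E₂) τ fun ρ => ∃ out' fl',
      ScanInv b σ L T N (scan k φ (x, y)) n ρ out' R fl' := by
  have hlen := H.len
  have hle := H.le
  have hpos := H.pos
  have harr := H.arr
  simp only [Arr] at harr
  simp only [List.length_cons] at hlen
  have d8 : ∀ j : ℕ, b + j ≠ 8 := fun j => by omega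
  -- Once the cell has been read and the flag updated, it is kept or dropped.
  have tail : ∀ (ρ : State) (hit : Bool), hit = decide (v = (x, y)) → Ok b σ (L ++ out) ρ →
      ρ.reg (b + 3) = v.1 → ρ.reg (b + 4) = v.2 → ρ.reg (b + 2) = (fl || hit).toNat →
      ρ.reg (b + 6) = hit.toNat → ρ.reg (b + 1) = τ.reg (b + 1) + 1 → ρ.reg (b + 5) = N →
      ρ.mem = τ.mem → wp W (.cond kt (push E₁ E₂) .skip) ρ fun ρ => ∃ out' fl',
        ScanInv b σ L T N (scan k φ (x, y)) n ρ out' R fl' := by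
    intro ρ hit hhit ho h3 h4 h2 h6 h1 h5 hm
    have heq := H.eq
    simp only [scan, ← hhit] at heq
    refine ⟨fun hc => ?_, fun hc => ?_⟩
    · rw [hk ρ _ _ h2 h6] at hc
      rw [if_pos hc] at heq
      have hmem : φ v ∈ T := by rw [← heq]; simp
      have hl : (L ++ out).length + 1 ≤ L.length + T.length := by
        rw [← heq]; simp only [List.length_append, List.length_cons]; omega
      refine (wp_push ho (v := φ v) (by omega) (hT _ hmem).1 (hT _ hmem).2 fun π hπ => ?_).mono
        fun π hπ => ?_
      · refine hE π v (fun i hi => ?_) ?_ ?_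
        · rw [hπ]; exact ho.agree hb hσ i hi
        · rw [hπ]; exact h3
        · rw [hπ]; exact h4
      · obtain ⟨p1, p2, p3⟩ := hπ
        refine ⟨out ++ [φ v], fl || hit, by omega, by rw [← heq]; simp, ?_, ?_, ?_, ?_, ?_, ?_⟩
        · rw [← List.append_assoc]; exact p1
        · rw [p2 _ (d8 2), h2]
        · rw [p2 _ (d8 1), h1]; push_cast at hpos; omega
        · rw [p2 _ (d8 5), h5]
        · rw [p2 _ (d8 1), h1, ← List.append_assoc, List.length_append (bs := [φ v])]
          simp only [List.length_singleton]; omega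
        · rw [p2 _ (d8 1), h1]
          exact harr.2.2.congr fun z hz hz' =>
            ⟨(p3 z (by omega) (by omega)).trans (by rw [hm]),
              (p3 _ (by omega) (by omega)).trans (by rw [hm])⟩
    · rw [hk ρ _ _ h2 h6] at hc
      rw [if_neg hc] at heq
      refine ⟨out, fl || hit, by omega, heq, ho, h2, ?_, h5, ?_, ?_⟩
      · rw [h1]; push_cast at hpos; omega
      · rw [h1]; omega
      · rw [h1, hm]; exact harr.2.2
  have hlimit := H.limit
  have hflag := H.flag
  have hok := H.ok
  have e1 : τ.mem (τ.reg (b + 1)) = v.1 := harr.1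
  have e2 : τ.mem (-1 - τ.reg (b + 1)) = v.2 := harr.2.1
  have hreg : ∀ i < b, i ≠ b + 1 ∧ i ≠ b + 2 ∧ i ≠ b + 3 ∧ i ≠ b + 4 ∧ i ≠ b + 6 := fun i hi => by
    omega
  have d8' : ∀ j : ℕ, (8 : ℕ) ≠ b + j := fun j => by omega
  have agree : ∀ ρ : State, (∀ i < b, i ≠ 8 → ρ.reg i = τ.reg i) → Agree ρ e := fun ρ hρ i hi => by
    rw [hρ i (by omega) (by omega)]; exact hok.agree hb hσ i hi
  simp only [scanBody, wp, Expr.eval, Test.holds, Function.update_self,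
    Function.update_of_ne (show b + 1 ≠ b + 3 by omega),
    Function.update_of_ne (show b + 1 ≠ b + 4 by omega),
    Function.update_of_ne (show b + 3 ≠ b + 1 by omega),
    Function.update_of_ne (show b + 3 ≠ b + 4 by omega),
    Function.update_of_ne (show b + 4 ≠ b + 1 by omega), e1, e2]
  refine ⟨hv.1, hv.2, ?_, fun hc => ⟨by simpa using hW, by simpa using hW, ?_⟩, fun hc =>
    ⟨by simp; omega, ?_⟩⟩
  · rw [abs_of_nonneg (by omega)]; push_cast at hpos; omega
  · rw [hX _ (agree _ fun i hi h8 => by simp [hreg i hi]),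
      hY _ (agree _ fun i hi h8 => by simp [hreg i hi])] at hc
    refine tail _ true ?_ ⟨?_, ?_, ?_, ?_⟩ ?_ ?_ ?_ ?_ ?_ ?_ rfl
    · have : v = (x, y) := Prod.ext hc.1 hc.2
      simp [this]
    · simp [d8', hok.sp]
    · exact hok.arr
    · intro i hi h8
      simp only [Function.update_apply, hreg i hi, if_false]
      exact hok.frame i hi h8
    · exact hok.out
    all_goals simp [hlimit]
  · rw [hX _ (agree _ fun i hi h8 => by simp [hreg i hi]),
      hY _ (agree _ fun i hi h8 => by simp [hreg i hi])] at hc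
    refine tail _ false ?_ ⟨?_, ?_, ?_, ?_⟩ ?_ ?_ ?_ ?_ ?_ ?_ rfl
    · have : v ≠ (x, y) := fun h => hc (by simp [h])
      simp [this]
    · simp [d8', hok.sp]
    · exact hok.arr
    · intro i hi h8
      simp only [Function.update_apply, hreg i hi, if_false]
      exact hok.frame i hi h8
    · exact hok.out
    all_goals simp [hlimit, hflag]

theorem Comp.scan {k : Bool → Bool → Bool} {φ : (ℕ → ℤ) → ℤ × ℤ → ℤ × ℤ} {x y : (ℕ → ℤ) → ℤ}
    (hf : Comp D f) (hk : KeepTest k) (hφ : LinMap φ) (hx : Lin x) (hy : Lin y)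
    (hs : ∀ K, ∃ K', ∀ e B, Adm e B → D e →
      Small (K * B) (RAM.scan k (φ e) (x e, y e) false (f e)) → Small (K' * B) (f e)) :
    Comp D fun e => RAM.scan k (φ e) (x e, y e) false (f e) := by
  obtain ⟨⟨X, hX⟩, -⟩ := hx
  obtain ⟨⟨Y, hY⟩, -⟩ := hy
  refine ⟨fun b hb => ?_⟩
  obtain ⟨P, hP⟩ := hf.prog (b + 1) (by omega)
  obtain ⟨kt, hkt⟩ := hk (b + 2) (b + 6)
  obtain ⟨E₁, E₂, hE⟩ := hφ (b + 3) (b + 4)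
  set body := scanBody b X Y kt E₁ E₂ with hbody
  set ini : Prog := .seq (.assign (b + 1) (.reg b)) (.seq (.assign (b + 5) (.reg 8))
    (.seq (.assign (b + 2) (.const 0)) (.assign 8 (.reg b)))) with hini
  set test : Test := .lt (.reg (b + 1)) (.reg (b + 5)) with htest
  refine ⟨.seq (.assign b (.reg 8)) (.seq P (.seq ini (.loop test body))), fun K => ?_⟩
  obtain ⟨K', hK'⟩ := hs K
  obtain ⟨C, hC⟩ := hP (K + K')
  refine ⟨C + (2 * K + K') + K' * (body.cost + test.cost + 1) + (ini.cost + test.cost + 5),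
    fun e B hB hDe hsm σ L hσ hL hlen => ?_⟩
  have hS := hK' e B hB hDe hsm
  have h1 := hB.one_le
  set c₁ := body.cost + test.cost + 1
  set c₂ := ini.cost + test.cost + 5
  have eC : (C + (2 * K + K') + K' * c₁ + c₂) * B = C * B + (2 * (K * B) + K' * B) +
      (K' * B) * c₁ + c₂ * B := by ring
  have h4 : c₂ ≤ c₂ * B := Nat.le_mul_of_pos_right _ h1
  have eK : (K + K') * B = K * B + K' * B := by ring
  rw [eC]
  set W : ℤ := ((C * B + (2 * (K * B) + K' * B) + (K' * B) * c₁ + c₂ * B : ℕ) : ℤ) with hW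
  have hc₂ : 5 ≤ c₂ := Nat.le_add_left _ _
  have hCW : ((C * B : ℕ) : ℤ) ≤ W := by rw [hW]; exact Int.ofNat_le.2 (by omega)
  have hKW : ((2 * (K * B) + K' * B + 5 : ℕ) : ℤ) ≤ W := by rw [hW]; exact Int.ofNat_le.2 (by omega)
  push_cast at hKW
  set T := RAM.scan k (φ e) (x e, y e) false (f e) with hT
  have hTl := hsm.1
  have hSl := hS.1
  have hd : ∀ j, 1 ≤ j → (8 : ℕ) ≠ b + j ∧ b ≠ b + j := fun j hj => by omega
  have hb8 : (8 : ℕ) ≠ b := by omega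
  -- Register `b` remembers the height of the stack, so that `f e` can be found above it.
  refine Run.mono (t := 2 + (C * B + (ini.cost + (K' * B * c₁ + (test.cost + 1))))) (Run.seq
    (Q := fun τ => Ok (b + 1) τ L τ ∧ Ok b σ L τ ∧ τ.reg b = L.length)
    (Run.of_wp (p := .assign b (.reg 8)) ?_) fun τ hτ => ?_) le_rfl ?_ fun _ => id
  · simp only [wp, Expr.eval]
    rw [hL.sp]
    refine ⟨by rw [abs_of_nonneg] <;> omega, ⟨?_, hL.arr, fun _ _ _ => rfl, rfl⟩,
      ⟨?_, hL.arr, fun i hi h8 => ?_, rfl⟩, by simp⟩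
    · simp [Function.update_of_ne hb8, hL.sp]
    · simp [Function.update_of_ne hb8, hL.sp]
    · simp [Function.update_of_ne (show i ≠ b by omega)]
  · obtain ⟨t1, t2, t3⟩ := hτ
    refine ((hC e B hB hDe (hS.mono (by omega)) τ L (t2.agree hb hσ) t1 (by omega)).mono hCW le_rfl
      fun _ => id).seq fun ρ hρ => ?_
    have hρb : ρ.reg b = L.length := (hρ.frame b (by omega) (by omega)).trans t3
    have hρo : Ok b σ (L ++ f e) ρ := t2.trans (by omega) hρ
    have hArr := (arr_append.1 hρ.arr).2
    -- The stack is cut back: the kept cells overwrite those of `f e` that have been read.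
    refine Run.seq (Q := fun π => ScanInv b σ L T ((L ++ f e).length : ℤ)
      (RAM.scan k (φ e) (x e, y e)) (f e).length π [] (f e) false) (Run.of_wp ?_) fun π hπ => ?_
    · simp only [hini, wp, Expr.eval, Function.update_apply, hd 1 le_rfl, hd 2 (by omega),
        hd 5 (by omega), if_false, hρb, hρ.sp]
      rw [List.length_append] at *
      refine ⟨by rw [abs_of_nonneg] <;> omega, by rw [abs_of_nonneg] <;> omega,
        by simp; omega, by rw [abs_of_nonneg] <;> omega, rfl, rfl, ⟨?_, ?_, ?_, hρo.out⟩,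
        ?_, ?_, ?_, ?_, ?_⟩
      · simp
      · rw [List.append_nil]; exact (arr_append.1 hρ.arr).1
      · intro i hi h8
        simp only [Function.update_apply, h8, show i ≠ b + 1 by omega, show i ≠ b + 2 by omega,
          show i ≠ b + 5 by omega, if_false]
        exact hρo.frame i hi h8
      · simp [show b + 2 ≠ 8 by omega]
      · simp [show b + 1 ≠ 8 by omega]
      · simp [show b + 5 ≠ 8 by omega]
      · simp [show b + 1 ≠ 8 by omega]
      · simpa [Function.update_apply, show b + 1 ≠ 8 by omega] using hArr
    · refine (Run.loop (t := body.cost) (fun n π => ∃ out R fl, ScanInv b σ L T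
        ((L ++ f e).length : ℤ) (RAM.scan k (φ e) (x e, y e)) n π out R fl ∧
          ∀ v ∈ R, v ∈ f e) ?_ ?_ ⟨_, _, _, hπ, fun _ => id⟩).mono le_rfl ?_ ?_
      · rintro π ⟨out, R, fl, I, -⟩ hlt
        simp only [htest, Test.holds, Expr.eval] at hlt
        have := I.pos
        have := I.limit
        push_cast at *; omega
      · rintro n π ⟨out, R, fl, I, hR⟩
        refine ⟨?_, ?_⟩
        · simp only [htest, Test.holds, Expr.eval]
          have := I.pos
          have := I.limit
          push_cast at *; omega
        · obtain _ | ⟨v, R⟩ := R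
          · have := I.len; simp at this
          refine Run.of_wp ((wp_scanBody (k := k) (φ := φ e) hb (hX · e) (hY · e) hkt
            (fun σ v => hE σ e v) hσ ?_ ?_ ?_ ?_ ?_ I).mono ?_)
          · intro v hv
            have := hsm.2 v hv
            push_cast at this
            constructor <;> omega
          · have : (T.length : ℤ) ≤ K * B := by exact_mod_cast hTl
            have : (L.length : ℤ) ≤ K * B := by exact_mod_cast hlen
            have : (0 : ℤ) ≤ K' * B := by positivity
            omega
          · rw [List.length_append]
            have : ((f e).length : ℤ) ≤ K' * B := by exact_mod_cast hSl
            have : (L.length : ℤ) ≤ K * B := by exact_mod_cast hlen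
            have : (0 : ℤ) ≤ K * B := by positivity
            push_cast; omega
          · have : (0 : ℤ) ≤ K * B := by positivity
            have : (0 : ℤ) ≤ K' * B := by positivity
            omega
          · have := hS.2 v (hR v (by simp))
            have : (0 : ℤ) ≤ K * B := by positivity
            push_cast at *
            constructor <;> omega
          · rintro π' ⟨out', fl', I'⟩
            exact ⟨out', R, fl', I', fun w hw => hR w (by simp [hw])⟩
      · have : (f e).length * c₁ ≤ K' * B * c₁ := Nat.mul_le_mul_right _ hSl
        exact Nat.add_le_add_right this _
      · rintro π' ⟨out, R, fl, I, -⟩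
        have hR : R = [] := List.eq_nil_of_length_eq_zero I.len
        subst hR
        have := I.eq
        simp only [RAM.scan, List.append_nil] at this
        have hfin : Ok b σ (L ++ T) π' := by rw [← this]; exact I.ok
        exact hfin
  · have : ini.cost + test.cost + 5 = c₂ := rfl
    omega

end RAM

namespace RAM
open Supergrid
variable {D D' : (ℕ → ℤ) → Prop} {f g : (ℕ → ℤ) → List (ℤ × ℤ)}

/-- The list `f e` has linear size for all inputs in the domain `D`. -/
def LinSize (D : (ℕ → ℤ) → Prop) (f : (ℕ → ℤ) → List (ℤ × ℤ)) : Prop :=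
  ∃ K, ∀ e B, Adm e B → D e → Small (K * B) (f e)

theorem linMap_id : LinMap fun _ v => v :=
  fun r₁ r₂ => ⟨.reg r₁, .reg r₂, fun _ _ _ _ h₁ h₂ => ⟨h₁, h₂⟩⟩

theorem keepTest_true : KeepTest fun _ _ => true :=
  fun _ _ => ⟨.eq (.const 0) (.const 0), fun _ _ _ _ _ => by simp [Test.holds]⟩

theorem scan_map (φ : ℤ × ℤ → ℤ × ℤ) (c : ℤ × ℤ) (b : Bool) (p : List (ℤ × ℤ)) :
    scan (fun _ _ => true) φ c b p = p.map φ := by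
  induction p generalizing b with
  | nil => rfl
  | cons v p ih => simp [scan, ih]

theorem Comp.map {φ : (ℕ → ℤ) → ℤ × ℤ → ℤ × ℤ} (hf : Comp D f) (hφ : LinMap φ)
    (hs : ∀ K, ∃ K', ∀ e B v, Adm e B → |(φ e v).1| ≤ ((K * B : ℕ) : ℤ) →
      |(φ e v).2| ≤ ((K * B : ℕ) : ℤ) → |v.1| ≤ ((K' * B : ℕ) : ℤ) ∧ |v.2| ≤ ((K' * B : ℕ) : ℤ)) :
    Comp D fun e => (f e).map (φ e) := by
  refine (hf.scan keepTest_true hφ (lin_const 0) (lin_const 0) fun K => ?_).congr (fun _ => id)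
    fun e _ => (scan_map _ _ _ _).symm
  obtain ⟨K', hK'⟩ := hs K
  refine ⟨K + K', fun e B hB _ hsm => ?_⟩
  rw [scan_map] at hsm
  have h1 := hsm.1
  have e1 : (K + K') * B = K * B + K' * B := by ring
  rw [e1]
  rw [List.length_map] at h1
  refine ⟨by omega, fun v hv => ?_⟩
  have h2 := hsm.2 _ (List.mem_map_of_mem hv)
  have h3 := hK' e B v hB h2.1 h2.2
  push_cast at *
  have : (0 : ℤ) ≤ K * B := by positivity
  constructor <;> omega

theorem Comp.tr (hf : Comp D f) : Comp D fun e => tr (f e) :=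
  hf.map (φ := fun _ v => (v.2, v.1))
    (fun r₁ r₂ => ⟨.reg r₂, .reg r₁, fun _ _ _ _ h₁ h₂ => ⟨h₂, h₁⟩⟩)
    fun K => ⟨K, fun _ _ _ _ h₁ h₂ => ⟨h₂, h₁⟩⟩

theorem Comp.fx {w : (ℕ → ℤ) → ℤ} (hf : Comp D f) (hw : Lin w) : Comp D fun e => fx (w e) (f e) := by
  obtain ⟨⟨E, hE⟩, c, hc⟩ := hw
  refine hf.map (φ := fun e v => (w e + 1 - v.1, v.2))
    (fun r₁ r₂ => ⟨.sub (.add E (.const 1)) (.reg r₁), .reg r₂, fun σ e v h h₁ h₂ =>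
      ⟨by simp only [Expr.eval, hE σ e h, h₁], h₂⟩⟩)
    fun K => ⟨K + c + 1, fun e B v hB h₁ h₂ => ?_⟩
  have := hc e B hB
  have hB1 := hB.one_le
  have e1 : (K + c + 1) * B = K * B + c * B + B := by ring
  rw [e1]
  push_cast at *
  rw [abs_le] at *
  rw [abs_le]
  have : (0 : ℤ) ≤ K * B := by positivity
  have : (0 : ℤ) ≤ c * B := by positivity
  omega

theorem Comp.fy {w : (ℕ → ℤ) → ℤ} (hf : Comp D f) (hw : Lin w) : Comp D fun e => fy (w e) (f e) := by
  refine (hf.tr.fx hw).tr.congr (fun _ => id) fun e _ => ?_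
  simp [Supergrid.fy, Supergrid.tr, Supergrid.fx]

theorem Comp.sh {x y : (ℕ → ℤ) → ℤ} (hf : Comp D f) (hx : Lin x) (hy : Lin y) :
    Comp D fun e => sh (x e) (y e) (f e) := by
  refine ((((hf.fx hx).fx (((hx.add hx)))).fy hy).fy (hy.add hy)).congr (fun _ => id) fun e _ => ?_
  simp only [Supergrid.fy, Supergrid.fx, Supergrid.sh, List.map_map]
  congr 1; funext v; simp; constructor <;> ring

theorem scan_filter (c : ℤ × ℤ) (b : Bool) (p : List (ℤ × ℤ)) :
    scan (fun _ h => !h) (fun v => v) c b p = p.filter (· ≠ c) := by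
  induction p generalizing b with
  | nil => rfl
  | cons v p ih => by_cases h : v = c <;> simp [scan, ih, h]

theorem scan_dropWhile (c : ℤ × ℤ) (b : Bool) (p : List (ℤ × ℤ)) :
    scan (fun b _ => b) (fun v => v) c b p = if b then p else p.dropWhile (· ≠ c) := by
  induction p generalizing b with
  | nil => simp [scan]
  | cons v p ih => by_cases h : v = c <;> cases b <;> simp [scan, ih, h]

theorem scan_takeWhile (c : ℤ × ℤ) (b : Bool) (p : List (ℤ × ℤ)) :
    scan (fun b _ => !b) (fun v => v) c b p = if b then [] else p.takeWhile (· ≠ c) := by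
  induction p generalizing b with
  | nil => simp [scan]
  | cons v p ih => by_cases h : v = c <;> cases b <;> simp [scan, ih, h]

theorem keepTest_second : KeepTest fun _ h => !h :=
  fun _ r₂ => ⟨.eq (.reg r₂) (.const 0), fun σ x y _ h => by
    cases y <;> simp [Test.holds, Expr.eval, h]⟩

theorem keepTest_first : KeepTest fun b _ => b :=
  fun r₁ _ => ⟨.not (.eq (.reg r₁) (.const 0)), fun σ x y h _ => by
    cases x <;> simp [Test.holds, Expr.eval, h]⟩

theorem keepTest_not_first : KeepTest fun b _ => !b :=
  fun r₁ _ => ⟨.eq (.reg r₁) (.const 0), fun σ x y h _ => by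
    cases x <;> simp [Test.holds, Expr.eval, h]⟩

theorem LinSize.const (hs : LinSize D f) (g : (ℕ → ℤ) → List (ℤ × ℤ)) :
    ∀ K : ℕ, ∃ K', ∀ e B, Adm e B → D e → Small (K * B) (g e) → Small (K' * B) (f e) := by
  obtain ⟨K', h⟩ := hs
  exact fun _ => ⟨K', fun e B hB hD _ => h e B hB hD⟩

theorem Comp.filter {x y : (ℕ → ℤ) → ℤ} (hf : Comp D f) (hs : LinSize D f) (hx : Lin x)
    (hy : Lin y) : Comp D fun e => (f e).filter (· ≠ (x e, y e)) :=
  (hf.scan keepTest_second linMap_id hx hy (hs.const _)).congr (fun _ => id)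
    fun _ _ => (scan_filter _ _ _).symm

theorem Comp.dropWhile {x y : (ℕ → ℤ) → ℤ} (hf : Comp D f) (hs : LinSize D f) (hx : Lin x)
    (hy : Lin y) : Comp D fun e => (f e).dropWhile (· ≠ (x e, y e)) :=
  (hf.scan keepTest_first linMap_id hx hy (hs.const _)).congr (fun _ => id)
    fun _ _ => (scan_dropWhile _ false _).symm

theorem Comp.takeWhile {x y : (ℕ → ℤ) → ℤ} (hf : Comp D f) (hs : LinSize D f) (hx : Lin x)
    (hy : Lin y) : Comp D fun e => (f e).takeWhile (· ≠ (x e, y e)) :=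
  (hf.scan keepTest_not_first linMap_id hx hy (hs.const _)).congr (fun _ => id)
    fun _ _ => (scan_takeWhile _ false _).symm

/-! ### Reversal -/

/-- The body of the loop that reverses a list by exchanging its outermost cells. -/
def swapBody (b : ℕ) : Prog :=
  .seq (.assign (b + 3) (.load (.reg (b + 1))))
    (.seq (.assign (b + 4) (.load (.sub (.const (-1)) (.reg (b + 1)))))
    (.seq (.store (.reg (b + 1)) (.load (.reg (b + 2))))
    (.seq (.store (.sub (.const (-1)) (.reg (b + 1))) (.load (.sub (.const (-1)) (.reg (b + 2)))))
    (.seq (.store (.reg (b + 2)) (.reg (b + 3)))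
    (.seq (.store (.sub (.const (-1)) (.reg (b + 2))) (.reg (b + 4)))
    (.seq (.assign (b + 1) (.add (.reg (b + 1)) (.const 1)))
      (.assign (b + 2) (.sub (.reg (b + 2)) (.const 1)))))))))

/-- The invariant of the reversal loop: the inner part `M` is still to be reversed. -/
structure SwapInv (b : ℕ) (σ : State) (L T : List (ℤ × ℤ)) (n : ℕ) (τ : State)
    (A M Z : List (ℤ × ℤ)) : Prop where
  len : M.length / 2 = n
  eq : A ++ (M.reverse ++ Z) = T
  ok : Ok b σ (L ++ (A ++ (M ++ Z))) τ
  left : τ.reg (b + 1) = L.length + A.length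
  right : τ.reg (b + 2) = L.length + A.length + M.length - 1

theorem exists_ends {M : List (ℤ × ℤ)} (h : 2 ≤ M.length) : ∃ u M' v, M = u :: (M' ++ [v]) := by
  obtain _ | ⟨u, M⟩ := M
  · simp at h
  rcases List.eq_nil_or_concat M with rfl | ⟨M', v, rfl⟩
  · simp at h
  · exact ⟨u, M', v, by simp⟩

theorem wp_swapBody {b : ℕ} (hb : 9 ≤ b) {W : ℤ} {σ : State} {L T : List (ℤ × ℤ)}
    (hT : ∀ v ∈ T, |v.1| ≤ W ∧ |v.2| ≤ W) (hLT : L.length + T.length + 1 ≤ W)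
    {n : ℕ} {τ : State} {A M Z : List (ℤ × ℤ)} (H : SwapInv b σ L T (n + 1) τ A M Z) :
    wp W (swapBody b) τ fun ρ => ∃ A' M' Z', SwapInv b σ L T n ρ A' M' Z' := by
  have hlen := H.len
  obtain ⟨u, M, v, rfl⟩ := exists_ends (M := M) (by omega)
  have hl := H.left
  have hr := H.right
  have hok := H.ok
  have harr := hok.arr
  have heq := H.eq
  have hTl : T.length = A.length + M.length + 2 + Z.length := by
    rw [← heq]; simp; omega
  have hu : u ∈ T := by rw [← heq]; simp
  have hv : v ∈ T := by rw [← heq]; simp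
  simp only [List.length_cons, List.length_append, List.length_nil] at hlen hr
  simp only [List.cons_append, List.append_assoc, List.nil_append] at harr
  rw [arr_append, arr_append] at harr
  obtain ⟨a1, a2, a3⟩ := harr
  simp only [Arr, arr_append, zero_add] at a1 a2 a3
  obtain ⟨a3, a4, a5, a6, a7, a8⟩ := a3
  set i := τ.reg (b + 1)
  set j := τ.reg (b + 2)
  push_cast at hr
  have hij : i + 1 + M.length = j := by omega
  rw [← hl] at a3 a4 a5 a6 a7 a8
  rw [hij] at a6 a7 a8
  have hLT' : (L.length : ℤ) + (A.length + M.length + 2 + Z.length) + 1 ≤ W := by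
    rw [hTl] at hLT; push_cast at hLT; exact hLT
  have q1 : (0 : ℤ) ≤ i := by omega
  have q2 : i < j := by omega
  have q3 : j + 2 ≤ W := by omega
  simp only [swapBody, wp, Expr.eval, Function.update_self, Function.update_apply,
    Nat.add_left_cancel_iff]
  simp only [show (1 : ℕ) ≠ 3 by omega, show (1 : ℕ) ≠ 4 by omega, show (2 : ℕ) ≠ 3 by omega,
    show (2 : ℕ) ≠ 4 by omega, show (2 : ℕ) ≠ 1 by omega, show (3 : ℕ) ≠ 4 by omega, if_false,
    show τ.reg (b + 1) = i from rfl, show τ.reg (b + 2) = j from rfl,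
    show ¬ -1 - j = i by omega, a3, a4, a6, a7]
  have b1 : |i| ≤ W := by rw [abs_of_nonneg] <;> omega
  have b2 : |-1 - i| ≤ W := by rw [abs_of_nonpos] <;> omega
  have b3 : |j| ≤ W := by rw [abs_of_nonneg] <;> omega
  have b4 : |-1 - j| ≤ W := by rw [abs_of_nonpos] <;> omega
  refine ⟨(hT u hu).1, (hT u hu).2, b1, (hT v hv).1, b2, (hT v hv).2, b3, (hT u hu).1, b4,
    (hT u hu).2, by rw [abs_of_nonneg] <;> omega, by rw [abs_of_nonneg] <;> omega,
    A ++ [v], M, u :: Z, ⟨by omega, by rw [← heq]; simp, ⟨?_, ?_, ?_, hok.out⟩, ?_, ?_⟩⟩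
  · simp only [Function.update_apply, show (8 : ℕ) ≠ b + 1 by omega, show (8 : ℕ) ≠ b + 2 by omega,
      show (8 : ℕ) ≠ b + 3 by omega, show (8 : ℕ) ≠ b + 4 by omega, if_false, hok.sp]
    simp
  · obtain ⟨m, hm⟩ : ∃ m, m = Function.update (Function.update (Function.update
      (Function.update τ.mem i v.1) (-1 - i) v.2) j u.1) (-1 - j) u.2 := ⟨_, rfl⟩
    have m1 : m i = v.1 := by
      simp only [hm, Function.update_apply, show ¬ i = -1 - j by omega, show ¬ i = j by omega,
        show ¬ i = -1 - i by omega, if_false, if_true]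
    have m2 : m (-1 - i) = v.2 := by
      simp only [hm, Function.update_apply, show ¬ -1 - i = -1 - j by omega,
        show ¬ -1 - i = j by omega, if_false, if_true]
    have m3 : m j = u.1 := by
      simp only [hm, Function.update_apply, show ¬ j = -1 - j by omega, if_false, if_true]
    have m4 : m (-1 - j) = u.2 := by
      simp only [hm, Function.update_self]
    have m5 : ∀ z, 0 ≤ z → z ≠ i → z ≠ j → m z = τ.mem z ∧ m (-1 - z) = τ.mem (-1 - z) := by
      intro z h0 h1 h2
      simp only [hm, Function.update_apply, h1, h2, show ¬ z = -1 - j by omega,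
        show ¬ z = -1 - i by omega, show ¬ -1 - z = -1 - j by omega, show ¬ -1 - z = j by omega,
        show ¬ -1 - z = -1 - i by omega, show ¬ -1 - z = i by omega, if_false, and_self]
    rw [← hm]
    simp only [List.append_assoc, List.cons_append, List.nil_append]
    rw [arr_append, arr_append]
    simp only [Arr, arr_append, zero_add]
    rw [← hl, hij]
    exact ⟨a1.congr fun z _ _ => m5 z (by omega) (by omega) (by omega),
      a2.congr fun z _ _ => m5 z (by omega) (by omega) (by omega), m1, m2,
      a5.congr fun z _ _ => m5 z (by omega) (by omega) (by omega), m3, m4,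
      a8.congr fun z _ _ => m5 z (by omega) (by omega) (by omega)⟩
  · intro k hk h8
    simp only [Function.update_apply, show ¬ k = b + 1 by omega, show ¬ k = b + 2 by omega,
      show ¬ k = b + 3 by omega, show ¬ k = b + 4 by omega, if_false]
    exact hok.frame k hk h8
  · simp only [Function.update_apply, show ¬ b + 1 = b + 2 by omega, if_true, if_false]
    rw [List.length_append, List.length_singleton]; push_cast; omega
  · simp only [Function.update_apply, if_true]
    rw [List.length_append, List.length_singleton]; push_cast; omega

theorem Comp.reverse (hf : Comp D f) : Comp D fun e => (f e).reverse := by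
  refine ⟨fun b hb => ?_⟩
  obtain ⟨P, hP⟩ := hf.prog (b + 1) (by omega)
  set ini : Prog := .seq (.assign (b + 1) (.reg b))
    (.assign (b + 2) (.sub (.reg 8) (.const 1))) with hini
  set test : Test := .lt (.reg (b + 1)) (.reg (b + 2)) with htest
  refine ⟨.seq (.assign b (.reg 8)) (.seq P (.seq ini (.loop test (swapBody b)))), fun K => ?_⟩
  obtain ⟨C, hC⟩ := hP K
  set c₁ := (swapBody b).cost + test.cost + 1 with hc₁
  set c₂ := ini.cost + test.cost + 5 with hc₂
  refine ⟨C + 2 * K + K * c₁ + c₂, fun e B hB hDe hsm σ L hσ hL hlen => ?_⟩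
  have h1 := hB.one_le
  have hS : Small (K * B) (f e) := ⟨by simpa using hsm.1, fun v hv => hsm.2 v (by simpa using hv)⟩
  have eC : (C + 2 * K + K * c₁ + c₂) * B = C * B + 2 * (K * B) + (K * B) * c₁ + c₂ * B := by ring
  have h4 : c₂ ≤ c₂ * B := Nat.le_mul_of_pos_right _ h1
  rw [eC]
  set W : ℤ := ((C * B + 2 * (K * B) + (K * B) * c₁ + c₂ * B : ℕ) : ℤ) with hW
  have hCW : ((C * B : ℕ) : ℤ) ≤ W := by rw [hW]; exact Int.ofNat_le.2 (by omega)
  have hKW : ((2 * (K * B) + 5 : ℕ) : ℤ) ≤ W := by rw [hW]; exact Int.ofNat_le.2 (by omega)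
  have hSl := hS.1
  have hb8 : (8 : ℕ) ≠ b := by omega
  refine Run.mono (t := 2 + (C * B + (ini.cost + (K * B * c₁ + (test.cost + 1))))) (Run.seq
    (Q := fun τ => Ok (b + 1) τ L τ ∧ Ok b σ L τ ∧ τ.reg b = L.length)
    (Run.of_wp (p := .assign b (.reg 8)) ?_) fun τ hτ => ?_) le_rfl (by omega) fun _ => id
  · simp only [wp, Expr.eval]
    rw [hL.sp]
    refine ⟨by rw [abs_of_nonneg] <;> omega, ⟨?_, hL.arr, fun _ _ _ => rfl, rfl⟩,
      ⟨?_, hL.arr, fun i hi h8 => ?_, rfl⟩, by simp⟩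
    · simp [Function.update_of_ne hb8, hL.sp]
    · simp [Function.update_of_ne hb8, hL.sp]
    · simp [Function.update_of_ne (show i ≠ b by omega)]
  · obtain ⟨t1, t2, t3⟩ := hτ
    refine ((hC e B hB hDe hS τ L (t2.agree hb hσ) t1 (by omega)).mono hCW le_rfl
      fun _ => id).seq fun ρ hρ => ?_
    have hρb : ρ.reg b = L.length := (hρ.frame b (by omega) (by omega)).trans t3
    have hρo : Ok b σ (L ++ f e) ρ := t2.trans (by omega) hρ
    refine Run.seq (Q := fun π => SwapInv b σ L (f e).reverse ((f e).length / 2) π [] (f e) [])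
      (Run.of_wp ?_) fun π hπ => ?_
    · simp only [hini, wp, Expr.eval, hρb, hρ.sp, Function.update_of_ne (show (8 : ℕ) ≠ b + 1 by omega)]
      have hl : (L ++ f e).length = L.length + (f e).length := List.length_append
      rw [hl]
      refine ⟨by rw [abs_of_nonneg] <;> omega, by rw [abs_le]; push_cast at *; constructor <;> omega,
        rfl, by simp, ⟨?_, ?_, ?_, hρo.out⟩, ?_, ?_⟩
      · simp [show (8 : ℕ) ≠ b + 1 by omega, show (8 : ℕ) ≠ b + 2 by omega, hρ.sp]
      · simpa using hρ.arr
      · intro i hi h8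
        simp only [Function.update_apply, show i ≠ b + 1 by omega, show i ≠ b + 2 by omega, if_false]
        exact hρo.frame i hi h8
      · simp
      · simp
    · refine (Run.loop (t := (swapBody b).cost) (fun n π => ∃ A M Z,
        SwapInv b σ L (f e).reverse n π A M Z) ?_ ?_ ⟨_, _, _, hπ⟩).mono le_rfl ?_ ?_
      · rintro π ⟨A, M, Z, I⟩ hlt
        simp only [htest, Test.holds, Expr.eval, I.left, I.right] at hlt
        have := I.len
        omega
      · rintro n π ⟨A, M, Z, I⟩
        refine ⟨?_, Run.of_wp (wp_swapBody hb (fun v hv => ?_) ?_ I)⟩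
        · simp only [htest, Test.holds, Expr.eval, I.left, I.right]
          have := I.len
          omega
        · have := hsm.2 v hv
          push_cast at *
          constructor <;> omega
        · rw [List.length_reverse]; omega
      · have : (f e).length / 2 * c₁ ≤ K * B * c₁ := Nat.mul_le_mul_right _ (by omega)
        exact Nat.add_le_add_right this _
      · rintro π' ⟨A, M, Z, I⟩
        have hM : M.reverse = M := by
          have := I.len
          obtain _ | ⟨x, _ | ⟨y, M⟩⟩ := M
          · rfl
          · rfl
          · simp only [List.length_cons] at this; omega
        have h1 := I.eq
        have h2 := I.ok
        rw [hM] at h1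
        rwa [h1] at h2

end RAM

namespace RAM
open Supergrid
variable {D D' : (ℕ → ℤ) → Prop} {f g : (ℕ → ℤ) → List (ℤ × ℤ)}

/-! ### Rows of a rectangle -/

theorem length_rows (w : ℤ) (alt : Bool) (n : ℕ) : (rows w alt n).length = n * w.toNat := by
  induction n with
  | zero => simp [rows]
  | succ n ih => simp [rows, row, ih]; ring

/-- The invariant of the loop that writes the `n + 1`st row: `i` cells have been written. -/
structure RowInv (b : ℕ) (σ : State) (L : List (ℤ × ℤ)) (w : ℤ) (rev : Bool) (n i : ℕ)
    (τ : State) : Prop where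
  ok : Ok b σ (L ++ (List.range i).map fun j : ℕ =>
    ((if rev then w - (j : ℤ) else (j : ℤ) + 1 : ℤ), (n : ℤ) + 1)) τ
  row : τ.reg b = n
  parity : τ.reg (b + 1) = (n % 2 : ℕ)
  col : τ.reg (b + 2) = i

/-- The body of the loop that writes a row. -/
def rowBody (b : ℕ) (E : Expr) (alt : Bool) : Prog :=
  .seq (.cond (.and (.eq (.const alt.toNat) (.const 1)) (.eq (.reg (b + 1)) (.const 1)))
    (push (.sub E (.reg (b + 2))) (.add (.reg b) (.const 1)))
    (push (.add (.reg (b + 2)) (.const 1)) (.add (.reg b) (.const 1))))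
    (.assign (b + 2) (.add (.reg (b + 2)) (.const 1)))

theorem wp_rowBody {b : ℕ} (hb : 9 ≤ b) {E : Expr} {e : ℕ → ℤ} {w : ℤ}
    (hE : ∀ σ, Agree σ e → E.eval σ = w) {W : ℤ} {σ : State} (hσ : Agree σ e)
    {L : List (ℤ × ℤ)} {alt : Bool} {n i : ℕ} {τ : State}
    (hW : L.length + i + 1 ≤ W) (hn : n + 1 ≤ W) (hi : i < w) (hw : w ≤ W)
    (H : RowInv b σ L w (alt && decide (n % 2 = 1)) n i τ) :
    wp W (rowBody b E alt) τ (RowInv b σ L w (alt && decide (n % 2 = 1)) n (i + 1)) := by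
  obtain ⟨hok, hr, hp, hc⟩ := H
  have hlen : (L ++ (List.range i).map fun j : ℕ => ((if (alt && decide (n % 2 = 1)) then w - (j : ℤ)
      else (j : ℤ) + 1 : ℤ), (n : ℤ) + 1)).length = L.length + i := by simp
  have fin : ∀ ρ : State, Ok b σ ((L ++ (List.range i).map fun j : ℕ =>
      ((if (alt && decide (n % 2 = 1)) then w - (j : ℤ) else (j : ℤ) + 1 : ℤ), (n : ℤ) + 1)) ++
      [((if (alt && decide (n % 2 = 1)) then w - (i : ℤ) else (i : ℤ) + 1 : ℤ), (n : ℤ) + 1)]) ρ →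
      (∀ j, j ≠ 8 → ρ.reg j = τ.reg j) →
      wp W (.assign (b + 2) (.add (.reg (b + 2)) (.const 1))) ρ
        (RowInv b σ L w (alt && decide (n % 2 = 1)) n (i + 1)) := by
    intro ρ ho hρ
    simp only [wp, Expr.eval, hρ (b + 2) (by omega), hc]
    refine ⟨by rw [abs_of_nonneg] <;> omega, ⟨?_, ?_, ?_, ho.out⟩, ?_, ?_, ?_⟩
    · dsimp only
      rw [Function.update_of_ne (show (8 : ℕ) ≠ b + 2 by omega), ho.sp]; simp
    · have := ho.arr
      rw [List.append_assoc] at this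
      rw [List.range_succ, List.map_append]
      exact this
    · intro j hj h8
      dsimp only
      rw [Function.update_of_ne (show j ≠ b + 2 by omega)]
      exact ho.frame j hj h8
    · dsimp only
      rw [Function.update_of_ne (show b ≠ b + 2 by omega), hρ b (by omega), hr]
    · dsimp only
      rw [Function.update_of_ne (show b + 1 ≠ b + 2 by omega), hρ (b + 1) (by omega), hp]
    · simp
  have hagr : ∀ ρ : State, ρ.reg = τ.reg → Agree ρ e := fun ρ hρ j hj => by
    rw [hρ]; exact hok.agree hb hσ j hj
  refine ⟨fun h => ?_, fun h => ?_⟩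
  · have hrev : (alt && decide (n % 2 = 1)) = true := by
      simp only [Test.holds, Expr.eval, hp] at h
      have h1 : alt = true := by cases alt <;> simp at h ⊢
      have h2 : n % 2 = 1 := by omega
      simp [h1, h2]
    simp only [hrev, if_true] at *
    refine (wp_push hok (v := (w - i, (n : ℤ) + 1)) (by rw [hlen]; push_cast; omega) ?_ ?_
      fun ρ hρ => ?_).mono fun ρ h => fin ρ h.1 h.2.1
    · rw [abs_of_nonneg] <;> omega
    · rw [abs_of_nonneg] <;> omega
    · simp only [Expr.eval, hE ρ (hagr ρ hρ), hρ, hc, hr, and_self]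
  · have hrev : (alt && decide (n % 2 = 1)) = false := by
      simp only [Test.holds, Expr.eval, hp] at h
      cases alt
      · rfl
      · have h2 : ¬ n % 2 = 1 := fun h2 => h (by simp [h2])
        simp [h2]
    simp only [hrev, Bool.false_eq_true, if_false] at *
    refine (wp_push hok (v := ((i : ℤ) + 1, (n : ℤ) + 1)) (by rw [hlen]; push_cast; omega) ?_ ?_
      fun ρ hρ => ?_).mono fun ρ h => fin ρ h.1 h.2.1
    · rw [abs_of_nonneg] <;> omega
    · rw [abs_of_nonneg] <;> omega
    · simp only [Expr.eval, hρ, hc, hr, and_self]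

theorem comp_rows {w h : (ℕ → ℤ) → ℤ} (hw : Lin w) (hh : Lin h) (alt : Bool) :
    Comp D fun e => rows (w e) alt (h e).toNat := by
  obtain ⟨⟨E, hE⟩, cw, hcw⟩ := hw
  obtain ⟨⟨F, hF⟩, ch, hch⟩ := hh
  refine ⟨fun b hb => ?_⟩
  set body := rowBody b E alt with hbody
  set t₁ : Test := .lt (.reg (b + 2)) E with ht₁
  set t₂ : Test := .lt (.reg b) F with ht₂
  set pre : Prog := .assign (b + 2) (.const 0) with hpre
  set post : Prog := .seq (.assign b (.add (.reg b) (.const 1)))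
    (.assign (b + 1) (.sub (.const 1) (.reg (b + 1)))) with hpost
  set ini : Prog := .seq (.assign b (.const 0)) (.assign (b + 1) (.const 0)) with hini
  refine ⟨.seq ini (.loop t₂ (.seq pre (.seq (.loop t₁ body) post))), fun K => ?_⟩
  set c₁ := body.cost + t₁.cost + 1 with hc₁
  set c₂ := pre.cost + ((t₁.cost + 1) + post.cost) + t₂.cost + 1 with hc₂
  set c₃ := ini.cost + t₂.cost + 5 with hc₃
  refine ⟨K * c₁ + ch * c₂ + c₃ + cw + ch + 2 * K, fun e B hB hDe hsm σ L hσ hL hlen => ?_⟩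
  have h1 := hB.one_le
  have bw := hcw e B hB
  have bh := hch e B hB
  have hS := hsm.1
  rw [length_rows] at hS
  have hEe := fun σ => hE σ e
  have hFe := fun σ => hF σ e
  generalize hwe : w e = we at *
  generalize hhe : h e = he at *
  have eC : (K * c₁ + ch * c₂ + c₃ + cw + ch + 2 * K) * B = (K * B) * c₁ + (ch * B) * c₂ + c₃ * B +
      cw * B + ch * B + 2 * (K * B) := by ring
  have h4 : c₃ ≤ c₃ * B := Nat.le_mul_of_pos_right _ h1
  rw [eC]
  set W : ℤ := (((K * B) * c₁ + (ch * B) * c₂ + c₃ * B + cw * B + ch * B + 2 * (K * B) : ℕ) : ℤ)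
    with hW
  have hc5 : 5 ≤ c₃ := Nat.le_add_left _ _
  have hKW : ((cw * B + ch * B + 2 * (K * B) + 5 : ℕ) : ℤ) ≤ W := by
    rw [hW]; exact Int.ofNat_le.2 (by omega)
  rw [abs_le] at bw bh
  push_cast at hKW bw bh
  have hTB : he.toNat ≤ ch * B := by
    have : ((ch * B : ℕ) : ℤ) = ch * B := by push_cast; ring
    omega
  have hT2 : he.toNat * (we.toNat * c₁ + c₂) ≤ K * B * c₁ + ch * B * c₂ := by
    calc he.toNat * (we.toNat * c₁ + c₂) = (he.toNat * we.toNat) * c₁ + he.toNat * c₂ := by ring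
      _ ≤ _ := Nat.add_le_add (Nat.mul_le_mul_right _ hS) (Nat.mul_le_mul_right _ hTB)
  have hK0 : (0 : ℤ) ≤ K * B := by positivity
  have hw0 : (0 : ℤ) ≤ cw * B := by positivity
  have hh0 : (0 : ℤ) ≤ ch * B := by positivity
  have hlen' : (L.length : ℤ) ≤ K * B := by exact_mod_cast hlen
  refine Run.mono (t := ini.cost + (he.toNat * (we.toNat * c₁ + c₂) + (t₂.cost + 1)))
    (Run.seq (Q := fun τ => Ok b σ L τ ∧ τ.reg b = 0 ∧ τ.reg (b + 1) = 0) (Run.of_wp ?_)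
      fun τ hτ => ?_) le_rfl ?_ fun _ => id
  · simp only [hini, wp, Expr.eval]
    refine ⟨by simp; omega, by simp; omega, ⟨?_, hL.arr, fun i hi h8 => ?_, rfl⟩, ?_, ?_⟩
    · simp [show (8 : ℕ) ≠ b by omega, show (8 : ℕ) ≠ b + 1 by omega, hL.sp]
    · simp [show i ≠ b by omega, show i ≠ b + 1 by omega]
    · simp
    · simp
  · refine (Run.loop (fun m τ => ∃ n : ℕ, n + m = he.toNat ∧ Ok b σ (L ++ rows we alt n) τ ∧
      τ.reg b = n ∧ τ.reg (b + 1) = (n % 2 : ℕ))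
      (t := we.toNat * c₁ + (pre.cost + ((t₁.cost + 1) + post.cost))) ?_ ?_
      (n := he.toNat) ⟨0, by omega, by simpa [rows] using hτ.1, by simpa using hτ.2.1,
        by simpa using hτ.2.2⟩).mono le_rfl ?_ ?_
    · rintro π ⟨n, hn, ho, hr, -⟩ hlt
      simp only [ht₂, Test.holds, Expr.eval, hFe π (ho.agree hb hσ), hr] at hlt
      omega
    · rintro m π ⟨n, hn, ho, hr, hp⟩
      have hnw : (rows we alt n).length + we.toNat ≤ K * B := by
        rw [length_rows]
        calc n * we.toNat + we.toNat = (n + 1) * we.toNat := by ring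
          _ ≤ he.toNat * we.toNat := Nat.mul_le_mul_right _ (by omega)
          _ ≤ _ := hS
      have hnw' : ((rows we alt n).length : ℤ) + we.toNat ≤ K * B := by exact_mod_cast hnw
      refine ⟨?_, ?_⟩
      · simp only [ht₂, Test.holds, Expr.eval, hFe π (ho.agree hb hσ), hr]
        omega
      · refine Run.mono (t := pre.cost + ((we.toNat * c₁ + (t₁.cost + 1)) + post.cost))
          (Run.seq (Q := RowInv b σ (L ++ rows we alt n) we (alt && decide (n % 2 = 1)) n 0)
          (Run.of_wp ?_) fun ρ hρ => Run.seq
          (Q := RowInv b σ (L ++ rows we alt n) we (alt && decide (n % 2 = 1)) n we.toNat)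
          ((Run.loop (fun m τ => ∃ i : ℕ, i + m = we.toNat ∧
            RowInv b σ (L ++ rows we alt n) we (alt && decide (n % 2 = 1)) n i τ)
            (t := body.cost) ?_ ?_ (n := we.toNat) ⟨0, by omega, hρ⟩).mono le_rfl ?_ ?_)
            fun ρ hρ => Run.of_wp ?_) le_rfl (by omega) fun _ => id
        · simp only [hpre, wp, Expr.eval]
          refine ⟨by simp; omega, ⟨?_, by simpa using ho.arr, fun i hi h8 => ?_, ho.out⟩, ?_, ?_, ?_⟩
          · simp [show (8 : ℕ) ≠ b + 2 by omega, ho.sp]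
          · simp only [Function.update_of_ne (show i ≠ b + 2 by omega)]
            exact ho.frame i hi h8
          · simp [hr]
          · simp [hp]
          · simp
        · rintro π ⟨i, hi, I⟩ hlt
          simp only [ht₁, Test.holds, Expr.eval, hEe π (I.ok.agree hb hσ), I.col] at hlt
          omega
        · rintro k π ⟨i, hi, I⟩
          refine ⟨?_, Run.of_wp ((wp_rowBody hb hEe hσ ?_ ?_ ?_ ?_ I).mono
            fun ρ hρ => ⟨i + 1, by omega, hρ⟩)⟩
          · simp only [ht₁, Test.holds, Expr.eval, hEe π (I.ok.agree hb hσ), I.col]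
            omega
          · rw [List.length_append]; push_cast; omega
          · omega
          · omega
          · omega
        · exact le_rfl
        · rintro ρ ⟨i, hi, I⟩
          obtain rfl : i = we.toNat := by omega
          exact I
        · obtain ⟨ho, hr, hp, -⟩ := hρ
          simp only [hpost, wp, Expr.eval, hr, hp, Function.update_of_ne (show b + 1 ≠ b by omega)]
          refine ⟨by rw [abs_of_nonneg] <;> omega, by rw [abs_of_nonneg] <;> omega,
            n + 1, by omega, ⟨?_, ?_, fun i hi h8 => ?_, ho.out⟩, ?_, ?_⟩
          · simp only [Function.update_of_ne (show (8 : ℕ) ≠ b by omega),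
              Function.update_of_ne (show (8 : ℕ) ≠ b + 1 by omega), ho.sp, rows, row]
            simp
          · have := ho.arr
            rw [List.append_assoc] at this
            exact this
          · simp only [Function.update_of_ne (show i ≠ b by omega),
              Function.update_of_ne (show i ≠ b + 1 by omega)]
            exact ho.frame i hi h8
          · simp
          · simp only [Function.update_self]; omega
    · refine Nat.add_le_add_right (Nat.mul_le_mul_left _ ?_) _
      omega
    · rintro π ⟨n, hn, ho, -⟩
      obtain rfl : n = he.toNat := by omega
      exact ho
  · have : c₃ = ini.cost + t₂.cost + 5 := rfl
    omega

/-! ### Case distinctions -/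

theorem Comp.ite_odd {h : (ℕ → ℤ) → ℤ} (hh : Lin h) (hf : Comp D f) (hg : Comp D g) :
    Comp D fun e => if h e % 2 = 1 then f e else g e := by
  obtain ⟨⟨F, hF⟩, ch, hch⟩ := hh
  refine ⟨fun b hb => ?_⟩
  obtain ⟨P, hP⟩ := hf.prog (b + 1) (by omega)
  obtain ⟨Q, hQ⟩ := hg.prog (b + 1) (by omega)
  set ini : Prog := .seq (.assign b F) (.cond (.lt (.reg b) (.const 0))
    (.assign b (.sub (.const 0) (.reg b))) .skip) with hini
  set body : Prog := .assign b (.sub (.reg b) (.const 2)) with hbody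
  set t₁ : Test := .lt (.const 1) (.reg b) with ht₁
  set t₂ : Test := .eq (.reg b) (.const 1) with ht₂
  refine ⟨.seq ini (.seq (.loop t₁ body) (.cond t₂ P Q)), fun K => ?_⟩
  obtain ⟨C₁, hC₁⟩ := hP K
  obtain ⟨C₂, hC₂⟩ := hQ K
  set c₁ := body.cost + t₁.cost + 1 with hc₁
  set c₂ := ini.cost + (t₁.cost + 1) + (t₂.cost + 1) with hc₂
  refine ⟨C₁ + C₂ + ch * c₁ + c₂ + ch, fun e B hB hDe hsm σ L hσ hL hlen => ?_⟩
  have h1 := hB.one_le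
  have bh := hch e B hB
  have hFe := hF σ e hσ
  generalize hhe : h e = he at *
  have eC : (C₁ + C₂ + ch * c₁ + c₂ + ch) * B = C₁ * B + C₂ * B + (ch * B) * c₁ + c₂ * B +
      ch * B := by ring
  have h4 : c₂ ≤ c₂ * B := Nat.le_mul_of_pos_right _ h1
  rw [eC]
  set W : ℤ := ((C₁ * B + C₂ * B + (ch * B) * c₁ + c₂ * B + ch * B : ℕ) : ℤ) with hW
  have hW1 : ((ch * B : ℕ) : ℤ) ≤ W := by rw [hW]; exact Int.ofNat_le.2 (by omega)
  have hW2 : ((C₁ * B : ℕ) : ℤ) ≤ W := by rw [hW]; exact Int.ofNat_le.2 (by omega)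
  have hW3 : ((C₂ * B : ℕ) : ℤ) ≤ W := by rw [hW]; exact Int.ofNat_le.2 (by omega)
  have habs : |he| = (he.natAbs : ℤ) := Int.abs_eq_natAbs he
  have hnat : he.natAbs ≤ ch * B := by omega
  have hb8 : (8 : ℕ) ≠ b := by omega
  refine Run.mono (t := ini.cost + ((he.natAbs * c₁ + (t₁.cost + 1)) +
    (t₂.cost + (C₁ * B + C₂ * B) + 1)))
    (Run.seq (Q := fun τ => Ok b σ L τ ∧ τ.reg b = he.natAbs) (Run.of_wp ?_)
      fun τ hτ => Run.seq (Q := fun τ => Ok b σ L τ ∧ τ.reg b = (he.natAbs % 2 : ℕ)) ?_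
        fun ρ hρ => ?_) le_rfl ?_ fun _ => id
  · simp only [hini, wp, Expr.eval, Test.holds, hFe, Function.update_self]
    have ok : ∀ x, Ok b σ L { σ with reg := Function.update σ.reg b x } := fun x =>
      ⟨by simp [hb8, hL.sp], hL.arr, fun i hi _ => by simp [show i ≠ b by omega], rfl⟩
    refine ⟨by omega, fun h => ⟨by rw [zero_sub, abs_neg]; omega, ?_, by omega⟩,
      fun h => ⟨ok _, by omega⟩⟩
    rw [Function.update_idem]
    exact ok _
  · refine (Run.loop (fun n τ => Ok b σ L τ ∧ ∃ r : ℕ, τ.reg b = r ∧ r / 2 = n ∧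
      r % 2 = he.natAbs % 2 ∧ r ≤ he.natAbs) (t := body.cost) ?_ ?_
      ⟨hτ.1, _, hτ.2, rfl, rfl, le_rfl⟩).mono le_rfl ?_ ?_
    · rintro τ ⟨-, r, h1, h2, -⟩ hlt
      simp only [ht₁, Test.holds, Expr.eval, h1] at hlt
      omega
    · rintro n τ ⟨ho, r, h1, h2, h3, h4⟩
      refine ⟨?_, Run.of_wp ⟨?_, ⟨?_, ho.arr, fun i hi h8 => ?_, ho.out⟩, r - 2, ?_, ?_, ?_, ?_⟩⟩
      · simp only [ht₁, Test.holds, Expr.eval, h1]; omega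
      · simp only [Expr.eval, h1]
        rw [abs_of_nonneg] <;> omega
      · simp [hb8, ho.sp]
      · simp only [Function.update_of_ne (show i ≠ b by omega)]
        exact ho.frame i hi h8
      · simp only [Function.update_self, Expr.eval, h1]; omega
      · omega
      · omega
      · omega
    · exact Nat.add_le_add_right (Nat.mul_le_mul_right _ (by omega)) _
    · rintro τ ⟨ho, r, h1, h2, h3, -⟩
      exact ⟨ho, by omega⟩
  · obtain ⟨ho, hr⟩ := hρ
    refine Run.cond (fun h => ?_) fun h => ?_
    · simp only [ht₂, Test.holds, Expr.eval, hr] at h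
      have hodd : he % 2 = 1 := by omega
      simp only [if_pos hodd] at hsm ⊢
      exact (hC₁ e B hB hDe hsm ρ L (ho.agree hb hσ) ho.self hlen).mono hW2 (by omega)
        fun π hπ => ho.trans (by omega) hπ
    · simp only [ht₂, Test.holds, Expr.eval, hr] at h
      have hodd : ¬ he % 2 = 1 := by omega
      simp only [if_neg hodd] at hsm ⊢
      exact (hC₂ e B hB hDe hsm ρ L (ho.agree hb hσ) ho.self hlen).mono hW3 (by omega)
        fun π hπ => ho.trans (by omega) hπ
  · have : he.natAbs * c₁ ≤ ch * B * c₁ := Nat.mul_le_mul_right _ hnat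
    omega

/-- A case distinction according to a test on a computable list `q e`: when the test is evaluated,
this list lies on the stack, and register `b` contains the position of its first cell. -/
theorem Comp.ite_list {p : (ℕ → ℤ) → Prop} [∀ e, Decidable (p e)]
    {q : (ℕ → ℤ) → List (ℤ × ℤ)} (hq : Comp D q) (hs : LinSize D q)
    (hp : ∀ b : ℕ, ∃ t : Test, ∀ e, D e → ∀ (ρ : State) (n : ℕ), Agree ρ e → ρ.reg b = n →
      ρ.reg 8 = n + (q e).length → Arr ρ.mem n (q e) → (t.holds ρ ↔ p e))
    (hf : Comp (fun e => D e ∧ p e) f) (hg : Comp (fun e => D e ∧ ¬ p e) g) :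
    Comp D fun e => if p e then f e else g e := by
  obtain ⟨Kq, hKq⟩ := hs
  refine ⟨fun b hb => ?_⟩
  obtain ⟨R, hR⟩ := hq.prog (b + 1) (by omega)
  obtain ⟨P, hP⟩ := hf.prog b hb
  obtain ⟨Q, hQ⟩ := hg.prog b hb
  obtain ⟨t, ht⟩ := hp b
  set pop : Prog := .assign 8 (.reg b) with hpop
  refine ⟨.seq (.assign b (.reg 8)) (.seq R (.cond t (.seq pop P) (.seq pop Q))), fun K => ?_⟩
  obtain ⟨C, hC⟩ := hR (K + Kq)
  obtain ⟨C₁, hC₁⟩ := hP K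
  obtain ⟨C₂, hC₂⟩ := hQ K
  set c₂ := t.cost + pop.cost + 5 with hc₂
  refine ⟨C + C₁ + C₂ + c₂ + 2 * K, fun e B hB hDe hsm σ L hσ hL hlen => ?_⟩
  have h1 := hB.one_le
  have hqs := hKq e B hB hDe
  have eC : (C + C₁ + C₂ + c₂ + 2 * K) * B = C * B + C₁ * B + C₂ * B + c₂ * B + 2 * (K * B) := by
    ring
  have h4 : c₂ ≤ c₂ * B := Nat.le_mul_of_pos_right _ h1
  have eK : (K + Kq) * B = K * B + Kq * B := by ring
  rw [eC]
  set W : ℤ := ((C * B + C₁ * B + C₂ * B + c₂ * B + 2 * (K * B) : ℕ) : ℤ) with hW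
  have hc5 : 5 ≤ c₂ := Nat.le_add_left _ _
  have hW0 : ((2 * (K * B) + 5 : ℕ) : ℤ) ≤ W := by rw [hW]; exact Int.ofNat_le.2 (by omega)
  have hW1 : ((C * B : ℕ) : ℤ) ≤ W := by rw [hW]; exact Int.ofNat_le.2 (by omega)
  have hW2 : ((C₁ * B : ℕ) : ℤ) ≤ W := by rw [hW]; exact Int.ofNat_le.2 (by omega)
  have hW3 : ((C₂ * B : ℕ) : ℤ) ≤ W := by rw [hW]; exact Int.ofNat_le.2 (by omega)
  have hb8 : (8 : ℕ) ≠ b := by omega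
  refine Run.mono (t := 2 + (C * B + (t.cost + (pop.cost + (C₁ * B + C₂ * B)) + 1))) (Run.seq
    (Q := fun τ => Ok (b + 1) τ L τ ∧ Ok b σ L τ ∧ τ.reg b = L.length)
    (Run.of_wp (p := .assign b (.reg 8)) ?_) fun τ hτ => ?_) le_rfl ?_ fun _ => id
  · simp only [wp, Expr.eval]
    rw [hL.sp]
    refine ⟨by rw [abs_of_nonneg] <;> omega, ⟨?_, hL.arr, fun _ _ _ => rfl, rfl⟩,
      ⟨?_, hL.arr, fun i hi h8 => ?_, rfl⟩, by simp⟩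
    · simp [Function.update_of_ne hb8, hL.sp]
    · simp [Function.update_of_ne hb8, hL.sp]
    · simp [Function.update_of_ne (show i ≠ b by omega)]
  · obtain ⟨t1, t2, t3⟩ := hτ
    refine ((hC e B hB hDe (hqs.mono (by omega)) τ L (t2.agree hb hσ) t1 (by omega)).mono hW1 le_rfl
      fun _ => id).seq fun ρ hρ => ?_
    have hρb : ρ.reg b = L.length := (hρ.frame b (by omega) (by omega)).trans t3
    have hρo : Ok b σ (L ++ q e) ρ := t2.trans (by omega) hρ
    have hArr := arr_append.1 hρ.arr
    have hag : Agree ρ e := hρo.agree hb hσ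
    have hpop' : wp W pop ρ (Ok b σ L) := by
      simp only [hpop, wp, Expr.eval, hρb]
      refine ⟨by rw [abs_of_nonneg] <;> omega, by simp, hArr.1, fun i hi h8 => ?_, hρo.out⟩
      simp only [Function.update_of_ne h8]
      exact hρo.frame i hi h8
    have htest : t.holds ρ ↔ p e := ht e hDe ρ L.length hag hρb
      (by rw [hρ.sp, List.length_append]; push_cast; rfl) (by simpa using hArr.2)
    refine Run.cond (fun h => ?_) fun h => ?_
    · rw [htest] at h
      simp only [if_pos h] at hsm ⊢
      refine ((Run.of_wp hpop').seq (u := C₁ * B + C₂ * B) fun π hπ => ?_)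
      exact (hC₁ e B hB ⟨hDe, h⟩ hsm π L (hπ.agree hb hσ) hπ.self hlen).mono hW2 (by omega)
        fun π' hπ' => hπ.trans le_rfl hπ'
    · rw [htest] at h
      simp only [if_neg h] at hsm ⊢
      refine ((Run.of_wp hpop').seq (u := C₁ * B + C₂ * B) fun π hπ => ?_)
      exact (hC₂ e B hB ⟨hDe, h⟩ hsm π L (hπ.agree hb hσ) hπ.self hlen).mono hW3 (by omega)
        fun π' hπ' => hπ.trans le_rfl hπ'
  · have : c₂ = t.cost + pop.cost + 5 := rfl
    omega

/-- A case distinction according to the second cell of a computable list. -/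
theorem Comp.ite_second {p : (ℕ → ℤ) → Prop} [∀ e, Decidable (p e)]
    {q : (ℕ → ℤ) → List (ℤ × ℤ)} (hq : Comp D q) (hs : LinSize D q) {x y : (ℕ → ℤ) → ℤ}
    (hx : Lin x) (hy : Lin y) (hp : ∀ e, D e → (p e ↔ (q e)[1]? = some (x e, y e)))
    (hf : Comp (fun e => D e ∧ p e) f) (hg : Comp (fun e => D e ∧ ¬ p e) g) :
    Comp D fun e => if p e then f e else g e := by
  obtain ⟨⟨X, hX⟩, -⟩ := hx
  obtain ⟨⟨Y, hY⟩, -⟩ := hy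
  refine hq.ite_list hs (fun b => ⟨.and (.lt (.add (.reg b) (.const 1)) (.reg 8))
    (.and (.eq (.load (.add (.reg b) (.const 1))) X)
      (.eq (.load (.sub (.const (-2)) (.reg b))) Y)), fun e hDe ρ n hag hb h8 hA => ?_⟩) hf hg
  rw [hp e hDe]
  simp only [Test.holds, Expr.eval, hX ρ e hag, hY ρ e hag, hb, h8]
  rcases hqe : q e with _ | ⟨u, _ | ⟨v, r⟩⟩
  · simp
  · simp
  · rw [hqe] at hA
    simp only [Arr] at hA
    have e2 : -1 - ((n : ℤ) + 1) = -2 - n := by ring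
    rw [e2] at hA
    rw [hA.2.2.1, hA.2.2.2.1]
    simp only [List.length_cons, List.getElem?_cons_succ, List.getElem?_cons_zero,
      Option.some.injEq, Prod.ext_iff]
    constructor
    · exact fun h => h.2
    · exact fun h => ⟨by push_cast; omega, h⟩

/-- A case distinction according to the length of a computable list. -/
theorem Comp.ite_length {q : (ℕ → ℤ) → List (ℤ × ℤ)} (hq : Comp D q) (hs : LinSize D q)
    {z : (ℕ → ℤ) → ℤ} (hz : Lin z) (hf : Comp D f) (hg : Comp D g) :
    Comp D fun e => if ((q e).length : ℤ) ≤ z e then f e else g e := by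
  obtain ⟨⟨Z, hZ⟩, -⟩ := hz
  refine hq.ite_list hs (fun b => ⟨.not (.lt Z (.sub (.reg 8) (.reg b))),
    fun e hDe ρ n hag hb h8 hA => ?_⟩) (hf.mono fun _ h => h.1) (hg.mono fun _ h => h.1)
  simp only [Test.holds, Expr.eval, hZ ρ e hag, hb, h8]
  rw [add_sub_cancel_left, not_lt]

end RAM

namespace RAM
open Supergrid
variable {D D' : (ℕ → ℤ) → Prop} {f g : (ℕ → ℤ) → List (ℤ × ℤ)}
  {w h x y a b c d m n k l x₁ x₂ y₁ y₂ w' h' : (ℕ → ℤ) → ℤ} {p q : (ℕ → ℤ) → Prop}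

/-! ### Programs for the paths of rectangles -/

instance (c : ℤ) : Lin fun _ => c := lin_const c
instance [Lin x] [Lin y] : Lin fun e => x e + y e := Lin.add ‹_› ‹_›
instance [Lin x] [Lin y] : Lin fun e => x e - y e := Lin.sub ‹_› ‹_›
instance [Lin x] [Lin y] : LinTest fun e => x e < y e := Lin.lt ‹_› ‹_›
instance [Lin x] [Lin y] : LinTest fun e => x e ≤ y e := Lin.le ‹_› ‹_›
instance [Lin x] [Lin y] : LinTest fun e => x e = y e := Lin.eq ‹_› ‹_›
instance [LinTest p] [LinTest q] : LinTest fun e => p e ∧ q e := LinTest.and ‹_› ‹_›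
instance [LinTest p] [LinTest q] : LinTest fun e => p e ∨ q e := LinTest.or ‹_› ‹_›
instance [LinTest p] [LinTest q] : LinTest fun e => p e → q e := LinTest.imp ‹_› ‹_›
instance [LinTest p] : LinTest fun e => ¬ p e := LinTest.not ‹_›
instance [Lin x] [Lin y] : LinTest fun e => x e ≠ y e := LinTest.not inferInstance
instance [Lin x] [Lin y] : Comp D fun e => [(x e, y e)] := comp_single ‹_› ‹_›
instance [Comp D f] [Comp D g] : Comp D fun e => f e ++ g e := Comp.append ‹_› ‹_›
instance [∀ e, Decidable (p e)] [LinTest p] [Comp (fun e => D e ∧ p e) f]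
    [Comp (fun e => D e ∧ ¬ p e) g] : Comp D fun e => if p e then f e else g e :=
  Comp.ite ‹_› ‹_› ‹_›
instance [Comp D f] : Comp D fun e => tr (f e) := Comp.tr ‹_›
instance [Comp D f] [Lin w] : Comp D fun e => fx (w e) (f e) := Comp.fx ‹_› ‹_›
instance [Comp D f] [Lin w] : Comp D fun e => fy (w e) (f e) := Comp.fy ‹_› ‹_›
instance [Comp D f] [Lin x] [Lin y] : Comp D fun e => sh (x e) (y e) (f e) := Comp.sh ‹_› ‹_› ‹_›
instance [Comp D f] : Comp D fun e => (f e).reverse := Comp.reverse ‹_›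
instance (alt : Bool) [Lin w] [Lin h] : Comp D fun e => rows (w e) alt (h e).toNat :=
  comp_rows ‹_› ‹_› alt

instance comp_row_false [Lin w] [Lin y] : Comp D fun e => row (w e) (y e) false := by
  have : Comp D fun e => sh 0 (y e - 1) (rows (w e) false (1 : ℤ).toNat) := inferInstance
  refine this.congr (fun _ => id) fun e _ => ?_
  simp [rows, row, sh]

instance [Lin w] [Lin y] : Comp D fun e => row (w e) (y e) true := by
  simp only [row_true]; infer_instance

instance (right : Bool) [Lin w] [Lin h] : Comp D fun e => sweep (w e) (h e) right := by
  unfold sweep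
  cases right
  · have : Comp D fun e => if h e % 2 = 1 then
        tr (rows 2 false (w e).toNat) ++ sh 0 2 (fx (w e) (rows (w e) true (h e - 2).toNat))
      else rows (w e) true (h e).toNat := Comp.ite_odd ‹_› inferInstance inferInstance
    refine this.congr (fun _ => id) fun e _ => ?_
    by_cases ho : h e % 2 = 1 <;> simp [ho]
  · have : Comp D fun e => if h e % 2 = 1 then rows (w e) true (h e).toNat else
        tr (rows 2 false (w e).toNat) ++ sh 0 2 (fx (w e) (rows (w e) true (h e - 2).toNat)) :=
      Comp.ite_odd ‹_› inferInstance inferInstance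
    refine this.congr (fun _ => id) fun e _ => ?_
    by_cases ho : h e % 2 = 1 <;> simp [ho]

instance (bottom : Bool) [Lin w] [Lin h] : Comp D fun e => csweep (w e) (h e) bottom := by
  unfold csweep; infer_instance

instance [Lin w] [Lin h] [Lin x] : Comp D fun e => cornerBottom (w e) (h e) (x e) := by
  unfold cornerBottom; infer_instance

instance [Lin w] [Lin h] [Lin x] [Lin y] : Comp D fun e => corner (w e) (h e) (x e) (y e) := by
  unfold corner; infer_instance

instance [Lin w] [Lin h] [Lin a] [Lin b] [Lin c] [Lin d] [Lin x] :
    Comp D fun e => split (w e) (h e) (a e) (b e) (c e) (d e) (x e) := by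
  unfold split; infer_instance

instance [Lin w] [Lin h] [Lin a] [Lin b] [Lin c] [Lin d] [Lin x] :
    Comp D fun e => splitB (w e) (h e) (a e) (b e) (c e) (d e) (x e) := by
  unfold splitB; infer_instance

instance [Lin w] [Lin h] [Lin b] [Lin c] [Lin d] :
    Comp D fun e => around (w e) (h e) (b e) (c e) (d e) := by
  unfold around; infer_instance

instance [Lin w] [Lin h] [Lin b] : Comp D fun e => adjacentInRow (w e) (h e) (b e) := by
  unfold adjacentInRow; infer_instance

instance [Lin w] [Lin h] : Comp D fun e => diagonalAtCorner (w e) (h e) := by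
  unfold diagonalAtCorner; infer_instance

instance [Lin w] [Lin h] [Lin b] : Comp D fun e => acrossRow (w e) (h e) (b e) := by
  unfold acrossRow; infer_instance

instance [Lin w] [Lin h] [Lin b] [Lin c] [Lin d] :
    Comp D fun e => rectEdge (w e) (h e) (b e) (c e) (d e) := by
  unfold rectEdge; infer_instance

set_option synthInstance.maxSize 1000 in
set_option synthInstance.maxHeartbeats 100000 in
instance [Lin w] [Lin h] [Lin a] [Lin b] [Lin c] [Lin d] :
    Comp D fun e => rectOrdered (w e) (h e) (a e) (b e) (c e) (d e) := by
  unfold rectOrdered; infer_instance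

instance [Lin w] [Lin h] [Lin a] [Lin b] [Lin c] [Lin d] :
    Comp D fun e => rectColumns (w e) (h e) (a e) (b e) (c e) (d e) := by
  unfold rectColumns; infer_instance

instance [Lin w] [Lin h] [Lin a] [Lin b] [Lin c] [Lin d] :
    Comp D fun e => rectAny (w e) (h e) (a e) (b e) (c e) (d e) := by
  unfold rectAny; infer_instance

instance [Lin w] [Lin h] [Lin a] [Lin b] [Lin c] [Lin d] :
    Comp D fun e => rectPath (w e) (h e) (a e) (b e) (c e) (d e) := by
  unfold rectPath; infer_instance

instance [Lin x₁] [Lin x₂] [Lin y₁] [Lin y₂] [Lin a] [Lin b] [Lin c] [Lin d] :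
    Comp D fun e => boxPath (x₁ e) (x₂ e) (y₁ e) (y₂ e) (a e) (b e) (c e) (d e) := by
  unfold boxPath; infer_instance

/-! ### Sizes of Hamiltonian paths -/

/-- For all inputs in `D`, the `w e` by `h e` rectangle has linear size. -/
def Area (D : (ℕ → ℤ) → Prop) (w h : (ℕ → ℤ) → ℤ) : Prop :=
  ∃ K, ∀ e B, Adm e B → D e → (w e).toNat * (h e).toNat ≤ K * B

theorem Area.mono (H : Area D w h) (hD : ∀ e, D' e → D e ∧ w' e ≤ w e ∧ h' e ≤ h e) :
    Area D' w' h' := by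
  obtain ⟨K, hK⟩ := H
  refine ⟨K, fun e B hB he => le_trans ?_ (hK e B hB (hD e he).1)⟩
  exact Nat.mul_le_mul (Int.toNat_le_toNat (hD e he).2.1) (Int.toNat_le_toNat (hD e he).2.2)

theorem Area.symm (H : Area D w h) : Area D h w := by
  obtain ⟨K, hK⟩ := H
  exact ⟨K, fun e B hB he => by rw [mul_comm]; exact hK e B hB he⟩

theorem length_le_of_ham {V : ℤ → ℤ → Prop} {a b c d x₁ x₂ y₁ y₂ : ℤ} {p : List (ℤ × ℤ)}
    (H : Ham V a b c d p) (hV : ∀ x y, V x y → box x₁ x₂ y₁ y₂ x y) :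
    p.length ≤ (x₂ - x₁ + 1).toNat * (y₂ - y₁ + 1).toNat := by
  have h1 : p.toFinset ⊆ Finset.Icc x₁ x₂ ×ˢ Finset.Icc y₁ y₂ := by
    rintro ⟨x, y⟩ hv
    exact mem_Icc_product.2 (hV x y ((H.mem _ _).1 (List.mem_toFinset.1 hv)))
  have h2 := Finset.card_le_card h1
  rw [List.toFinset_card_of_nodup H.nodup, card_Icc_product] at h2
  rwa [show x₂ - x₁ + 1 = x₂ + 1 - x₁ by ring, show y₂ - y₁ + 1 = y₂ + 1 - y₁ by ring]

theorem linSize_of_ham (hx₁ : Lin x₁) (hx₂ : Lin x₂) (hy₁ : Lin y₁) (hy₂ : Lin y₂)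
    (hA : Area D (fun e => x₂ e - x₁ e + 1) fun e => y₂ e - y₁ e + 1)
    (H : ∀ e, D e → ∃ V a b c d, Ham V a b c d (f e) ∧
      ∀ x y, V x y → box (x₁ e) (x₂ e) (y₁ e) (y₂ e) x y) : LinSize D f := by
  obtain ⟨K, hK⟩ := hA
  obtain ⟨c₁, h1⟩ := hx₁.bound
  obtain ⟨c₂, h2⟩ := hx₂.bound
  obtain ⟨c₃, h3⟩ := hy₁.bound
  obtain ⟨c₄, h4⟩ := hy₂.bound
  refine ⟨K + c₁ + c₂ + c₃ + c₄, fun e B hB he => ?_⟩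
  obtain ⟨V, a, b, c, d, hH, hV⟩ := H e he
  have h1 := h1 e B hB
  have h2 := h2 e B hB
  have h3 := h3 e B hB
  have h4 := h4 e B hB
  have e1 : (K + c₁ + c₂ + c₃ + c₄) * B = K * B + c₁ * B + c₂ * B + c₃ * B + c₄ * B := by ring
  rw [e1]
  refine ⟨(length_le_of_ham hH hV).trans ((hK e B hB he).trans (by omega)), ?_⟩
  rintro ⟨x, y⟩ hv
  have := hV x y ((hH.mem _ _).1 hv)
  simp only [box, abs_le] at *
  constructor <;> omega

theorem LinSize.mono (hs : LinSize D f) (hD : ∀ e, D' e → D e) : LinSize D' f := by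
  obtain ⟨K, hK⟩ := hs
  exact ⟨K, fun e B hB he => hK e B hB (hD e he)⟩

theorem LinSize.sublist (hs : LinSize D f) (h : ∀ e, (g e).Sublist (f e)) : LinSize D g := by
  obtain ⟨K, hK⟩ := hs
  exact ⟨K, fun e B hB he => ⟨(h e).length_le.trans (hK e B hB he).1,
    fun v hv => (hK e B hB he).2 v ((h e).subset hv)⟩⟩

theorem linSize_rectPath (hw : Lin w) (hh : Lin h) (hA : Area D w h)
    (H : ∀ e, D e → RectOK (w e) (h e) (a e) (b e) (c e) (d e)) :
    LinSize D fun e => rectPath (w e) (h e) (a e) (b e) (c e) (d e) :=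
  linSize_of_ham (lin_const 1) hw (lin_const 1) hh (by simpa using hA) fun e he =>
    ⟨_, _, _, _, _, ham_rectPath (H e he), fun _ _ => id⟩

/-! ### Programs for the paths of L-shapes -/

theorem Comp.insertBefore (hf : Comp D f) (hs : LinSize D f) (hg : Comp D g) (hx : Lin x)
    (hy : Lin y) : Comp D fun e => insertBefore (x e, y e) (g e) (f e) :=
  ((hf.takeWhile hs hx hy).append hg).append (hf.dropWhile hs hx hy)

theorem comp_bumpInsert (hg : Comp D g) (hf : Comp D f) (hs : LinSize D f)
    (hn : ∀ e, D e → (f e).Nodup) : Comp D fun e => bumpInsert (g e) (f e) := by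
  unfold bumpInsert
  have key : ∀ {D' : (ℕ → ℤ) → Prop} {f₁ f₂ : (ℕ → ℤ) → List (ℤ × ℤ)} (u₁ u₂ v₁ v₂ : ℤ),
      (∀ e, D' e → D e) → Comp D' f₁ → (∀ D'', (∀ e, D'' e → D e) → Comp D'' f₂) →
      Comp D' fun e => if [(u₁, u₂), (v₁, v₂)] <:+: f e then f₁ e else f₂ e := by
    intro D' f₁ f₂ u₁ u₂ v₁ v₂ hD h₁ h₂
    exact ((hf.mono hD).dropWhile (hs.mono hD) (lin_const u₁) (lin_const u₂)).ite_second
      ((hs.mono hD).sublist fun e => List.dropWhile_sublist _) (lin_const v₁) (lin_const v₂)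
      (fun e he => infix_iff_second (hn e (hD e he))) (h₁.mono fun _ h => h.1)
      (h₂ _ fun e h => hD e h.1)
  have ins : ∀ {D' : (ℕ → ℤ) → Prop} {g' : (ℕ → ℤ) → List (ℤ × ℤ)} (v₁ v₂ : ℤ),
      (∀ e, D' e → D e) → Comp D' g' →
      Comp D' fun e => Supergrid.insertBefore (v₁, v₂) (g' e) (f e) := fun v₁ v₂ hD hg' =>
    (hf.mono hD).insertBefore (hs.mono hD) hg' (lin_const v₁) (lin_const v₂)
  have ins' : ∀ {D' : (ℕ → ℤ) → Prop} {g' : (ℕ → ℤ) → List (ℤ × ℤ)} (v₁ v₂ : ℤ),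
      (∀ e, D' e → D e) → Comp D' g' → Comp D' fun e =>
        Supergrid.insertBefore (v₁, v₂) (g' e) ((f e).filter (· ≠ (2, 1))) := fun v₁ v₂ hD hg' =>
    ((hf.mono hD).filter (hs.mono hD) (lin_const 2) (lin_const 1)).insertBefore
      ((hs.mono hD).sublist fun e => List.filter_sublist) hg' (lin_const v₁) (lin_const v₂)
  have E : ∀ {D' : (ℕ → ℤ) → Prop}, (∀ e, D' e → D e) → Comp D' g := fun hD => hg.mono hD
  refine key _ _ _ _ (fun _ => id) (ins _ _ (fun _ => id) ?_) fun D₁ h₁ =>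
    key _ _ _ _ h₁ (ins _ _ h₁ ?_) fun D₂ h₂ => key _ _ _ _ h₂ (ins _ _ h₂ ?_) fun D₃ h₃ =>
    key _ _ _ _ h₃ (ins _ _ h₃ ?_) fun D₄ h₄ => key _ _ _ _ h₄ (ins' _ _ h₄ ?_) fun D₅ h₅ =>
    ins' _ _ h₅ ?_
  · exact hg.reverse.append inferInstance
  · exact (E h₁).reverse.append inferInstance
  · exact Comp.append inferInstance (E h₂)
  · exact Comp.append inferInstance (E h₃)
  · exact Comp.append inferInstance ((E h₄).append inferInstance)
  · exact Comp.append inferInstance ((E h₅).append inferInstance)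

theorem comp_withoutCorner [Lin w] [Lin h] [Lin b] [Lin c] [Lin d] (hA : Area D w h)
    (H : ∀ e, D e → RectOK (w e - 1) (h e) 1 (b e) (c e - 1) (d e)) :
    Comp D fun e => withoutCorner (w e) (h e) (b e) (c e) (d e) := by
  unfold withoutCorner
  refine Comp.filter inferInstance (linSize_of_ham (x₁ := fun _ => 2) (x₂ := w) (y₁ := fun _ => 1)
    (y₂ := h) inferInstance inferInstance inferInstance inferInstance (hA.mono fun e he =>
      ⟨he, by omega, by omega⟩) fun e he => ⟨_, _, _, _, _, ham_boxPath ?_, fun _ _ => id⟩)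
    inferInstance inferInstance
  have := H e he
  unfold RectOK box at *
  omega

theorem comp_bumpFrom [Lin w] [Lin h] [Lin a] [Lin c] [Lin d] (hg : Comp D g) (hA : Area D w h)
    (H : ∀ e, D e → BumpOK (w e) (h e) (a e) 1 (c e) (d e) ∧ (a e = 1 ∨ a e = 2)) :
    Comp D fun e => bumpFrom (w e) (h e) (a e) (c e) (d e) (g e) := by
  have H' : ∀ e, D e → 2 ≤ w e ∧ 2 ≤ h e ∧ (1 ≤ c e ∧ c e ≤ w e ∧ 1 ≤ d e ∧ d e ≤ h e) ∧
      ¬ (a e = c e ∧ d e = 1) ∧ ¬ (a e = 1 ∧ c e = 2 ∧ d e = 1) ∧ ¬ (a e = 2 ∧ c e = 1 ∧ d e = 1) ∧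
      (a e = 1 ∨ a e = 2) ∧ ¬ (h e = 2 ∧ 3 ≤ w e ∧ (a e = 1 ∧ c e = 2 ∧ d e = 2 ∨
        a e = 2 ∧ c e = 1 ∧ d e = 2)) ∧ ¬ (h e = 2 ∧ a e = c e ∧ 1 < a e ∧ a e < w e) := by
    intro e he
    obtain ⟨⟨h1, h2, ⟨-, h4, h5, -, -, -, h6⟩, h7, h8, h9⟩, h10⟩ := H e he
    unfold box at h4
    refine ⟨h1, h2, h4, ?_, ?_, ?_, h10, ?_, h6⟩
    · clear h6 h7 h8 h9; omega
    · clear h5 h6 h8 h9; omega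
    · clear h5 h6 h7 h9; omega
    · clear h5 h6 h7 h8; omega
  clear H
  have hA' : ∀ {D'}, (∀ e, D' e → D e) → Area D' w h := fun hD =>
    hA.mono fun e he => ⟨hD e he, le_rfl, le_rfl⟩
  have h₁ : Comp (fun e => D e ∧ a e = 1) fun e =>
      (rectPath (w e) (h e) 2 1 (c e) (d e)).filter (· ≠ (1, 1)) := by
    refine .filter inferInstance (linSize_rectPath ‹_› ‹_› (hA' fun _ h => h.1) ?_) inferInstance
      inferInstance
    rintro e ⟨he, h1⟩
    have := H' e he
    unfold RectOK box
    omega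
  have h₂ : Comp (fun e => ((D e ∧ ¬ a e = 1) ∧ ¬ w e = 2) ∧ c e = 1) fun e =>
      if d e ≤ 3 then withoutCorner (w e) (h e) 2 2 (h e)
      else withoutCorner (w e) (h e) (d e - 1) 2 (h e) := by
    refine .ite inferInstance (comp_withoutCorner (hA' fun _ h => h.1.1.1.1) ?_)
      (comp_withoutCorner (hA' fun _ h => h.1.1.1.1) ?_)
    all_goals
      rintro e ⟨⟨⟨⟨he, h1⟩, h2⟩, h3⟩, h4⟩
      have := H' e he
      unfold RectOK box
      omega
  have h₃ : Comp (fun e => ((D e ∧ ¬ a e = 1) ∧ ¬ w e = 2) ∧ ¬ c e = 1) fun e =>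
      if c e = 2 ∧ d e = h e then withoutCorner (w e) (h e) (h e - 1) (c e) (d e)
      else withoutCorner (w e) (h e) (h e) (c e) (d e) := by
    refine .ite inferInstance (comp_withoutCorner (hA' fun _ h => h.1.1.1.1) ?_)
      (comp_withoutCorner (hA' fun _ h => h.1.1.1.1) ?_)
    all_goals
      rintro e ⟨⟨⟨⟨he, h1⟩, h2⟩, h3⟩, h4⟩
      have := H' e he
      unfold RectOK box
      omega
  unfold bumpFrom
  exact .ite inferInstance (.append inferInstance (.append (hg.mono fun _ h => h.1) h₁))
    (.append inferInstance (.append (Comp.reverse (hg.mono fun _ h => h.1)) (.ite inferInstance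
      inferInstance (.ite inferInstance (.append inferInstance (.append h₂ inferInstance))
        (.append inferInstance h₃)))))

theorem comp_bump [Lin w] [Lin h] [Lin a] [Lin b] [Lin c] [Lin d] (hg : Comp D g)
    (hA : Area D w h) (H : ∀ e, D e → BumpOK (w e) (h e) (a e) (b e) (c e) (d e)) :
    Comp D fun e => bump (w e) (h e) (a e) (b e) (c e) (d e) (g e) := by
  unfold bump
  refine .ite inferInstance (comp_bumpFrom (hg.mono fun _ h => h.1)
    (hA.mono fun _ h => ⟨h.1, le_rfl, le_rfl⟩) ?_) (.ite inferInstance (Comp.reverse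
    (comp_bumpFrom (hg.mono fun _ h => h.1.1) (hA.mono fun _ h => ⟨h.1.1, le_rfl, le_rfl⟩) ?_)) ?_)
  · rintro e ⟨he, h1, h2⟩
    have := H e he
    rw [h2] at this
    exact ⟨this, h1⟩
  · rintro e ⟨⟨he, -⟩, h1, h2⟩
    have := H e he
    rw [h2] at this
    exact ⟨this.symm, h1⟩
  · have hs : LinSize (fun e => (D e ∧ ¬ ((a e = 1 ∨ a e = 2) ∧ b e = 1)) ∧
        ¬ ((c e = 1 ∨ c e = 2) ∧ d e = 1)) fun e => rectPath (w e) (h e) (a e) (b e) (c e) (d e) :=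
      linSize_rectPath ‹_› ‹_› (hA.mono fun _ h => ⟨h.1.1, le_rfl, le_rfl⟩)
        fun e he => (H e he.1.1).2.2.1
    exact comp_bumpInsert (hg.mono fun _ h => h.1.1)
      (.filter inferInstance hs inferInstance inferInstance)
      (hs.sublist fun e => List.filter_sublist)
      fun e he => (ham_rectPath (H e he.1.1).2.2.1).nodup.filter _

set_option synthInstance.maxSize 1000 in
set_option synthInstance.maxHeartbeats 100000 in
instance [Lin w] [Lin h] [Lin a] [Lin b] [Lin c] [Lin d] :
    LinTest fun e => RectOK (w e) (h e) (a e) (b e) (c e) (d e) := by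
  unfold RectOK box; infer_instance

set_option synthInstance.maxSize 1000 in
set_option synthInstance.maxHeartbeats 100000 in
instance [Lin w] [Lin h] [Lin a] [Lin b] [Lin c] [Lin d] :
    LinTest fun e => BumpOK (w e) (h e) (a e) (b e) (c e) (d e) := by
  unfold BumpOK; infer_instance

instance [Lin m] [Lin n] [Lin l] [Lin b] :
    Comp D fun e => armRowPair (m e) (n e) (l e) (b e) := by
  unfold armRowPair; infer_instance

instance [Lin m] [Lin n] [Lin k] [Lin l] : Comp D fun e => leftCorner (m e) (n e) (k e) (l e) := by
  unfold leftCorner; infer_instance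

instance [Lin m] [Lin n] [Lin l] [Lin b] :
    Comp D fun e => leftRowPair (m e) (n e) (l e) (b e) := by
  unfold leftRowPair; infer_instance

instance [Lin m] [Lin n] [Lin l] : Comp D fun e => leftDiagonal (m e) (n e) (l e) := by
  unfold leftDiagonal; infer_instance

instance [Lin m] [Lin n] [Lin l] : Comp D fun e => leftAntidiagonal (m e) (n e) (l e) := by
  unfold leftAntidiagonal; infer_instance

instance [Lin m] [Lin n] [Lin k] [Lin l] [Lin c] [Lin d] :
    Comp D fun e => mixedRight (m e) (n e) (k e) (l e) (c e) (d e) := by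
  unfold mixedRight; infer_instance

instance [Lin m] [Lin n] [Lin k] [Lin l] [Lin a] [Lin b] [Lin c] [Lin d] :
    Comp D fun e => mixedPath (m e) (n e) (k e) (l e) (a e) (b e) (c e) (d e) := by
  unfold mixedPath; infer_instance

theorem comp_armPath [Lin m] [Lin n] [Lin k] [Lin l] [Lin a] [Lin b] [Lin c] [Lin d]
    (hA : Area D m n) (H : ∀ e, D e → 0 ≤ l e ∧ k e ≤ m e) :
    Comp D fun e => armPath (m e) (n e) (k e) (l e) (a e) (b e) (c e) (d e) := by
  unfold armPath
  refine .ite inferInstance (.sh (.tr (.fx (comp_bump inferInstance (hA.symm.mono fun e he => ?_)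
    fun _ h => h.2) inferInstance)) inferInstance inferInstance) (.ite inferInstance (.sh (.tr
    (comp_bump inferInstance (hA.symm.mono fun e he => ?_) fun _ h => h.2)) inferInstance
    inferInstance) inferInstance)
  · have := H e he.1
    exact ⟨he.1, by omega, by omega⟩
  · have := H e he.1.1
    exact ⟨he.1.1, by omega, by omega⟩

theorem comp_leftPath [Lin m] [Lin n] [Lin k] [Lin l] [Lin a] [Lin b] [Lin c] [Lin d]
    (hA : Area D m n) (H : ∀ e, D e → 0 ≤ k e) :
    Comp D fun e => leftPath (m e) (n e) (k e) (l e) (a e) (b e) (c e) (d e) := by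
  unfold leftPath
  refine .ite inferInstance (.fx (.fy (.tr (comp_bump inferInstance (hA.symm.mono fun e he => ?_)
    fun _ h => h.2)) inferInstance) inferInstance) inferInstance
  have := H e he.1
  exact ⟨he.1, by omega, by omega⟩

theorem comp_lPathWide [Lin m] [Lin n] [Lin k] [Lin l] [Lin a] [Lin b] [Lin c] [Lin d]
    (hA : Area D m n) (H : ∀ e, D e → 0 ≤ l e ∧ 0 ≤ k e ∧ k e ≤ m e) :
    Comp D fun e => lPathWide (m e) (n e) (k e) (l e) (a e) (b e) (c e) (d e) := by
  unfold lPathWide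
  exact .ite inferInstance (.ite inferInstance (comp_leftPath (hA.mono fun e he =>
    ⟨he.1.1, le_rfl, le_rfl⟩) fun e he => (H e he.1.1).2.1) inferInstance) (.ite inferInstance
    inferInstance (comp_armPath (hA.mono fun e he => ⟨he.1.1, le_rfl, le_rfl⟩)
      fun e he => ⟨(H e he.1.1).1, (H e he.1.1).2.2⟩))

theorem comp_lPath [Lin m] [Lin n] [Lin k] [Lin l] [Lin a] [Lin b] [Lin c] [Lin d]
    (hA : Area D m n) (H : ∀ e, D e → LOK (m e) (n e) (k e) (l e) (a e) (b e) (c e) (d e)) :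
    Comp D fun e => lPath (m e) (n e) (k e) (l e) (a e) (b e) (c e) (d e) := by
  unfold lPath mir
  refine .ite inferInstance (comp_lPathWide (hA.mono fun e he => ⟨he.1, le_rfl, le_rfl⟩)
    fun e he => ?_) (.ite inferInstance (.fx (.fy (.tr (comp_lPathWide (hA.symm.mono fun e he =>
      ⟨he.1.1, le_rfl, le_rfl⟩) fun e he => ?_)) inferInstance) inferInstance) (.filter
      inferInstance (linSize_rectPath inferInstance inferInstance
        (hA.mono fun e he => ⟨he.1.1, le_rfl, le_rfl⟩) fun e he => ?_) inferInstance inferInstance))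
  · have := H e he.1
    unfold LOK at this
    omega
  · have := H e he.1.1
    unfold LOK at this
    omega
  · have := H e he.1.1
    unfold LOK lCells box at this
    unfold RectOK box
    omega

end RAM

namespace Supergrid

/-! ### A longest path in every case -/

section
variable {m n k l a b c d : ℤ} {s t : ℤ × ℤ}

theorem mirror_mirror (m n : ℤ) (v : ℤ × ℤ) : mirror n m (mirror m n v) = v := by
  simp only [mirror]
  exact Prod.ext (by dsimp only; omega) (by dsimp only; omega)

theorem mirror_mem {v : ℤ × ℤ} : mirror m n v ∈ lShape n m l k ↔ v ∈ lShape m n k l := by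
  simp only [mem_lShape, lCells, box, mirror]
  omega

theorem near_mirror (u v : ℤ × ℤ) (h : Near u v) : Near (mirror m n u) (mirror m n v) := by
  simp only [Near, mirror] at *
  omega

theorem Instance.mirror (H : Instance m n k l s t) :
    Instance n m l k (mirror m n s) (mirror m n t) :=
  ⟨H.2, H.1, H.4, H.3, H.6, H.5, mirror_mem.2 H.7, mirror_mem.2 H.8, fun h => H.9 (by
    rw [← mirror_mirror m n s, h, mirror_mirror])⟩

theorem Instance.symm (H : Instance m n k l s t) : Instance m n k l t s :=
  ⟨H.1, H.2, H.3, H.4, H.5, H.6, H.8, H.7, H.9.symm⟩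

theorem IsLongestSTPath.mirror {p : List (ℤ × ℤ)} (H : IsLongestSTPath (lShape m n k l) s t p) :
    IsLongestSTPath (lShape n m l k) (mirror m n s) (mirror m n t) (p.map (mirror m n)) :=
  H.map (ψ := Supergrid.mirror n m) (mirror_mirror m n) (mirror_mirror n m) near_mirror near_mirror
    fun _ => mirror_mem

theorem mir_eq_map (m n : ℤ) (p : List (ℤ × ℤ)) : mir m n p = p.map (mirror n m) := by
  simp only [mir, fx, fy, tr, List.map_map]
  exact List.map_congr_left fun v _ => by simp [mirror]

/-- A longest path whose ends `(a, b)` and `(c, b)` form a full row of a vertical arm of width two.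
It stays above or below that row, whichever part is larger. -/
def armPairPath (m n k l a b c : ℤ) : List (ℤ × ℤ) :=
  if ((lPath m (n - (b - 1)) k (l - (b - 1)) a 1 c 1).length : ℤ) ≤ b + b then boxPath 1 2 1 b a b c b
  else sh 0 (b - 1) (lPath m (n - (b - 1)) k (l - (b - 1)) a 1 c 1)

theorem lOK_armPair (hk : m - k = 2) (hk1 : 1 ≤ k) (hn : 2 ≤ n - l) (hbl : b ≤ l)
    (h : a = 1 ∧ c = 2 ∨ a = 2 ∧ c = 1) : LOK m (n - (b - 1)) k (l - (b - 1)) a 1 c 1 := by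
  unfold LOK lCells box
  omega

theorem isLongest_armPairPath (hk : m - k = 2) (hk1 : 1 ≤ k) (hn : 2 ≤ n - l) (hb : 1 ≤ b)
    (hbl : b ≤ l) (h : a = 1 ∧ c = 2 ∨ a = 2 ∧ c = 1) :
    IsLongestSTPath (lShape m n k l) (a, b) (c, b) (armPairPath m n k l a b c) := by
  have HP : Ham (box 1 2 1 b) a b c b (boxPath 1 2 1 b a b c b) :=
    ham_boxPath (by unfold RectOK box; omega)
  have HL : Ham (fun x y => lCells m n k l x y ∧ b ≤ y) a b c b
      (sh 0 (b - 1) (lPath m (n - (b - 1)) k (l - (b - 1)) a 1 c 1)) :=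
    ((ham_lPath (lOK_armPair hk hk1 hn hbl h)).sh 0 (b - 1)).congr (by omega)
      (by simp only [lCells, box]; omega)
  have hside : ∀ q, IsSTPath (lShape m n k l) (a, b) (c, b) q →
      (∀ v ∈ q, box 1 2 1 b v.1 v.2) ∨ ∀ v ∈ q, lCells m n k l v.1 v.2 ∧ b ≤ v.2 := fun q hq => by
    refine (hq.row_pair (y := b) rfl rfl fun v hv hvb => ?_).imp (fun h v hv => ?_)
      fun h v hv => ⟨hq.2.2.2.1 v hv, h v hv⟩
    · simp only [mem_lShape, lCells, box, Prod.ext_iff] at *; omega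
    · have h1 := h v hv
      have h2 := hq.2.2.2.1 v hv
      simp only [mem_lShape, lCells, box] at *; omega
  have e := HP.length_box
  have e' : (sh 0 (b - 1) (lPath m (n - (b - 1)) k (l - (b - 1)) a 1 c 1)).length =
      (lPath m (n - (b - 1)) k (l - (b - 1)) a 1 c 1).length := by simp [sh]
  rw [show (2 : ℤ) + 1 - 1 = 2 by norm_num, show (2 : ℤ).toNat = 2 from rfl] at e
  unfold armPairPath
  split_ifs with h1
  · refine HP.isLongest_of_two HL (fun x y h => ?_) hside (by omega)
    simp only [mem_lShape, lCells, box] at *; omega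
  · exact HL.isLongest_of_two HP (fun x y h => h.1) (fun q hq => (hside q hq).symm) (by omega)

/-- A longest path of `L(m, n; k, l)` from `(a, b)` to `(c, d)`. -/
def longestPath (m n k l a b c d : ℤ) : List (ℤ × ℤ) :=
  if m - k = 1 then narrowPath m n l a b c d
  else if n - l = 1 then mir m n (narrowPath n m k (n + 1 - b) (m + 1 - a) (n + 1 - d) (m + 1 - c))
  else if m - k = 2 ∧ b = d ∧ 2 ≤ b ∧ b ≤ l then armPairPath m n k l a b c
  else if n - l = 2 ∧ a = c ∧ m - k + 1 ≤ a ∧ a ≤ m - 1 then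
    mir m n (armPairPath n m l k (n + 1 - b) (m + 1 - a) (n + 1 - d))
  else lPath m n k l a b c d

theorem isLongest_longestPath (H : Instance m n k l (a, b) (c, d)) :
    IsLongestSTPath (lShape m n k l) (a, b) (c, d) (longestPath m n k l a b c d) := by
  have hmir : ∀ p, IsLongestSTPath (lShape n m l k) (n + 1 - b, m + 1 - a) (n + 1 - d, m + 1 - c) p →
      IsLongestSTPath (lShape m n k l) (a, b) (c, d) (mir m n p) := fun p hp => by
    rw [mir_eq_map]
    have := hp.mirror
    simp only [Supergrid.mirror] at this
    convert this using 2 <;> omega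
  obtain ⟨h1, h2, h3, h4, h5, h6, hs, ht, hst⟩ := H
  rw [mem_lShape] at hs ht
  rw [ne_eq, Prod.mk.injEq] at hst
  have hs' := hs
  have ht' := ht
  simp only [lCells, box] at hs' ht'
  unfold longestPath
  split_ifs with c1 c2 c3 c4
  · exact isLongest_narrowPath (by omega) c1 h4 h6 hs ht hst
  · exact hmir _ (isLongest_narrowPath (by omega) c2 h3 h5 (by simp only [lCells, box]; omega)
      (by simp only [lCells, box]; omega) (by omega))
  · obtain ⟨c3, rfl, c5, c6⟩ := c3
    exact isLongest_armPairPath c3 h3 (by omega) (by omega) c6 (by omega)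
  · obtain ⟨c4, rfl, c5, c6⟩ := c4
    exact hmir _ (isLongest_armPairPath c4 h4 (by omega) (by omega) (by omega) (by omega))
  · exact (ham_lPath ⟨by omega, by omega, h3, h4, hs, ht, hst, c3, c4⟩).isLongest (fun x y => id)
      fun q hq v hv => hq.2.2.2.1 v hv

end
end Supergrid

namespace RAM
open Supergrid
variable {D : (ℕ → ℤ) → Prop} {m n k l a b c d x₁ x₂ y w h : (ℕ → ℤ) → ℤ}

/-! ### Programs for longest paths -/

instance [Lin x₁] [Lin x₂] [Lin y] : Comp D fun e => Supergrid.segment (x₁ e) (x₂ e) (y e) := by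
  unfold Supergrid.segment; infer_instance

instance [Lin b] [Lin d] : Comp D fun e => columnPath (b e) (d e) := by
  unfold columnPath; infer_instance

instance [Lin m] [Lin n] [Lin l] [Lin b] [Lin c] [Lin d] :
    Comp D fun e => descentPath (m e) (n e) (l e) (b e) (c e) (d e) := by
  unfold descentPath; infer_instance

instance [Lin n] [Lin a] [Lin c] : Comp D fun e => rowPath (n e) (a e) (c e) := by
  unfold rowPath; infer_instance

theorem comp_bumpLow [Lin w] [Lin h] [Lin l] [Lin a] [Lin b] [Lin c] [Lin d] (hA : Area D w h)
    (H : ∀ e, D e → BumpOK (w e) (h e) (a e) (b e - l e) (c e) (d e - l e)) :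
    Comp D fun e => bumpLow (w e) (h e) (l e) (a e) (b e) (c e) (d e) := by
  unfold bumpLow
  exact .sh (comp_bump inferInstance hA H) inferInstance inferInstance

theorem comp_lowPath [Lin m] [Lin n] [Lin l] [Lin a] [Lin b] [Lin c] [Lin d]
    (hA : Area D m n) (H : ∀ e, D e → 2 ≤ m e ∧ 1 ≤ l e ∧ 2 ≤ n e - l e ∧
      box 1 (m e) (l e + 1) (n e) (a e) (b e) ∧ box 1 (m e) (l e + 1) (n e) (c e) (d e) ∧
      ¬ (a e = c e ∧ b e = d e)) :
    Comp D fun e => lowPath (m e) (n e) (l e) (a e) (b e) (c e) (d e) := by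
  unfold lowPath
  refine .ite inferInstance (comp_bumpLow (hA.mono fun e he => ?_) fun _ h => h.2)
    (.ite inferInstance (.ite inferInstance (comp_bumpLow (hA.mono fun e he => ?_) fun e he => ?_)
      inferInstance) (.ite inferInstance (.ite inferInstance (comp_bumpLow (hA.mono fun e he => ?_)
      fun e he => ?_) inferInstance) inferInstance))
  · have := H e he.1
    exact ⟨he.1, by omega, by omega⟩
  all_goals obtain ⟨⟨⟨h1, -⟩, h3⟩, -⟩ := he
  · have := H e h1
    unfold box at this
    exact ⟨h1, by omega, by omega⟩
  · have := H e h1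
    unfold box at this
    unfold BumpOK RectOK box
    omega
  · obtain ⟨h1, -⟩ := h1
    have := H e h1
    unfold box at this
    exact ⟨h1, by omega, by omega⟩
  · obtain ⟨h1, -⟩ := h1
    have := H e h1
    unfold box at this
    unfold BumpOK RectOK box
    omega

theorem comp_narrowPath [Lin m] [Lin n] [Lin l] [Lin a] [Lin b] [Lin c] [Lin d]
    (hA : Area D m n) (H : ∀ e, D e → 2 ≤ m e ∧ 1 ≤ l e ∧
      box 1 (m e) 1 (n e) (a e) (b e) ∧ box 1 (m e) 1 (n e) (c e) (d e) ∧
      ¬ (a e = c e ∧ b e = d e)) :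
    Comp D fun e => narrowPath (m e) (n e) (l e) (a e) (b e) (c e) (d e) := by
  unfold narrowPath
  refine .ite inferInstance inferInstance (.ite inferInstance inferInstance (.ite inferInstance
    (comp_lowPath (hA.mono fun e he => ⟨he.1.1.1, le_rfl, le_rfl⟩) fun e he => ?_) inferInstance))
  obtain ⟨⟨⟨h1, h2⟩, h3⟩, h4⟩ := he
  have := H e h1
  unfold box at *
  omega

theorem comp_armPairPath [Lin m] [Lin n] [Lin k] [Lin l] [Lin a] [Lin b] [Lin c]
    (hA : Area D m n) (H : ∀ e, D e → 1 ≤ b e ∧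
      LOK (m e) (n e - (b e - 1)) (k e) (l e - (b e - 1)) (a e) 1 (c e) 1) :
    Comp D fun e => armPairPath (m e) (n e) (k e) (l e) (a e) (b e) (c e) := by
  unfold armPairPath
  have hA' : Area D m fun e => n e - (b e - 1) := hA.mono fun e he => by
    have := (H e he).1
    exact ⟨he, by omega, by omega⟩
  have hn : Lin fun e => n e - (b e - 1) := Lin.sub ‹_› (Lin.sub ‹_› (lin_const 1))
  have hl : Lin fun e => l e - (b e - 1) := Lin.sub ‹_› (Lin.sub ‹_› (lin_const 1))
  have hL : Comp D fun e => lPath (m e) (n e - (b e - 1)) (k e) (l e - (b e - 1)) (a e) 1 (c e) 1 :=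
    comp_lPath hA' fun e he => (H e he).2
  refine hL.ite_length ?_ inferInstance inferInstance (.sh hL inferInstance inferInstance)
  exact linSize_of_ham (lin_const 1) ‹Lin m› (lin_const 1) (y₂ := fun e => n e - (b e - 1))
    inferInstance (hA'.mono fun e he => ⟨he, by omega, by omega⟩) fun e he =>
    ⟨_, _, _, _, _, ham_lPath (H e he).2, fun _ _ h => h.1⟩

theorem comp_longestPath [Lin m] [Lin n] [Lin k] [Lin l] [Lin a] [Lin b] [Lin c] [Lin d]
    (hA : Area D m n)
    (H : ∀ e, D e → Instance (m e) (n e) (k e) (l e) (a e, b e) (c e, d e)) :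
    Comp D fun e => longestPath (m e) (n e) (k e) (l e) (a e) (b e) (c e) (d e) := by
  have H' : ∀ e, D e → 2 ≤ m e ∧ 2 ≤ n e ∧ 1 ≤ k e ∧ 1 ≤ l e ∧ 1 ≤ m e - k e ∧ 1 ≤ n e - l e ∧
      lCells (m e) (n e) (k e) (l e) (a e) (b e) ∧ lCells (m e) (n e) (k e) (l e) (c e) (d e) ∧
      ¬ (a e = c e ∧ b e = d e) := fun e he => by
    obtain ⟨h1, h2, h3, h4, h5, h6, hs, ht, hst⟩ := H e he
    rw [ne_eq, Prod.mk.injEq] at hst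
    exact ⟨h1, h2, h3, h4, h5, h6, hs, ht, hst⟩
  clear H
  unfold longestPath mir
  refine .ite inferInstance (comp_narrowPath (hA.mono fun e he => ⟨he.1, le_rfl, le_rfl⟩)
    fun e he => ?_) (.ite inferInstance (.fx (.fy (.tr (comp_narrowPath (hA.symm.mono fun e he =>
      ⟨he.1.1, le_rfl, le_rfl⟩) fun e he => ?_)) inferInstance) inferInstance) (.ite inferInstance
    (comp_armPairPath (hA.mono fun e he => ⟨he.1.1.1, le_rfl, le_rfl⟩) fun e he => ?_)
    (.ite inferInstance (.fx (.fy (.tr (comp_armPairPath (hA.symm.mono fun e he =>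
      ⟨he.1.1.1.1, le_rfl, le_rfl⟩) fun e he => ?_)) inferInstance) inferInstance)
    (comp_lPath (hA.mono fun e he => ⟨he.1.1.1.1, le_rfl, le_rfl⟩) fun e he => ?_))))
  · have := H' e he.1
    unfold lCells box at this
    unfold box
    omega
  · have := H' e he.1.1
    unfold lCells box at this
    unfold box
    omega
  · obtain ⟨⟨⟨h1, h2⟩, h3⟩, h4⟩ := he
    have := H' e h1
    unfold lCells box at this
    exact ⟨by omega, lOK_armPair (by omega) (by omega) (by omega) (by omega) (by omega)⟩
  · obtain ⟨⟨⟨⟨h1, h2⟩, h3⟩, h4⟩, h5⟩ := he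
    have := H' e h1
    unfold lCells box at this
    exact ⟨by omega, lOK_armPair (by omega) (by omega) (by omega) (by omega) (by omega)⟩
  · obtain ⟨⟨⟨⟨h1, h2⟩, h3⟩, h4⟩, h5⟩ := he
    obtain ⟨-, -, g3, g4, g5, g6, g7, g8, g9⟩ := H' e h1
    exact ⟨by omega, by omega, g3, g4, g7, g8, g9, h4, h5⟩

/-- The body of the loop that writes the cells on the stack to the output. -/
def outputBody : Prog :=
  .seq (.write (.load (.reg 9))) (.seq (.write (.load (.sub (.const (-1)) (.reg 9))))
    (.assign 9 (.add (.reg 9) (.const 1))))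

/-- The invariant of the output loop: the `n` cells of `Z` are still to be written. -/
structure OutInv (T : List (ℤ × ℤ)) (n : ℕ) (τ : State) (A Z : List (ℤ × ℤ)) : Prop where
  eq : A ++ Z = T
  len : Z.length = n
  idx : τ.reg 9 = A.length
  sp : τ.reg 8 = T.length
  arr : Arr τ.mem 0 T
  out : τ.out = A.flatMap fun v => [v.1, v.2]

theorem run_output {T : List (ℤ × ℤ)} {N : ℕ} (hT : Small N T) {σ : State}
    (hs : σ.reg 8 = T.length) (ha : Arr σ.mem 0 T) (h9 : σ.reg 9 = 0) (ho : σ.out = []) :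
    Run ((N + 1 : ℕ) : ℤ) (.loop (.lt (.reg 9) (.reg 8)) outputBody) σ (20 * N + 20)
      fun τ => τ.out = T.flatMap fun v => [v.1, v.2] := by
  have key := Run.loop (W := ((N + 1 : ℕ) : ℤ)) (c := .lt (.reg 9) (.reg 8)) (p := outputBody)
    (t := outputBody.cost) (fun n τ => ∃ A Z, OutInv T n τ A Z) ?_ ?_ (n := T.length) (σ := σ)
    ⟨[], T, rfl, rfl, h9, hs, ha, ho⟩
  · refine key.mono le_rfl ?_ ?_
    · have : outputBody.cost = 12 := rfl
      have h2 : (Test.lt (.reg 9) (.reg 8)).cost = 3 := rfl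
      rw [this, h2]
      have := hT.1
      omega
    · rintro τ ⟨A, Z, H⟩
      rw [H.out, ← H.eq, List.length_eq_zero_iff.1 H.len, List.append_nil]
  · rintro τ ⟨A, Z, H⟩
    have := congrArg List.length H.eq
    rw [List.length_append, H.len] at this
    simp only [Test.holds, Expr.eval, H.idx, H.sp]
    omega
  · rintro n τ ⟨A, Z, H⟩
    have hlen := congrArg List.length H.eq
    rw [List.length_append, H.len] at hlen
    obtain ⟨v, Z, rfl⟩ : ∃ v Z', Z = v :: Z' := by
      obtain _ | ⟨v, Z⟩ := Z
      · have := H.len; simp at this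
      · exact ⟨v, Z, rfl⟩
    have harr := H.arr
    rw [← H.eq, arr_append] at harr
    simp only [Arr, zero_add] at harr
    have hv := hT.2 v (by rw [← H.eq]; simp)
    have hN := hT.1
    refine ⟨by simp only [Test.holds, Expr.eval, H.idx, H.sp]; omega, Run.of_wp ?_⟩
    simp only [outputBody, wp, Expr.eval, H.idx, harr.2.1, harr.2.2.1]
    refine ⟨by push_cast; omega, by push_cast; omega, by rw [abs_of_nonneg] <;> push_cast <;> omega,
      A ++ [v], Z, ?_, ?_, ?_, ?_, H.arr, ?_⟩
    · rw [← H.eq]; simp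
    · have := H.len; simpa using this
    · simp
    · exact H.sp
    · simp [H.out]

/-- The machine solves the problem in linear time. -/
theorem exists_program :
    ∃ (P : Prog) (C : ℕ), ∀ (m n k l : ℤ) (s t : ℤ × ℤ), Instance m n k l s t →
      ∃ (p : List (ℤ × ℤ)) (T : ℕ) (τ : State),
        IsLongestSTPath (lShape m n k l) s t p ∧
        Exec (C * (m * n)) P (State.init [m, n, k, l, s.1, s.2, t.1, t.2]) T τ ∧
        (T : ℤ) ≤ C * (m * n) ∧ τ.out = p.flatMap (fun v => [v.1, v.2]) := by
  let D : (ℕ → ℤ) → Prop := fun e => Instance (e 0) (e 1) (e 2) (e 3) (e 4, e 5) (e 6, e 7)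
  have hA : Area D (fun e => e 0) fun e => e 1 := by
    refine ⟨1, fun e B hB he => ?_⟩
    have h0 := he.one_lt_m
    have h1 := he.one_lt_n
    have := hB.area_le
    dsimp only
    rw [← Int.toNat_mul (by omega) (by omega)]
    omega
  obtain ⟨hC⟩ : Comp D fun e => longestPath (e 0) (e 1) (e 2) (e 3) (e 4) (e 5) (e 6) (e 7) :=
    @comp_longestPath D _ _ _ _ _ _ _ _ (lin_var 0 (by norm_num)) (lin_var 1 (by norm_num))
      (lin_var 2 (by norm_num)) (lin_var 3 (by norm_num)) (lin_var 4 (by norm_num))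
      (lin_var 5 (by norm_num)) (lin_var 6 (by norm_num)) (lin_var 7 (by norm_num)) hA fun e he => he
  -- Register 9 is left alone by this program; it counts the cells in the output loop.
  obtain ⟨P, hP⟩ := hC 10 (by norm_num)
  obtain ⟨C, hC⟩ := hP 1
  refine ⟨.seq P (.loop (.lt (.reg 9) (.reg 8)) outputBody), C + 40,
    fun m n k l s t H => ?_⟩
  obtain ⟨e, he⟩ : ∃ e : ℕ → ℤ, e = (State.init [m, n, k, l, s.1, s.2, t.1, t.2]).reg := ⟨_, rfl⟩
  have hD : D e := by subst he; exact H
  have hmn : 2 * 2 ≤ m * n := mul_le_mul H.one_lt_m H.one_lt_n (by norm_num) (by have := H.1; omega)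
  obtain ⟨B, hB⟩ : ∃ B : ℕ, (B : ℤ) = m * n := ⟨(m * n).toNat, by omega⟩
  have hp := isLongest_longestPath H
  obtain ⟨p, hpe⟩ : ∃ p, p = longestPath m n k l s.1 s.2 t.1 t.2 := ⟨_, rfl⟩
  rw [Prod.mk.eta, Prod.mk.eta] at hp
  rw [← hpe] at hp
  obtain ⟨h1, h2, h3, h4, h5, h6, hs, ht, -⟩ := H
  have hm : m ≤ B := by rw [hB]; nlinarith
  have hn : n ≤ B := by rw [hB]; nlinarith
  have hadm : Adm e B := by
    simp only [mem_lShape, lCells, box] at hs ht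
    refine ⟨by omega, fun i hi => ?_, ?_⟩
    · subst he
      rw [abs_le]
      interval_cases i <;> simp [State.init] <;> omega
    · subst he
      simp [State.init, hB]
  have hsmall : Small (1 * B) p := by
    have hbox : ∀ v ∈ p, box 1 m 1 n v.1 v.2 := fun v hv => (hp.1.2.2.2.1 v hv).1
    refine ⟨?_, fun v hv => ?_⟩
    · have h1 : p.toFinset ⊆ Finset.Icc 1 m ×ˢ Finset.Icc 1 n := by
        rintro ⟨x, y⟩ hv
        exact mem_Icc_product.2 (hbox _ (List.mem_toFinset.1 hv))
      have h2 := Finset.card_le_card h1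
      rw [List.toFinset_card_of_nodup hp.1.2.2.1, card_Icc_product,
        ← Int.toNat_mul (by omega) (by omega)] at h2
      simp only [add_sub_cancel_right, ← hB] at h2
      omega
    · have := hbox v hv
      simp only [box, abs_le] at *
      omega
  have hrun := hC e B hadm hD (by subst he; rw [hpe] at hsmall; exact hsmall)
    (State.init [m, n, k, l, s.1, s.2, t.1, t.2]) [] (fun i _ => by rw [he])
    ⟨rfl, trivial, fun _ _ _ => rfl, rfl⟩ (by simp)
  have hpe' : [] ++ longestPath (e 0) (e 1) (e 2) (e 3) (e 4) (e 5) (e 6) (e 7) = p := by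
    subst he; rw [hpe]; rfl
  rw [hpe'] at hrun
  rw [one_mul] at hsmall
  obtain ⟨T, τ, hE, hT, hO⟩ := (hrun.mono (W' := (((C + 40) * B : ℕ) : ℤ)) (by
      rw [add_mul]; push_cast; omega) le_rfl (fun _ => id)).seq fun τ hτ =>
    (run_output hsmall hτ.sp hτ.arr ((hτ.frame 9 (by norm_num) (by norm_num)).trans rfl)
      (hτ.out.trans rfl)).mono (W' := (((C + 40) * B : ℕ) : ℤ)) (by
        rw [add_mul]; push_cast; have : (0 : ℤ) ≤ C * B := by positivity
        omega) le_rfl fun _ => id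
  refine ⟨p, T, τ, hp, ?_, ?_, hO⟩
  · rw [← hB]; exact_mod_cast hE
  · rw [← hB]
    have : T ≤ (C + 40) * B := by rw [add_mul]; omega
    exact_mod_cast this

end RAM

namespace Supergrid

/-! ### The upper bounds are attained -/

section
variable {m n k l : ℤ} {s t : ℤ × ℤ} {V V₁ V₂ : Set (ℤ × ℤ)} {p q : List (ℤ × ℤ)} {N : ℤ}

theorem IsLongestSTPath.length_eq (H : IsLongestSTPath V s t p) (H' : IsLongestSTPath V s t q) :
    p.length = q.length :=
  le_antisymm (H'.2 p H.1) (H.2 q H'.1)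

theorem length_segment {x₁ x₂ : ℤ} (y : ℤ) (h : x₁ ≤ x₂) :
    ((segment x₁ x₂ y).length : ℤ) = x₂ + 1 - x₁ := by
  rw [(ham_segment y h).length_box, show y + 1 - y = 1 by ring]
  simp only [Int.toNat_one, mul_one]
  omega

theorem iff_of_sides (h₁ : V₁ ⊆ V) (h₂ : V₂ ⊆ V)
    (h : IsSTPath V s t q → (∀ v ∈ q, v ∈ V₁) ∨ ∀ v ∈ q, v ∈ V₂) :
    IsSTPath V s t q ↔ IsSTPath V₁ s t q ∨ IsSTPath V₂ s t q :=
  ⟨fun hq => (h hq).imp hq.mono hq.mono, fun hq => hq.elim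
    (fun hq => hq.mono fun v hv => h₁ (hq.2.2.2.1 v hv))
    fun hq => hq.mono fun v hv => h₂ (hq.2.2.2.1 v hv)⟩

theorem length_of_uB1 (H : Instance m n k l s t) (hp : IsLongestSTPath (lShape m n k l) s t p)
    (h : UB1 m n k l s t) : (p.length : ℤ) = |t.2 - s.2| + 1 := by
  obtain ⟨h1, -, h3, h4⟩ := h
  rw [hp.length_eq (isLongest_columnPath h1 H.7 H.8 h3 h4), (ham_columnPath _ _).length_box,
    show (1 : ℤ) + 1 - 1 = 1 by norm_num, Int.toNat_one, one_mul, Int.toNat_of_nonneg (by omega)]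
  rcases le_total s.2 t.2 with h | h
  · rw [max_eq_right h, min_eq_left h, abs_of_nonneg (by omega)]; omega
  · rw [max_eq_left h, min_eq_right h, abs_of_nonpos (by omega)]; omega

theorem length_of_uB2 (H : Instance m n k l s t) (hp : IsLongestSTPath (lShape m n k l) s t p)
    (h : UB2 m n k l s t) : (p.length : ℤ) = n - s.2 + t.1 := by
  obtain ⟨h1, h2, -, h4, h5⟩ := h
  have ht := H.8
  simp only [mem_lShape, lCells, box] at ht
  rw [hp.length_eq (isLongest_descentPath H.1 h1 H.6 H.7 H.8 h4 (by omega))]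
  unfold descentPath
  rw [if_neg (by omega), if_neg (by omega), List.length_append]
  simp only [tr, List.length_map]
  push_cast
  rw [length_segment _ h4, length_segment _ (by omega)]
  omega

theorem length_descentPath_corner {b : ℤ} (hn : n - l = 1) (hb : b ≤ l) :
    ((descentPath m n l b 1 n).length : ℤ) = n - b + 2 := by
  unfold descentPath
  rw [if_neg (by omega), if_pos rfl, List.length_append]
  simp only [tr, List.length_map]
  push_cast
  rw [length_segment _ hb]
  simp only [List.cons_append, List.nil_append, List.length_cons, List.length_nil]
  push_cast
  omega

theorem length_of_uB3 (H : Instance m n k l s t) (hp : IsLongestSTPath (lShape m n k l) s t p)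
    (h : UB3 m n k l s t) : (p.length : ℤ) = |t.2 - s.2| + 2 := by
  obtain ⟨h1, h2, -, h4, h5, h6, -⟩ := h
  obtain ⟨a, b⟩ := s
  obtain ⟨c, d⟩ := t
  have hs := H.7
  have ht := H.8
  have hst := H.9
  simp only [mem_lShape, lCells, box, ne_eq, Prod.mk.injEq] at *
  obtain rfl := h4
  obtain rfl := h5
  rcases le_total b d with h | h
  · rw [max_eq_right h] at h6
    obtain rfl := h6
    rw [hp.length_eq (isLongest_descentPath H.1 h1 H.6 H.7 H.8 (by omega) (by omega)),
      length_descentPath_corner h2 (by omega), abs_of_nonneg (by omega)]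
  · rw [max_eq_left h] at h6
    obtain rfl := h6
    rw [hp.length_eq (isLongest_descentPath H.1 h1 H.6 H.8 H.7 (by omega) (by omega)).reverse,
      List.length_reverse, length_descentPath_corner h2 (by omega), abs_of_nonpos (by omega)]
    ring

theorem length_of_uB4 (H : Instance m n k l s t) (hp : IsLongestSTPath (lShape m n k l) s t p)
    (h : UB4 m n k l s t) :
    longestLength (lShape m (n - cutRows l s t) k (l - cutRows l s t))
      (s - (0, cutRows l s t)) (t - (0, cutRows l s t)) = p.length := by
  obtain ⟨h1, h2, h3⟩ := h
  have hs := H.7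
  have ht := H.8
  simp only [mem_lShape, lCells, box] at hs ht
  -- The vertical arm has width one, so that no path visits the first `r` rows.
  obtain ⟨r, hr⟩ : ∃ r, r = cutRows l s t := ⟨_, rfl⟩
  have hr' : 0 ≤ r ∧ r + 1 ≤ l ∧ r + 1 ≤ s.2 ∧ r + 1 ≤ t.2 := by
    unfold cutRows at hr
    split_ifs at hr with h4
    · omega
    · rcases min_cases s.2 t.2 with h5 | h5 <;> omega
  rw [← hr]
  clear hr
  rw [longestLength_sub (V := {v | v ∈ lShape m n k l ∧ r < v.2}) (0, r) fun v => by
    simp only [Set.mem_ofPred_eq, mem_lShape, lCells, box, Prod.fst_add, Prod.snd_add]; omega,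
    ← hp.longestLength_eq]
  exact longestLength_congr fun q => ⟨fun hq => hq.mono fun v hv => (hq.2.2.2.1 v hv).1,
    fun hq => hq.mono fun v hv => ⟨hq.2.2.2.1 v hv,
      hq.le_row h1 hr'.2.1 hr'.2.2.1 hr'.2.2.2 v hv⟩⟩

theorem length_of_uB5 (H : Instance m n k l s t) (hp : IsLongestSTPath (lShape m n k l) s t p)
    (h : UB5 m n k l s t) : longestLength (rect m (n - l)) (s - (0, l)) (t - (0, l)) = p.length := by
  obtain ⟨h1, h2, -, rfl, rfl⟩ := h
  have hm := H.1
  have HP : Ham (box 1 m (l + 1) n) 1 (l + 1) 2 (l + 1) (boxPath 1 m (l + 1) n 1 (l + 1) 2 (l + 1)) :=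
    ham_boxPath (by unfold RectOK box; omega)
  rw [hp.length_eq (isLongest_top (by omega) h2 (by omega) H.4 HP),
    longestLength_sub (V := {v | box 1 m (l + 1) n v.1 v.2}) (0, l) fun v => by
      simp only [Set.mem_ofPred_eq, rect, box, Prod.fst_add, Prod.snd_add]; omega]
  exact (HP.isLongest (fun x y => id) fun q hq v hv => hq.2.2.2.1 v hv).longestLength_eq

theorem length_of_uB6a (H : Instance m n k l s t) (hp : IsLongestSTPath (lShape m n k l) s t p)
    (h : UB6a m n k l s t) : max (longestLength (rect (m - k) s.2) s t)
      (longestLength (lShape m (n - s.2 + 1) k (l - s.2 + 1))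
        (s - (0, s.2 - 1)) (t - (0, s.2 - 1))) = p.length := by
  obtain ⟨h1, h2, h3, h4, h5, h6⟩ := h
  obtain ⟨hm, hn, hk, hl, -, -, hs, ht, hst⟩ := H
  obtain ⟨a, b⟩ := s
  obtain ⟨c, d⟩ := t
  dsimp only at *
  subst h5
  have hne : a ≠ c := by rintro rfl; exact hst rfl
  simp only [mem_lShape, lCells, box] at hs ht
  rw [longestLength_sub (V := {v | v ∈ lShape m n k l ∧ b ≤ v.2}) (0, b - 1) fun v => by
    simp only [Set.mem_ofPred_eq, mem_lShape, lCells, box, Prod.fst_add, Prod.snd_add]; omega]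
  refine hp.max_eq fun q => iff_of_sides (fun v hv => ?_) (fun v hv => hv.1) fun hq =>
    (hq.row_pair (y := b) rfl rfl fun v hv hvb => ?_).imp (fun h v hv => ?_)
      fun h v hv => ⟨hq.2.2.2.1 v hv, h v hv⟩
  · simp only [rect, Set.mem_ofPred_eq, mem_lShape, lCells, box] at *; omega
  · simp only [mem_lShape, lCells, box, Prod.ext_iff] at *; omega
  · have h7 := h v hv
    have h8 := hq.2.2.2.1 v hv
    simp only [rect, Set.mem_ofPred_eq, mem_lShape, lCells, box] at *; omega

theorem length_of_uB6b (H : Instance m n k l s t) (hp : IsLongestSTPath (lShape m n k l) s t p)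
    (h : UB6b m n k l s t) : max (longestLength (lShape m s.2 k l) s t)
      (longestLength (rect m (n - s.2 + 1)) (s - (0, s.2 - 1)) (t - (0, s.2 - 1))) = p.length := by
  obtain ⟨h1, h2, h3, h4, h5⟩ := h
  obtain ⟨hm, hn, hk, hl, -, -, hs, ht, hst⟩ := H
  obtain ⟨a, b⟩ := s
  obtain ⟨c, d⟩ := t
  dsimp only at *
  subst h4
  have hne : a ≠ c := by rintro rfl; exact hst rfl
  simp only [mem_lShape, lCells, box] at hs ht
  rw [longestLength_sub (V := {v | v ∈ lShape m n k l ∧ b ≤ v.2}) (0, b - 1) fun v => by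
    simp only [Set.mem_ofPred_eq, rect, mem_lShape, lCells, box, Prod.fst_add, Prod.snd_add]; omega]
  refine hp.max_eq fun q => iff_of_sides (fun v hv => ?_) (fun v hv => hv.1) fun hq =>
    (hq.row_pair (y := b) rfl rfl fun v hv hvb => ?_).imp (fun h v hv => ?_)
      fun h v hv => ⟨hq.2.2.2.1 v hv, h v hv⟩
  · simp only [mem_lShape, lCells, box] at *; omega
  · simp only [mem_lShape, lCells, box, Prod.ext_iff] at *; omega
  · have h7 := h v hv
    have h8 := hq.2.2.2.1 v hv
    simp only [mem_lShape, lCells, box] at *; omega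

theorem length_of_uB6c (H : Instance m n k l s t) (hp : IsLongestSTPath (lShape m n k l) s t p)
    (h : UB6c m n k l s t) : max (longestLength (lShape s.1 n (s.1 - (m - k)) l) s t)
      (longestLength (rect (m - s.1 + 1) (n - l))
        (s - (s.1 - 1, l)) (t - (s.1 - 1, l))) = p.length := by
  obtain ⟨h1, h2, h3, h4, h5⟩ := h
  obtain ⟨hm, hn, hk, hl, -, -, hs, ht, hst⟩ := H
  obtain ⟨a, b⟩ := s
  obtain ⟨c, d⟩ := t
  dsimp only at *
  subst h4
  have hne : b ≠ d := by rintro rfl; exact hst rfl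
  simp only [mem_lShape, lCells, box] at hs ht
  rw [longestLength_sub (V := {v | v ∈ lShape m n k l ∧ a ≤ v.1}) (a - 1, l) fun v => by
    simp only [Set.mem_ofPred_eq, rect, mem_lShape, lCells, box, Prod.fst_add, Prod.snd_add]; omega]
  refine hp.max_eq fun q => iff_of_sides (fun v hv => ?_) (fun v hv => hv.1) fun hq =>
    (hq.column_pair (x := a) rfl rfl fun v hv hvb => ?_).imp (fun h v hv => ?_)
      fun h v hv => ⟨hq.2.2.2.1 v hv, h v hv⟩
  · simp only [mem_lShape, lCells, box] at *; omega
  · simp only [mem_lShape, lCells, box, Prod.ext_iff] at *; omega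
  · have h7 := h v hv
    have h8 := hq.2.2.2.1 v hv
    simp only [mem_lShape, lCells, box] at *; omega

theorem pair_eq_iff {a b c d : ℤ × ℤ} (h : ({a, b} : Set (ℤ × ℤ)) = {c, d}) :
    a = c ∧ b = d ∨ a = d ∧ b = c := by
  rwa [Set.pair_eq_pair_iff] at h

theorem length_of_f5Std (hp : IsLongestSTPath (lShape m n k l) s t p)
    (h : F5Std m n k l s t) : (p.length : ℤ) = m * n - k * l - 1 := by
  obtain ⟨h1, h2, rfl, h4, h5⟩ := h
  obtain rfl : n = 3 := by omega
  obtain rfl : k = m - 1 := by omega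
  have key : ∀ b d, b = 2 ∧ d = 3 ∨ b = 3 ∧ d = 2 → ∃ q,
      IsLongestSTPath (lShape m 3 (m - 1) 1) (1, b) (2, d) q ∧ (q.length : ℤ) = 2 * m := by
    intro b d hbd
    have HP : Ham (box 1 m (1 + 1) 3) 1 b 2 d (boxPath 1 m (1 + 1) 3 1 b 2 d) :=
      ham_boxPath (by unfold RectOK box; omega)
    refine ⟨_, isLongest_diagonal (by omega) h1 le_rfl h2 (by omega) HP, ?_⟩
    rw [HP.length_box, show (3 : ℤ) + 1 - (1 + 1) = 2 by norm_num, show (2 : ℤ).toNat = 2 from rfl]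
    omega
  have e : m * 3 - (m - 1) * 1 - 1 = 2 * m := by ring
  rw [e]
  rcases h5 with h5 | h5 <;> rcases pair_eq_iff h5 with ⟨rfl, rfl⟩ | ⟨rfl, rfl⟩
  · obtain ⟨q, hq, hl⟩ := key 2 3 (by norm_num)
    rw [hp.length_eq hq, hl]
  · obtain ⟨q, hq, hl⟩ := key 2 3 (by norm_num)
    rw [hp.length_eq hq.reverse, List.length_reverse, hl]
  · obtain ⟨q, hq, hl⟩ := key 3 2 (by norm_num)
    rw [hp.length_eq hq, hl]
  · obtain ⟨q, hq, hl⟩ := key 3 2 (by norm_num)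
    rw [hp.length_eq hq.reverse, List.length_reverse, hl]

theorem UpperBound.length_eq (H : Instance m n k l s t)
    (hp : IsLongestSTPath (lShape m n k l) s t p) (h : UpperBound m n k l s t N) :
    (p.length : ℤ) = N := by
  cases h with
  | ub1 h => exact length_of_uB1 H hp h
  | ub2 h => exact length_of_uB2 H hp h
  | ub3 h => exact length_of_uB3 H hp h
  | ub4 h => exact_mod_cast (length_of_uB4 H hp h).symm
  | ub5 h => exact_mod_cast (length_of_uB5 H hp h).symm
  | ub6a h => exact_mod_cast (length_of_uB6a H hp h).symm
  | ub6b h => exact_mod_cast (length_of_uB6b H hp h).symm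
  | ub6c h => exact_mod_cast (length_of_uB6c H hp h).symm
  | f5 h => exact length_of_f5Std hp h

theorem UpperBoundIso.length_eq (H : Instance m n k l s t)
    (hp : IsLongestSTPath (lShape m n k l) s t p) (h : UpperBoundIso m n k l s t N) :
    (p.length : ℤ) = N := by
  rcases h with h | h | h | h
  · exact h.length_eq H hp
  · simpa using h.length_eq H.symm hp.reverse
  · simpa using h.length_eq H.mirror hp.mirror
  · simpa using h.length_eq H.mirror.symm hp.mirror.reverse

end
end Supergrid

namespace Supergrid

/-! ### Hamiltonian paths and forbidden conditions -/

/-- A Hamiltonian path from `s` to `t` exists. -/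
def HasHamPath (m n k l : ℤ) (s t : ℤ × ℤ) : Prop :=
  ∃ p, IsSTPath (lShape m n k l) s t p ∧ ∀ v ∈ lShape m n k l, v ∈ p

/-- Either there is a Hamiltonian path, or one of the forbidden conditions holds and one of the
upper bounds applies. -/
def Dichotomy (m n k l : ℤ) (s t : ℤ × ℤ) : Prop :=
  HasHamPath m n k l s t ∨
    (F1 m n k l s t ∨ F4 m n k l s t ∨ F5 m n k l s t) ∧ ∃ N, UpperBoundIso m n k l s t N

section
variable {m n k l a b c d : ℤ} {s t : ℤ × ℤ} {V V' : Set (ℤ × ℤ)} {p : List (ℤ × ℤ)} {N : ℤ}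

theorem Ham.hasHamPath {U : ℤ → ℤ → Prop} (H : Ham U a b c d p)
    (h : ∀ x y, U x y ↔ lCells m n k l x y) : HasHamPath m n k l (a, b) (c, d) :=
  ⟨p, H.isSTPath fun x y => (h x y).1, fun v hv => (H.mem v.1 v.2).2 ((h _ _).2 hv)⟩

theorem HasHamPath.symm (H : HasHamPath m n k l s t) : HasHamPath m n k l t s := by
  obtain ⟨p, hp, h⟩ := H
  exact ⟨p.reverse, hp.reverse, fun v hv => List.mem_reverse.2 (h v hv)⟩

theorem mirror_injective (m n : ℤ) : Function.Injective (mirror m n) := fun u v h => by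
  rw [← mirror_mirror m n u, h, mirror_mirror]

theorem HasHamPath.mirror (H : HasHamPath m n k l s t) :
    HasHamPath n m l k (mirror m n s) (mirror m n t) := by
  obtain ⟨p, hp, h⟩ := H
  refine ⟨p.map (Supergrid.mirror m n), hp.map _ (mirror_injective m n) near_mirror
    fun v => mirror_mem.2, fun v hv => List.mem_map.2 ⟨Supergrid.mirror n m v, h _ ?_, ?_⟩⟩
  · exact mirror_mem.2 hv
  · exact mirror_mirror n m v

theorem HasHamPath.not_f1 (H : HasHamPath m n k l s t) (hst : s ≠ t) : ¬ F1 m n k l s t := by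
  obtain ⟨p, hp, h⟩ := H
  obtain ⟨h1, h2, h3⟩ := not_isVertexCut_of_covering hp hst h
  exact fun h => h.elim h1 fun h => h.elim h2 h3

theorem HasHamPath.not_f4 (H : HasHamPath m n k l s t) : ¬ F4 m n k l s t := by
  obtain ⟨p, hp, h⟩ := H
  rintro ⟨w, h1, h2, h3⟩
  exact ncard_neighborSet_ne_one hp h h2 h3 h1

theorem HasHamPath.exists_isLongest (H : Instance m n k l s t) (h : HasHamPath m n k l s t) :
    ∃ p, IsLongestSTPath (lShape m n k l) s t p ∧ (p.length : ℤ) = m * n - k * l := by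
  obtain ⟨p, hp, h⟩ := h
  refine ⟨p, ⟨hp, fun q hq => (List.subperm_of_subset hq.2.2.1 fun v hv =>
    h v (hq.2.2.2.1 v hv)).length_le⟩, ?_⟩
  obtain ⟨h1, h2, h3, h4, h5, h6, -, -, -⟩ := H
  have hsub : Finset.Icc (m - k + 1) m ×ˢ Finset.Icc 1 l ⊆ Finset.Icc 1 m ×ˢ Finset.Icc 1 n :=
    Finset.product_subset_product (Finset.Icc_subset_Icc (by omega) le_rfl)
      (Finset.Icc_subset_Icc le_rfl (by omega))
  have e : p.toFinset = (Finset.Icc 1 m ×ˢ Finset.Icc 1 n) \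
      (Finset.Icc (m - k + 1) m ×ˢ Finset.Icc 1 l) := by
    ext ⟨x, y⟩
    rw [List.mem_toFinset, Finset.mem_sdiff, mem_Icc_product, mem_Icc_product,
      show (x, y) ∈ p ↔ (x, y) ∈ lShape m n k l from ⟨hp.2.2.2.1 _, h _⟩]
    simp only [mem_lShape, lCells, box]
    omega
  rw [← List.toFinset_card_of_nodup hp.2.2.1, e, Finset.card_sdiff_of_subset hsub,
    Nat.cast_sub (Finset.card_le_card hsub), card_Icc_product, card_Icc_product]
  push_cast
  rw [Int.toNat_of_nonneg (by omega), Int.toNat_of_nonneg (by omega),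
    Int.toNat_of_nonneg (by omega), Int.toNat_of_nonneg (by omega)]
  ring

/-! ### Symmetries of the forbidden conditions -/

theorem F1.symm (H : F1 m n k l s t) : F1 m n k l t s := by
  unfold F1 at *
  rw [Set.pair_comm]
  tauto

theorem F4.symm (H : F4 m n k l s t) : F4 m n k l t s := by
  obtain ⟨w, h1, h2, h3⟩ := H
  exact ⟨w, h1, h3, h2⟩

theorem F5.symm (H : F5 m n k l s t) : F5 m n k l t s := by
  unfold F5 F5Std at *
  rwa [Set.pair_comm, Set.pair_comm (Supergrid.mirror m n t)]

/-- The reflection as an isomorphism between induced subgraphs. -/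
def mirrorIso (m n : ℤ) {W W' : Set (ℤ × ℤ)} (h : ∀ v, mirror m n v ∈ W' ↔ v ∈ W) :
    supergrid.induce W ≃g supergrid.induce W' where
  toFun v := ⟨mirror m n v, (h v).2 v.2⟩
  invFun v := ⟨mirror n m v, (h _).1 (by rw [mirror_mirror]; exact v.2)⟩
  left_inv v := Subtype.ext (mirror_mirror m n v)
  right_inv v := Subtype.ext (mirror_mirror n m v)
  map_rel_iff' := by
    rintro ⟨u, hu⟩ ⟨v, hv⟩
    change supergrid.Adj (mirror m n u) (mirror m n v) ↔ supergrid.Adj u v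
    rw [adj_iff, adj_iff, (mirror_injective m n).ne_iff]
    refine and_congr_right fun _ => ⟨fun h => ?_, near_mirror u v⟩
    have := near_mirror (m := n) (n := m) _ _ h
    rwa [mirror_mirror, mirror_mirror] at this

theorem IsVertexCut.mirror {S S' : Set (ℤ × ℤ)} (H : IsVertexCut V S)
    (hV : ∀ v, mirror m n v ∈ V' ↔ v ∈ V) (hS : ∀ v, mirror m n v ∈ S' ↔ v ∈ S) :
    IsVertexCut V' S' := by
  intro h
  refine H ?_
  let e := mirrorIso m n (W := V \ S) (W' := V' \ S') fun v => by
    rw [Set.mem_sdiff, Set.mem_sdiff, hV, hS]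
  exact h.map e.symm.toHom e.symm.surjective

theorem F1.mirror (H : F1 m n k l s t) : F1 n m l k (mirror m n s) (mirror m n t) := by
  have h : ∀ u v, Supergrid.mirror m n u = Supergrid.mirror m n v ↔ u = v := fun u v =>
    (mirror_injective m n).eq_iff
  refine H.imp (fun H => H.mirror (fun v => mirror_mem) fun v => ?_) fun H => H.imp
    (fun H => H.mirror (fun v => mirror_mem) fun v => ?_)
    fun H => H.mirror (fun v => mirror_mem) fun v => ?_
  all_goals simp only [Set.mem_insert_iff, Set.mem_singleton_iff, h]

theorem F4.mirror (H : F4 m n k l s t) : F4 n m l k (mirror m n s) (mirror m n t) := by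
  obtain ⟨w, h1, h2, h3⟩ := H
  let e := mirrorIso m n (W := lShape m n k l) (W' := lShape n m l k) fun v => mirror_mem
  refine ⟨e w, ?_, fun h => h2 (mirror_injective m n h), fun h => h3 (mirror_injective m n h)⟩
  rw [← h1, ← Nat.card_coe_set_eq, ← Nat.card_coe_set_eq]
  exact (Nat.card_congr (e.mapNeighborSet w)).symm

theorem F5.mirror (H : F5 m n k l s t) : F5 n m l k (mirror m n s) (mirror m n t) := by
  unfold F5 at *
  rw [mirror_mirror, mirror_mirror]
  exact H.symm

theorem UpperBoundIso.symm (H : UpperBoundIso m n k l s t N) : UpperBoundIso m n k l t s N := by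
  unfold UpperBoundIso at *
  tauto

theorem UpperBoundIso.mirror (H : UpperBoundIso m n k l s t N) :
    UpperBoundIso n m l k (mirror m n s) (mirror m n t) N := by
  unfold UpperBoundIso at *
  rw [mirror_mirror, mirror_mirror]
  tauto

theorem Dichotomy.symm (H : Dichotomy m n k l s t) : Dichotomy m n k l t s :=
  H.imp HasHamPath.symm fun ⟨h, N, hN⟩ =>
    ⟨h.imp F1.symm fun h => h.imp F4.symm F5.symm, N, hN.symm⟩

theorem Dichotomy.mirror (H : Dichotomy m n k l s t) :
    Dichotomy n m l k (mirror m n s) (mirror m n t) :=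
  H.imp HasHamPath.mirror fun ⟨h, N, hN⟩ =>
    ⟨h.imp F1.mirror fun h => h.imp F4.mirror F5.mirror, N, hN.mirror⟩

end
end Supergrid

namespace Supergrid

/-! ### The dichotomy for a vertical arm of width one -/

section
variable {m n k l a b c d : ℤ} {s t : ℤ × ℤ}

/-- If the vertical arm has length at least two and no end lies in it, then its top cell `(1, 1)` is
a pendant vertex. -/
theorem f4_of_low (H : Instance m n k l s t) (hk : m - k = 1) (hl : 1 < l) (hs : l < s.2)
    (ht : l < t.2) : F4 m n k l s t := by
  obtain ⟨h1, h2, h3, h4, h5, h6, -⟩ := H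
  refine ⟨⟨(1, 1), ?_⟩, ncard_neighborSet_eq_one (z := (1, 2)) ?_ ?_ ?_ ?_ ?_, ?_, ?_⟩
  · simp only [mem_lShape, lCells, box]; omega
  · simp only [mem_lShape, lCells, box]; omega
  · simp only [mem_lShape, lCells, box]; omega
  · simp [Near]
  · simp
  · intro x hx hn
    simp only [mem_lShape, lCells, box, Near, Prod.ext_iff] at *
    omega
  · intro h; rw [← h] at hs; dsimp only at hs; omega
  · intro h; rw [← h] at ht; dsimp only at ht; omega

/-- The rightmost cell of a horizontal arm of height one is a pendant vertex. -/
theorem f4_of_corner (H : Instance m n k l s t) (hk : m - k = 1) (hn : n - l = 1) (hm : 3 ≤ m)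
    (hs : s.1 = 1) (ht : t.1 = 1) : F4 m n k l s t := by
  obtain ⟨h1, h2, h3, h4, h5, h6, -⟩ := H
  refine ⟨⟨(m, n), ?_⟩, ncard_neighborSet_eq_one (z := (m - 1, n)) ?_ ?_ ?_ ?_ ?_, ?_, ?_⟩
  · simp only [mem_lShape, lCells, box]; omega
  · simp only [mem_lShape, lCells, box]; omega
  · simp only [mem_lShape, lCells, box]; omega
  · simp [Near]
  · simp only [ne_eq, Prod.mk.injEq]; omega
  · intro x hx hn
    simp only [mem_lShape, lCells, box, Near, Prod.ext_iff] at *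
    omega
  · intro h; rw [← h] at hs; dsimp only at hs; omega
  · intro h; rw [← h] at ht; dsimp only at ht; omega

/-- A single cell of the vertical arm separates the cells above from those below. -/
theorem isVertexCut_arm_cell (hk : m - k = 1) (hm : 1 ≤ m) (hn : l < n) (hb : 2 ≤ b) (hbl : b ≤ l) :
    IsVertexCut (lShape m n k l) {(1, b)} := by
  refine isVertexCut_of_separation (fun v => v.2 < b) (u := (1, 1)) (v := (1, n)) ?_ ?_ ?_ ?_ ?_
  · simp only [Set.mem_sdiff, Set.mem_singleton_iff, mem_lShape, lCells, box, Prod.mk.injEq]; omega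
  · simp only [Set.mem_sdiff, Set.mem_singleton_iff, mem_lShape, lCells, box, Prod.mk.injEq]; omega
  · dsimp only; omega
  · dsimp only; omega
  · intro x hx y hy
    simp only [Set.mem_sdiff, Set.mem_singleton_iff, mem_lShape, lCells, box, Prod.ext_iff,
      Near] at *
    omega

/-- A single cell of a horizontal arm of height one separates the cells to its left from those to
its right. -/
theorem isVertexCut_row_cell (hk : m - k = 1) (hl : 1 ≤ l) (hn : n - l = 1) (ha : 2 ≤ a)
    (ham : a < m) : IsVertexCut (lShape m n k l) {(a, n)} := by
  refine isVertexCut_of_separation (fun v => v.1 < a) (u := (1, 1)) (v := (m, n)) ?_ ?_ ?_ ?_ ?_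
  · simp only [Set.mem_sdiff, Set.mem_singleton_iff, mem_lShape, lCells, box, Prod.mk.injEq]; omega
  · simp only [Set.mem_sdiff, Set.mem_singleton_iff, mem_lShape, lCells, box, Prod.mk.injEq]; omega
  · dsimp only; omega
  · dsimp only; omega
  · intro x hx y hy
    simp only [Set.mem_sdiff, Set.mem_singleton_iff, mem_lShape, lCells, box, Prod.ext_iff,
      Near] at *
    omega

theorem isVertexCut_row_pair {V : Set (ℤ × ℤ)} {y : ℤ} (h : ∀ v ∈ V, v.2 = y → v = s ∨ v = t)
    (hs : s.2 = y) (ht : t.2 = y) {u v : ℤ × ℤ} (hu : u ∈ V) (hv : v ∈ V) (huy : u.2 < y)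
    (hvy : y < v.2) : IsVertexCut V {s, t} := by
  refine isVertexCut_of_separation (fun v => v.2 < y) (u := u) (v := v) ⟨hu, ?_⟩ ⟨hv, ?_⟩ huy
    (by omega) ?_
  · rintro (rfl | rfl) <;> omega
  · rintro (rfl | rfl) <;> omega
  · rintro x - z ⟨hz, hz'⟩ hx hzy hn
    exact hz' (h z hz (by simp only [Near] at hn; omega))

theorem isVertexCut_column_pair {V : Set (ℤ × ℤ)} {x : ℤ} (h : ∀ v ∈ V, v.1 = x → v = s ∨ v = t)
    (hs : s.1 = x) (ht : t.1 = x) {u v : ℤ × ℤ} (hu : u ∈ V) (hv : v ∈ V) (hux : u.1 < x)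
    (hvx : x < v.1) : IsVertexCut V {s, t} := by
  refine isVertexCut_of_separation (fun v => v.1 < x) (u := u) (v := v) ⟨hu, ?_⟩ ⟨hv, ?_⟩ hux
    (by omega) ?_
  · rintro (rfl | rfl) <;> omega
  · rintro (rfl | rfl) <;> omega
  · rintro y - z ⟨hz, hz'⟩ hy hzy hn
    exact hz' (h z hz (by simp only [Near] at hn; omega))

/-- Both ends lie in the vertical arm. -/
theorem dichotomy_of_column (H : Instance m n k l s t) (hk : m - k = 1) (hs : s.2 ≤ l)
    (ht : t.2 ≤ l) (hst : s.2 < t.2) : Dichotomy m n k l s t := by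
  obtain ⟨h1, h2, h3, h4, h5, h6, h7, h8, -⟩ := H
  simp only [mem_lShape, lCells, box] at h7 h8
  obtain ⟨c, d⟩ := t
  obtain rfl : c = 1 := by dsimp only at *; omega
  dsimp only at *
  exact .inr ⟨.inl (.inr (.inl (isVertexCut_arm_cell hk (by omega) (by omega) (by omega) ht))), _,
    .inl (.ub1 ⟨hk, by omega, hs, ht⟩)⟩

/-- In a shape with two columns and a horizontal arm of height one, removing the last row leaves a
column. -/
theorem not_isVertexCut_bottom (hl : 1 ≤ l) (hn : n - l = 1) :
    ¬ IsVertexCut (lShape 2 n 1 l) {(1, n), (2, n)} := by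
  simp only [IsVertexCut, not_not]
  have HP := (ham_segment (x₁ := 1) (x₂ := l) 1 hl).tr
  refine preconnected_of_chain HP.chain fun v => ?_
  rw [show v = (v.1, v.2) from rfl, HP.mem]
  simp only [Set.mem_sdiff, Set.mem_insert_iff, Set.mem_singleton_iff, mem_lShape, lCells, box,
    Prod.mk.injEq]
  omega

theorem upperBound_bottom (hl : 1 < l) (hn : n - l = 1) :
    ∃ N, UpperBound 2 n 1 l (1, n) (2, n) N :=
  ⟨_, .ub4 ⟨by norm_num, hl, .inl ⟨by dsimp only; omega, by dsimp only; omega,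
    not_isVertexCut_bottom (by omega) hn⟩⟩⟩

/-- The first end lies in the vertical arm, the second one below it. -/
theorem dichotomy_of_descent (H : Instance m n k l s t) (hk : m - k = 1) (hs : s.2 ≤ l)
    (ht : l < t.2) : Dichotomy m n k l s t := by
  have H0 := H
  obtain ⟨h1, h2, h3, h4, h5, h6, h7, h8, h9⟩ := H
  obtain ⟨a, b⟩ := s
  obtain ⟨c, d⟩ := t
  rw [mem_lShape] at h7 h8
  have h7' := h7
  have h8' := h8
  simp only [lCells, box] at h7' h8'
  dsimp only at hs ht h7 h8
  obtain rfl : a = 1 := by omega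
  by_cases hb : b = 1
  · subst hb
    by_cases hn : 2 ≤ n - l
    · exact .inl ((ham_descentPath_high h1 hk hn le_rfl hs h8 ht).hasHamPath fun x y => by
        simp only [lCells, box]; omega)
    · have hn' : n - l = 1 := by omega
      obtain rfl : d = n := by omega
      by_cases hc : c = 1
      · subst hc
        by_cases hm : m = 2
        · exact .inl ((ham_descentPath_corner (m := m) hn' hs).hasHamPath fun x y => by
            simp only [lCells, box]; omega)
        · refine .inr ⟨.inr (.inl (f4_of_corner H0 hk hn' (by omega) rfl rfl)), ?_⟩
          by_cases hl : 1 < l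
          · exact ⟨_, .inl (.ub4 ⟨hk, hl, .inr (.inl ⟨hs, ht⟩)⟩)⟩
          · obtain rfl : l = 1 := by omega
            obtain rfl : d = 2 := by omega
            -- The reflected ends are the two lowest cells of `L(2, m; 1, k)`.
            obtain ⟨N, hN⟩ := upperBound_bottom (n := m) (l := k) (by omega) hk
            refine ⟨N, .inr (.inr (.inr ?_))⟩
            simpa [mirror] using hN
      · by_cases hcm : c = m
        · subst hcm
          exact .inl ((ham_descentPath_right (m := c) hn' hs (by omega)).hasHamPath fun x y => by
            simp only [lCells, box]; omega)
        · refine .inr ⟨.inl (.inr (.inl (isVertexCut_row_cell hk h4 hn' (by omega) (by omega)))), ?_⟩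
          by_cases hl : 1 < l
          · exact ⟨_, .inl (.ub4 ⟨hk, hl, .inr (.inl ⟨hs, ht⟩)⟩)⟩
          · exact ⟨_, .inr (.inr (.inl (.ub4 ⟨hn', by omega, .inr (.inr
              ⟨by simp only [mirror]; omega, by simp only [mirror]; omega⟩)⟩)))⟩
  · exact .inr ⟨.inl (.inl (isVertexCut_arm_cell hk (by omega) (by omega) (by omega) hs)), _,
      .inl (.ub4 ⟨hk, by omega, .inr (.inl ⟨hs, ht⟩)⟩)⟩

/-- Both ends lie in the horizontal arm, which has height one. -/
theorem dichotomy_of_row (H : Instance m n k l s t) (hk : m - k = 1) (hn : n - l = 1)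
    (hs : s.2 = n) (ht : t.2 = n) (hst : s.1 < t.1) : Dichotomy m n k l s t := by
  have H0 := H
  obtain ⟨h1, h2, h3, h4, h5, h6, h7, h8, h9⟩ := H
  obtain ⟨a, b⟩ := s
  obtain ⟨c, d⟩ := t
  rw [mem_lShape] at h7 h8
  simp only [lCells, box] at h7 h8
  dsimp only at hs ht hst
  obtain rfl := hs
  obtain rfl := ht
  by_cases hfull : l = 1 ∧ a = 1 ∧ c = m
  · obtain ⟨rfl, rfl, rfl⟩ := hfull
    exact .inl ((ham_rowPath_one (by omega)).hasHamPath fun x y => by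
      simp only [lCells, box]; omega)
  refine .inr ⟨?_, ?_⟩
  · by_cases hl : 1 < l
    · exact .inr (.inl (f4_of_low H0 hk hl (by dsimp only; omega) (by dsimp only; omega)))
    · by_cases ha : a = 1
      · exact .inl (.inr (.inl (isVertexCut_row_cell hk h4 hn (by omega) (by omega))))
      · exact .inl (.inl (isVertexCut_row_cell hk h4 hn (by omega) (by omega)))
  · by_cases ha : a = 1
    · subst ha
      by_cases hk1 : k = 1
      · subst hk1
        obtain rfl : m = 2 := by omega
        obtain rfl : c = 2 := by omega
        obtain ⟨N, hN⟩ := upperBound_bottom (n := d) (l := l) (by omega) hn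
        exact ⟨N, .inl hN⟩
      · refine ⟨_, .inr (.inr (.inl (.ub3 ⟨hn, hk, by omega, by simp only [mirror]; omega,
          by simp only [mirror]; omega, ?_, ?_⟩)))⟩
        · simp only [mirror]
          rw [max_eq_left (by omega)]; omega
        · simp only [mirror]
          rw [min_eq_right (by omega)]; omega
    · exact ⟨_, .inr (.inr (.inl (.ub1 ⟨hn, by omega, by simp only [mirror]; omega,
        by simp only [mirror]; omega⟩)))⟩

/-- If the rows from `l` on minus the ends are connected, then so is the whole graph minus the
ends. -/
theorem not_isVertexCut_of_low (hl : 1 ≤ l) (hln : l < n) (hk : m - k = 1) (hm : 1 ≤ m)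
    (hs : l < s.2) (ht : l < t.2) {p : List (ℤ × ℤ)} (hp : p.IsChain Near)
    (hmem : ∀ v, v ∈ p ↔ (lCells m n k l v.1 v.2 ∧ l ≤ v.2) ∧ v ≠ s ∧ v ≠ t) :
    ¬ IsVertexCut (lShape m n k l) {s, t} := by
  simp only [IsVertexCut, not_not]
  have HQ := (ham_segment (x₁ := 1) (x₂ := l) 1 hl).tr
  have hns : ∀ v : ℤ × ℤ, v.2 ≤ l → v ≠ s ∧ v ≠ t := fun v hv =>
    ⟨by rintro rfl; omega, by rintro rfl; omega⟩
  refine preconnected_of_two_chains hp HQ.chain (c := (1, l)) ((hmem _).2 ⟨?_, hns _ le_rfl⟩)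
    ((HQ.mem 1 l).2 ?_) fun v => ?_
  · simp only [lCells, box]; omega
  · simp only [box]; omega
  · rw [hmem, show v = (v.1, v.2) from rfl, HQ.mem]
    simp only [Set.mem_sdiff, Set.mem_insert_iff, Set.mem_singleton_iff, mem_lShape, not_or]
    constructor
    · rintro ⟨h1, h2⟩
      by_cases hv : l ≤ v.2
      · exact .inl ⟨⟨h1, hv⟩, h2⟩
      · right
        simp only [lCells, box] at *; omega
    · rintro (⟨⟨h1, -⟩, h2⟩ | h)
      · exact ⟨h1, h2⟩
      · simp only [box] at h
        exact ⟨by simp only [lCells, box]; omega, hns _ (by dsimp only; omega)⟩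

/-- The ends are diagonal neighbours at the left end of a horizontal arm of height two. -/
theorem dichotomy_of_diagonal (H : Instance m n k l (1, b) (2, d)) (hk : m - k = 1)
    (hn : n - l = 2) (hm : 3 ≤ m) (h : b = l + 1 ∧ d = l + 2 ∨ b = l + 2 ∧ d = l + 1) :
    Dichotomy m n k l (1, b) (2, d) := by
  have H0 := H
  obtain ⟨h1, h2, h3, h4, h5, h6, -, -, -⟩ := H
  obtain rfl : n = l + 2 := by omega
  right
  by_cases hl : 1 < l
  · refine ⟨.inr (.inl (f4_of_low H0 hk hl (by dsimp only; omega) (by dsimp only; omega))), _,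
      .inl (.ub4 ⟨hk, hl, .inl ⟨by dsimp only; omega, by dsimp only; omega, ?_⟩⟩)⟩
    rcases h with ⟨rfl, rfl⟩ | ⟨rfl, rfl⟩
    · have HP : Ham (box 3 m (l + 1) (l + 2)) 3 (l + 1) 3 (l + 2)
          (boxPath 3 m (l + 1) (l + 2) 3 (l + 1) 3 (l + 2)) :=
        ham_boxPath (by unfold RectOK box; omega)
      -- A walk is enough here, and this one visits `(2, l + 1)` twice.
      refine not_isVertexCut_of_low h4 (by omega) hk (by omega) (by dsimp only; omega)
        (by dsimp only; omega) (p := [(1, l), (2, l + 1), (1, l + 2), (2, l + 1)] ++ boxPath _ _ _ _ _ _ _ _)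
        (List.isChain_append.2 ⟨?_, HP.chain, ?_⟩) ?_
      · simp [Near]
      · rw [HP.head]; simp [Near]; omega
      · rintro ⟨x, y⟩
        rw [List.mem_append, HP.mem]
        simp only [List.mem_cons, List.not_mem_nil, or_false, Prod.mk.injEq, lCells, box, ne_eq]
        omega
    · have HP : Ham (box 3 m (l + 1) (l + 2)) 3 (l + 2) 3 (l + 1)
          (boxPath 3 m (l + 1) (l + 2) 3 (l + 2) 3 (l + 1)) :=
        ham_boxPath (by unfold RectOK box; omega)
      refine not_isVertexCut_of_low h4 (by omega) hk (by omega) (by dsimp only; omega)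
        (by dsimp only; omega) (p := [(1, l), (1, l + 1), (2, l + 2)] ++ boxPath _ _ _ _ _ _ _ _)
        (List.isChain_append.2 ⟨?_, HP.chain, ?_⟩) ?_
      · simp [Near]
      · rw [HP.head]; simp [Near]
      · rintro ⟨x, y⟩
        rw [List.mem_append, HP.mem]
        simp only [List.mem_cons, List.not_mem_nil, or_false, Prod.mk.injEq, lCells, box, ne_eq]
        omega
  · obtain rfl : l = 1 := by omega
    have hF : F5Std m (1 + 2) k 1 (1, b) (2, d) := by
      refine ⟨hk, hn, rfl, by omega, ?_⟩
      rcases h with ⟨rfl, rfl⟩ | ⟨rfl, rfl⟩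
      · exact .inl rfl
      · exact .inr rfl
    exact ⟨.inr (.inr (.inl hF)), _, .inl (.f5 hF)⟩

/-- The ends are the two leftmost cells of the first row of the horizontal arm. -/
theorem dichotomy_of_top (H : Instance m n k l (1, l + 1) (2, l + 1)) (hk : m - k = 1)
    (hn : 2 ≤ n - l) : Dichotomy m n k l (1, l + 1) (2, l + 1) := by
  have H0 := H
  obtain ⟨h1, h2, h3, h4, h5, h6, -, -, -⟩ := H
  refine .inr ⟨?_, ?_⟩
  · refine .inl (.inr (.inr (isVertexCut_of_separation (fun v => v.2 ≤ l) (u := (1, l))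
      (v := (1, n)) ?_ ?_ ?_ ?_ ?_)))
    · simp only [Set.mem_sdiff, Set.mem_insert_iff, Set.mem_singleton_iff, mem_lShape, lCells, box,
        Prod.mk.injEq]; omega
    · simp only [Set.mem_sdiff, Set.mem_insert_iff, Set.mem_singleton_iff, mem_lShape, lCells, box,
        Prod.mk.injEq]; omega
    · dsimp only; omega
    · dsimp only; omega
    · intro x hx y hy
      simp only [Set.mem_sdiff, Set.mem_insert_iff, Set.mem_singleton_iff, mem_lShape, lCells, box,
        Prod.ext_iff, Near] at *
      omega
  · by_cases hm : m = 2
    · exact ⟨_, .inl (.ub6b ⟨hm, by omega, le_rfl, rfl, by dsimp only; omega⟩)⟩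
    · exact ⟨_, .inl (.ub5 ⟨by omega, hk, by omega, rfl, rfl⟩)⟩

/-- Both ends lie in the horizontal arm, which has height at least two. -/
theorem dichotomy_of_low (H : Instance m n k l s t) (hk : m - k = 1) (hn : 2 ≤ n - l)
    (hs : l < s.2) (ht : l < t.2) : Dichotomy m n k l s t := by
  have H0 := H
  obtain ⟨h1, h2, h3, h4, h5, h6, h7, h8, h9⟩ := H
  obtain ⟨a, b⟩ := s
  obtain ⟨c, d⟩ := t
  have h7' := h7
  have h8' := h8
  simp only [mem_lShape, lCells, box] at h7 h8
  dsimp only at hs ht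
  by_cases hB : BumpOK m (n - l) a (b - l) c (d - l)
  · have HB := ham_bumpLow hB
    clear hB
    have e : ∀ x y, (box 1 m (l + 1) (l + (n - l)) x y ∨ x = 1 ∧ y = l) ↔
        lCells m n k l x y ∧ l ≤ y := fun x y => by simp only [lCells, box]; omega
    by_cases hl : 1 < l
    · refine .inr ⟨.inr (.inl (f4_of_low H0 hk hl hs ht)), _,
        .inl (.ub4 ⟨hk, hl, .inl ⟨hs, ht, ?_⟩⟩)⟩
      have HS := HB.isSTPath (V := lShape m n k l) fun x y h => ((e x y).1 h).1
      refine not_isVertexCut_of_low h4 (by omega) hk (by omega) hs ht HS.chain_inner fun v => ?_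
      rw [HS.mem_inner_iff h9, show v ∈ bumpLow m (n - l) l a b c d ↔ _ from HB.mem v.1 v.2, e]
    · exact .inl (HB.hasHamPath fun x y => by rw [e]; simp only [lCells, box]; omega)
  rw [ne_eq, Prod.mk.injEq] at h9
  have hE := exceptions_of_not_bumpOK (w := m) (h := n - l) h1 hn (by unfold box; omega)
    (by unfold box; omega) (by omega) hB
  clear hB
  rcases hE with ⟨rfl, e1, e2, e3⟩ | ⟨e1, rfl, e2, e3⟩ | ⟨h4, h5, ⟨rfl, rfl⟩ | ⟨rfl, rfl⟩⟩ |
    ⟨h4, h5, h6 | h6⟩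
  · obtain rfl : b = d := by omega
    refine .inr ⟨.inl (.inr (.inr (isVertexCut_row_pair (y := b) (fun v hv hvb => ?_) rfl rfl
      (u := (1, 1)) (v := (1, n)) ?_ ?_ ?_ ?_))), _,
      .inl (.ub6b ⟨rfl, by omega, by dsimp only; omega, rfl, by dsimp only; omega⟩)⟩
    · have hac : a ≠ c := by rintro rfl; exact h9 ⟨rfl, rfl⟩
      simp only [mem_lShape, lCells, box, Prod.ext_iff] at *; omega
    · simp only [mem_lShape, lCells, box]; omega
    · simp only [mem_lShape, lCells, box]; omega
    · dsimp only; omega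
    · dsimp only; omega
  · refine .inr ⟨?_, _, .inl (.ub6c ⟨e1, by omega, by dsimp only; omega, rfl, by dsimp only; omega⟩)⟩
    by_cases hl : 1 < l
    · exact .inr (.inl (f4_of_low H0 hk hl hs ht))
    refine .inl (.inr (.inr (isVertexCut_column_pair (x := a) (fun v hv hvb => ?_) rfl rfl
      (u := (1, n)) (v := (m, n)) ?_ ?_ ?_ ?_)))
    · have hbd : b ≠ d := by rintro rfl; exact h9 ⟨rfl, rfl⟩
      simp only [mem_lShape, lCells, box, Prod.ext_iff] at *; omega
    · simp only [mem_lShape, lCells, box]; omega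
    · simp only [mem_lShape, lCells, box]; omega
    · dsimp only; omega
    · dsimp only; omega
  · obtain rfl : b = l + 1 := by omega
    obtain rfl : d = l + 1 := by omega
    exact dichotomy_of_top H0 hk hn
  · obtain rfl : b = l + 1 := by omega
    obtain rfl : d = l + 1 := by omega
    exact (dichotomy_of_top H0.symm hk hn).symm
  · obtain ⟨rfl, rfl⟩ : a = 1 ∧ c = 2 := by omega
    exact dichotomy_of_diagonal H0 hk h4 h5 (by omega)
  · obtain ⟨rfl, rfl⟩ : a = 2 ∧ c = 1 := by omega
    exact (dichotomy_of_diagonal H0.symm hk h4 h5 (by omega)).symm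

theorem dichotomy_narrow (H : Instance m n k l s t) (hk : m - k = 1) : Dichotomy m n k l s t := by
  have h6 := H.6
  have h7 := H.7
  have h8 := H.8
  have h9 := H.9
  simp only [mem_lShape, lCells, box] at h7 h8
  rw [ne_eq, Prod.ext_iff] at h9
  by_cases hs : s.2 ≤ l <;> by_cases ht : t.2 ≤ l
  · by_cases hst : s.2 < t.2
    · exact dichotomy_of_column H hk hs ht hst
    · exact (dichotomy_of_column H.symm hk ht hs (by omega)).symm
  · exact dichotomy_of_descent H hk hs (by omega)
  · exact (dichotomy_of_descent H.symm hk ht (by omega)).symm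
  · by_cases hn : 2 ≤ n - l
    · exact dichotomy_of_low H hk hn (by omega) (by omega)
    · by_cases hst : s.1 < t.1
      · exact dichotomy_of_row H hk (by omega) (by omega) (by omega) hst
      · exact (dichotomy_of_row H.symm hk (by omega) (by omega) (by omega) (by omega)).symm

/-! ### The dichotomy in general -/

/-- Both arms have width at least two, and the ends form a full row of the vertical arm. -/
theorem dichotomy_of_armPair (H : Instance m n k l s t) (hk : m - k = 2) (hn : 2 ≤ n - l)
    (hst : s.2 = t.2) (hs : 2 ≤ s.2) (hsl : s.2 ≤ l) : Dichotomy m n k l s t := by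
  obtain ⟨h1, h2, h3, h4, h5, h6, h7, h8, h9⟩ := H
  refine .inr ⟨.inl (.inr (.inr (isVertexCut_row_pair (y := s.2) (fun v hv hvb => ?_) rfl hst.symm
    (u := (1, 1)) (v := (1, n)) ?_ ?_ ?_ ?_))), _,
    .inl (.ub6a ⟨by omega, hk, by omega, hs, hst, hsl⟩)⟩
  · simp only [mem_lShape, lCells, box, Prod.ext_iff, ne_eq] at *; omega
  · simp only [mem_lShape, lCells, box]; omega
  · simp only [mem_lShape, lCells, box]; omega
  · dsimp only; omega
  · dsimp only; omega

theorem dichotomy (H : Instance m n k l s t) : Dichotomy m n k l s t := by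
  by_cases hk : m - k = 1
  · exact dichotomy_narrow H hk
  by_cases hn : n - l = 1
  · have := (dichotomy_narrow H.mirror hn).mirror
    rwa [mirror_mirror, mirror_mirror] at this
  obtain ⟨h1, h2, h3, h4, h5, h6, h7, h8, h9⟩ := id H
  by_cases ha : m - k = 2 ∧ s.2 = t.2 ∧ 2 ≤ s.2 ∧ s.2 ≤ l
  · exact dichotomy_of_armPair H ha.1 (by omega) ha.2.1 ha.2.2.1 ha.2.2.2
  by_cases hb : n - l = 2 ∧ s.1 = t.1 ∧ m - k + 1 ≤ s.1 ∧ s.1 ≤ m - 1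
  · have := (dichotomy_of_armPair H.mirror hb.1 (by omega) (by simp only [mirror]; omega)
      (by simp only [mirror]; omega) (by simp only [mirror]; omega)).mirror
    rwa [mirror_mirror, mirror_mirror] at this
  · rw [mem_lShape] at h7 h8
    rw [ne_eq, Prod.ext_iff] at h9
    exact .inl ((ham_lPath ⟨by omega, by omega, h3, h4, h7, h8, h9, ha, hb⟩).hasHamPath
      fun x y => Iff.rfl)

theorem exists_isLongest (H : Instance m n k l s t) :
    ∃ p, IsLongestSTPath (lShape m n k l) s t p :=
  ⟨_, isLongest_longestPath (a := s.1) (b := s.2) (c := t.1) (d := t.2) H⟩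

end
end Supergrid

theorem theorem4 :
    (∃ (P : RAM.Prog) (C : ℕ), ∀ (m n k l : ℤ) (s t : ℤ × ℤ),
      Supergrid.Instance m n k l s t →
        ∃ (p : List (ℤ × ℤ)) (T : ℕ) (τ : RAM.State),
          Supergrid.IsLongestSTPath (Supergrid.lShape m n k l) s t p ∧
          RAM.Exec (C * (m * n)) P
            (RAM.State.init [m, n, k, l, s.1, s.2, t.1, t.2]) T τ ∧
          (T : ℤ) ≤ C * (m * n) ∧
          τ.out = p.flatMap (fun v => [v.1, v.2])) ∧
    (∀ (m n k l : ℤ) (s t : ℤ × ℤ), Supergrid.Instance m n k l s t →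
      ((¬ Supergrid.F1 m n k l s t ∧ ¬ Supergrid.F4 m n k l s t ∧ ¬ Supergrid.F5 m n k l s t) →
        ∃ p, Supergrid.IsLongestSTPath (Supergrid.lShape m n k l) s t p ∧
          (p.length : ℤ) = m * n - k * l) ∧
      ((Supergrid.F1 m n k l s t ∨ Supergrid.F4 m n k l s t ∨ Supergrid.F5 m n k l s t) →
        ∃ N, Supergrid.UpperBoundIso m n k l s t N) ∧
      (∀ N, Supergrid.UpperBoundIso m n k l s t N →
        ∃ p, Supergrid.IsLongestSTPath (Supergrid.lShape m n k l) s t p ∧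
          (p.length : ℤ) = N)) := by
  refine ⟨RAM.exists_program, fun m n k l s t H => ⟨fun h => ?_, fun h => ?_, fun N hN => ?_⟩⟩
  · refine ((Supergrid.dichotomy H).resolve_right fun h' => ?_).exists_isLongest H
    exact h'.1.elim h.1 fun h' => h'.elim h.2.1 h.2.2
  · rcases Supergrid.dichotomy H with hH | hU
    · rcases h with h | h | h | h
      · exact absurd h (hH.not_f1 H.9)
      · exact absurd h hH.not_f4
      · exact ⟨_, .inl (.f5 h)⟩
      · exact ⟨_, .inr (.inr (.inl (.f5 h)))⟩
    · exact hU.2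
  · obtain ⟨p, hp⟩ := Supergrid.exists_isLongest H
    exact ⟨p, hp, hN.length_eq H hp⟩
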